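/- Let $n\ge 1$, let $\mathbb D^n$ be the unit polydisc in $\mathbb C^n$, $\mathbb T^n$ the torus $\{\xi\in\mathbb C^n:|\xi_1|=\dots=|\xi_n|=1\}$ with normalized Lebesgue measure $d\xi$, $I=[0,1)$, and let $H(\mathbb D^n)$ be the space of holomorphic functions on $\mathbb D^n$. For $r\in I^n$, $\xi\in\mathbb T^n$ and $\gamma\in\mathbb R$ write $r\xi=(r_1\xi_1,\dots,r_n\xi_n)$ and $(1-r)^\gamma=\prod_{j=1}^n(1-r_j)^\gamma$. For $0<p,q<\infty$, $\alpha>0$, $f\in H(\mathbb D^n)$ put $M_p(f,r)=\big(\int_{\mathbb T^n}|f(r\xi)|^p\,d\xi\big)^{1/p}$ and $$A^{p,q}_\alpha(\mathbb D^n)=\Big\{f\in H(\mathbb D^n):\int_{I^n}M_p(f,R)^q(1-R)^{\alpha q-1}\,dR<\infty\Big\},$$ $$F^{p,q}_\alpha(\mathbb D^n)=\Big\{f\in H(\mathbb D^n):\int_{\mathbb T^n}\Big(\int_{I^n}|f(R\xi)|^q(1-R)^{\alpha q-1}\,dR\Big)^{p/q}d\xi<\infty\Big\}.$$ For $f(z)=\sum_{k\in\mathbb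 Z_+^n}a_kz^k$ in $H(\mathbb D^n)$ and $m \in \mathbb N$ let $$D^mf(z)=\sum_{k\in\mathbb Z_+^n}\Big(\prod_{j=1}^n\frac{\Gamma(k_j+m+1)}{\Gamma(m+1)\Gamma(k_j+1)}\Big)a_kz^k .$$ For $X,Y\subset H(\mathbb D^n)$ let $M_T(X,Y)$ be the set of all families $\{c_k\}_{k\in\mathbb Z_+^n}$ of complex numbers such that for every $f(z)=\sum_k a_kz^k$ in $X$ the function $h(z)=\sum_k c_ka_kz^k$ belongs to $Y$. **Theorem.** Let $g\in H(\mathbb D^n)$, $g(z)=\sum_{k\in\mathbb Z_+^n}c_kz^k$. Let $p,q,\alpha,\beta>0$, $t\le 1$, $\frac t2<s\le t$, $\max(p,q)\le s$, $\beta+\frac1t<\alpha+\frac1p<\frac2t$, and let $m\in\mathbb N$ with $m>\frac2t-1$. Then: $1^\circ$ $\{c_k\}\in M_T(F^{p,q}_\alpha(\mathbb D^n),F^{t,s}_\beta(\mathbb D^n))$ if and only if $$\sup_{r\in I^n}M_t(D^mg,r)\,(1-r)^{m+1-\frac1p+\beta-\alpha}<\infty.$$ $2^\circ$ $\{c_k\}\in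 M_T(A^{p,q}_\alpha(\mathbb D^n),F^{t,s}_\beta(\mathbb D^n))$ if and only if $$\sup_{r\in I^n}M_t(D^mg,r)\,(1-r)^{m+1-\frac1p+\beta-\alpha}<\infty.$$ -/

import Mathlib

open MeasureTheory Set
open scoped ENNReal

noncomputable section

/-- The unit polydisc `𝔻ⁿ` in `ℂⁿ`. -/
def polydisc (n : ℕ) : Set (Fin n → ℂ) := {z | ∀ i, ‖z i‖ < 1}

/-- The cube `Iⁿ = [0, 1)ⁿ` of multi-radii. -/
def radii (n : ℕ) : Set (Fin n → ℝ) := {r | ∀ i, 0 ≤ r i ∧ r i < 1}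

/-- The monomial `z ^ k = z₁ ^ k₁ ⋯ zₙ ^ kₙ`. -/
def monom {n : ℕ} (k : Fin n → ℕ) (z : Fin n → ℂ) : ℂ := ∏ i, z i ^ k i

/-- The point `r ξ = (r₁ ξ₁, …, rₙ ξₙ)`, where `ξ ∈ 𝕋ⁿ` has the coordinates `ξⱼ = exp (2 π i θⱼ)`.
The torus `𝕋ⁿ` is parametrised by `θ ∈ (ℝ / ℤ)ⁿ`, whose `volume` is the normalised Lebesgue
measure (a product of probability measures). -/
def torusPoint {n : ℕ} (r : Fin n → ℝ) (θ : UnitAddTorus (Fin n)) : Fin n → ℂ :=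
  fun i => (r i : ℂ) * (AddCircle.toCircle (θ i) : ℂ)

/-- The weight `(1 - r) ^ γ = (1 - r₁) ^ γ ⋯ (1 - rₙ) ^ γ`, as an extended nonnegative number;
only used for `r ∈ [0, 1)ⁿ`. -/
def weight {n : ℕ} (γ : ℝ) (r : Fin n → ℝ) : ℝ≥0∞ := ENNReal.ofReal (∏ i, (1 - r i) ^ γ)

/-- The space `H(𝔻ⁿ)` of functions holomorphic in the polydisc (values elsewhere are
irrelevant). -/
def holo (n : ℕ) : Set ((Fin n → ℂ) → ℂ) := {f | DifferentiableOn ℂ f (polydisc n)}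

/-- `f(z) = ∑ₖ aₖ z ^ k` for all `z` in the polydisc, with unconditional (equivalently, absolute)
convergence. -/
def HasExpansion {n : ℕ} (f : (Fin n → ℂ) → ℂ) (a : (Fin n → ℕ) → ℂ) : Prop :=
  ∀ z ∈ polydisc n, HasSum (fun k => a k * monom k z) (f z)

/-- The fractional derivative `D ^ β f` of the function `f(z) = ∑ₖ aₖ z ^ k`, namely
`D ^ β f (z) = ∑ₖ (∏ⱼ Γ(kⱼ + β + 1) / (Γ(β + 1) Γ(kⱼ + 1))) aₖ z ^ k`,
given through the expansion coefficients `a` of `f`. -/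
def fracDeriv {n : ℕ} (β : ℝ) (a : (Fin n → ℕ) → ℂ) (z : Fin n → ℂ) : ℂ :=
  ∑' k : Fin n → ℕ,
    ((∏ i, Real.Gamma ((k i : ℝ) + β + 1) /
      (Real.Gamma (β + 1) * Real.Gamma ((k i : ℝ) + 1)) : ℝ) : ℂ) * a k * monom k z

/-- The integral mean `M_p(f, r) = (∫_{𝕋ⁿ} |f(r ξ)| ^ p dξ) ^ (1 / p)`, for `0 < p < ∞`. -/
def integralMean {n : ℕ} (p : ℝ) (f : (Fin n → ℂ) → ℂ) (r : Fin n → ℝ) : ℝ≥0∞ :=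
  (∫⁻ θ : UnitAddTorus (Fin n), ‖f (torusPoint r θ)‖ₑ ^ p) ^ (1 / p)

/-- The mixed norm space `A^{p,q}_α(𝔻ⁿ)`: the `f ∈ H(𝔻ⁿ)` with
`∫_{Iⁿ} M_p(f, R) ^ q (1 - R) ^ (α q - 1) dR < ∞`. -/
def mixedNormSpace (n : ℕ) (p q α : ℝ) : Set ((Fin n → ℂ) → ℂ) :=
  {f | f ∈ holo n ∧
    ∫⁻ R in radii n, integralMean p f R ^ q * weight (α * q - 1) R < ⊤}

/-- The Lizorkin–Triebel space `F^{p,q}_α(𝔻ⁿ)`: the `f ∈ H(𝔻ⁿ)` with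
`∫_{𝕋ⁿ} (∫_{Iⁿ} |f(R ξ)| ^ q (1 - R) ^ (α q - 1) dR) ^ (p / q) dξ < ∞`. -/
def lizorkinTriebelSpace (n : ℕ) (p q α : ℝ) : Set ((Fin n → ℂ) → ℂ) :=
  {f | f ∈ holo n ∧
    ∫⁻ θ : UnitAddTorus (Fin n),
      (∫⁻ R in radii n, ‖f (torusPoint R θ)‖ₑ ^ q * weight (α * q - 1) R) ^ (p / q) < ⊤}

/-- The coefficient multipliers `M_T(X, Y)`: the families `c` such that for every
`f(z) = ∑ₖ aₖ z ^ k` in `X` the function `h(z) = ∑ₖ cₖ aₖ z ^ k` is in `Y`. -/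
def coeffMultipliers {n : ℕ} (X Y : Set ((Fin n → ℂ) → ℂ)) : Set ((Fin n → ℕ) → ℂ) :=
  {c | ∀ f ∈ X, ∀ a, HasExpansion f a → ∃ h ∈ Y, HasExpansion h (fun k => c k * a k)}

end

/-!
The proof discretizes everything at the centres `ρ_j` (`boxMid j`) of the dyadic boxes
`∏ᵢ [1 - 2^(-jᵢ), 1 - 2^(-jᵢ-1))`, `j ∈ ℕⁿ`, which tile the cube of multi-radii; `dyad j a` is
the weight `2^(-a|j|)`.

*The spaces.* For every `p > 0` the function `|f|^p` is subharmonic in each variable. This gives a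
sub-mean value inequality over dyadic boxes (`enorm_rpow_le_lintegral_box`) and the monotonicity of
the integral means in the radii (`powerMean_mono`). Consequently `f ∈ A^{p,q}_α` if and only if
`∑_j 2^(-αq|j|) M_p(f, ρ_j)^q` is finite (`mem_mixedNormSpace_iff`, `dyadicNorm`), one has
`F^{p,q}_α ⊆ A^{p,max(p,q)}_α` (`dyadicNorm_lt_top_of_mem_lizorkinTriebelSpace`) and, for `s ≤ t`,
`A^{t,s}_β ⊆ F^{t,s}_β` (`mem_lizorkinTriebelSpace_of_dyadicNorm`). For `p ≤ t` the mean `M_t` at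
`ρ_j` is at most `2^(|j|(1/p - 1/t))` times `M_p` at the next dyadic radius, up to a constant
(`powerMean_le_powerMean_rpow`).

*Sufficiency.* Let `G = D^m g`. The Beta integral and the convolution on the torus represent the
Hadamard product `h` of `g` and `f` as
`h(r ξ) = ∫ ∏ᵢ m (1 - xᵢ)^(m-1) ∫ G(√x η) f(√x r ξ η⁻¹) dη dx` (`hadamard_eq_integral`,
`integral_mul_eq_hadamard`). The inner integrand has the modulus of a holomorphic function at `√x η`
(`exists_holo_powerMean_eq_crossMean`), so that the comparison of `M_1` with `M_t`, `t ≤ 1`, applies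
to it. Taking `t`-th powers and integrating in `ξ` separates `G` from `f`
(`exists_powerMean_hadamard_le`). With the growth condition on `G` there remains the sum
`∑_j 2^(-d|j|) M_t(f, ρ_{min(i,j)})^t` for the mean of `h` at `ρ_i`, where
`d = t (α + 1/p - β - 1/t)` is positive. Summing over `i` and `j` against geometric weights and
returning from `M_t` to `M_p` bounds the `A^{t,s}_β` norm of `h` by the `A^{p,s}_α` norm of `f`
(`dyadicNorm_hadamard_lt_top`), and `A^{p,τ}_α ⊆ A^{p,s}_α` for `τ ≤ s`.

*Necessity.* The test functions `∏ᵢ (1 - rᵢ zᵢ)^(-(m+1))` with `r = ρ_j` are mapped by the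
multiplier to the dilations `z ↦ G(r z)`. Their norms are at most a constant times
`2^(|j|(m+1-α-1/p))`, since `m + 1 > α + 1/p` (`exists_dyadicNorm_kernelFun_le`). If the growth
condition failed, there would be a sequence of test functions, normalized and multiplied by
summable amplitudes, whose images have means that are too large. All superpositions with
coefficients selected by a 0-1 sequence still lie in the source space
(`testSeries_mem_mixedNormSpace`, `testSeries_mem_lizorkinTriebelSpace`), and their images lie in
`F^{t,s}_β`, whose elements satisfy `M_t(h, ρ_j) = O(2^(β|j|))`. By the Baire category theorem on
`{0,1}^ℕ` this bound is uniform on an open set, and flipping a single entry there gives a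
contradiction (`exists_powerMean_mul_dyad_le`). The monotonicity of the means passes from dyadic to
arbitrary radii (`iSup_lt_top_of_powerMean_le`).
-/

noncomputable section

/-! ### Sub-mean value inequalities in one variable -/

/-- The logarithm of `‖f‖` is subharmonic (a consequence of Jensen's formula). -/
theorem log_norm_le_circleAverage {f : ℂ → ℂ} {c : ℂ} {R : ℝ} (hR : 0 < R)
    (hf : AnalyticOnNhd ℂ f (Metric.closedBall c R)) (hc : f c ≠ 0) :
    Real.log ‖f c‖ ≤ Real.circleAverage (Real.log ‖f ·‖) c R := by
  have hf' : AnalyticOnNhd ℂ f (Metric.closedBall c |R|) := by rwa [abs_of_pos hR]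
  rw [hf'.circleAverage_log_norm hR.ne' hc]
  have : 0 ≤ ∑ᶠ u, MeromorphicOn.divisor f (Metric.closedBall c |R|) u *
      Real.log (R * ‖c - u‖⁻¹) := by
    refine finsum_nonneg fun u => ?_
    by_cases hu : u ∈ Metric.closedBall c |R|
    · refine mul_nonneg ?_ ?_
      · exact_mod_cast (MeromorphicOn.AnalyticOnNhd.divisor_nonneg hf') u
      · rcases eq_or_ne c u with rfl | hne
        · simp
        · apply Real.log_nonneg
          have : 0 < ‖c - u‖ := norm_pos_iff.2 (sub_ne_zero.2 hne)
          rw [← div_eq_mul_inv, one_le_div this]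
          rw [mem_closedBall_iff_norm, abs_of_pos hR, norm_sub_rev] at hu
          exact hu
    · simp [hu]
  linarith

/-- For every `p > 0` the function `‖f‖ ^ p` is subharmonic: Jensen's inequality for `exp`,
applied to `p log ‖f‖`. -/
theorem norm_rpow_le_circleAverage {f : ℂ → ℂ} {c : ℂ} {R p : ℝ} (hR : 0 < R) (hp : 0 < p)
    (hf : AnalyticOnNhd ℂ f (Metric.closedBall c R)) :
    ‖f c‖ ^ p ≤ Real.circleAverage (fun z => ‖f z‖ ^ p) c R := by
  by_cases hc : f c = 0
  · rw [hc, norm_zero, Real.zero_rpow hp.ne']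
    refine Real.circleAverage_nonneg_of_nonneg fun x _ => by positivity
  have hfs : AnalyticOnNhd ℂ f (Metric.closedBall c |R|) := by rwa [abs_of_pos hR]
  set A := Real.circleAverage (Real.log ‖f ·‖) c R with hA
  have hlog := log_norm_le_circleAverage hR hf hc
  have hint : CircleIntegrable (Real.log ‖f ·‖) c R :=
    MeromorphicOn.circleIntegrable_log_norm (hfs.mono Metric.sphere_subset_closedBall).meromorphicOn
  have hint2 : CircleIntegrable (fun z => ‖f z‖ ^ p) c R := by
    apply ContinuousOn.circleIntegrable hR.le
    exact ((hf.continuousOn.mono Metric.sphere_subset_closedBall).norm).rpow_const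
      (fun x _ => Or.inr hp.le)
  -- the junk value `log 0 = 0` is replaced by one for which the tangent line estimate holds
  set L : ℂ → ℝ := fun z => if f z = 0 then A - 1 / p else Real.log ‖f z‖ with hL
  have hcod : (Real.log ‖f ·‖) =ᶠ[Filter.codiscreteWithin (Metric.sphere c |R|)] L := by
    have h1 : f ⁻¹' {0}ᶜ ∈ Filter.codiscreteWithin (Metric.closedBall c |R|) :=
      hfs.preimage_zero_mem_codiscreteWithin hc (by simp)
        ((convex_closedBall c |R|).isConnected ⟨c, by simp⟩)
    filter_upwards [Filter.codiscreteWithin_mono Metric.sphere_subset_closedBall h1] with z hz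
    simp only [mem_preimage, mem_compl_iff, mem_singleton_iff] at hz
    simp [L, hz]
  have hLint : CircleIntegrable L c R := hint.congr_codiscreteWithin hcod
  have hLA : Real.circleAverage L c R = A :=
    (Real.circleAverage_congr_codiscreteWithin hcod hR.ne').symm
  set E := Real.exp (p * A)
  have hpt : ∀ z ∈ Metric.sphere c |R|, (E * p) • L z + E * (1 - p * A) ≤ ‖f z‖ ^ p := by
    intro z _
    by_cases hz : f z = 0
    · simp only [L, hz, if_true, norm_zero, smul_eq_mul, Real.zero_rpow hp.ne']
      field_simp
      linarith
    · simp only [L, hz, if_false, smul_eq_mul]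
      have hpos : 0 < ‖f z‖ := norm_pos_iff.2 hz
      rw [Real.rpow_def_of_pos hpos]
      have := Real.add_one_le_exp (Real.log ‖f z‖ * p - p * A)
      have h2 : Real.exp (Real.log ‖f z‖ * p) = E * Real.exp (Real.log ‖f z‖ * p - p * A) := by
        rw [← Real.exp_add]; congr 1; ring
      rw [h2]
      nlinarith [Real.exp_pos (p * A)]
  have hmono := Real.circleAverage_mono (f₁ := fun z => (E * p) • L z + E * (1 - p * A))
    (by
      apply CircleIntegrable.add
      · exact hLint.const_smul
      · exact circleIntegrable_const _ _ _) hint2 hpt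
  rw [Real.circleAverage_fun_add (f₁ := fun z => (E * p) • L z) (hLint.const_smul)
    (circleIntegrable_const _ _ _), Real.circleAverage_fun_smul,
    Real.circleAverage_const, hLA] at hmono
  refine le_trans ?_ hmono
  have : ‖f c‖ ^ p ≤ E := by
    rw [Real.rpow_def_of_pos (norm_pos_iff.2 hc)]
    apply Real.exp_le_exp.2
    rw [mul_comm]
    gcongr
  simp only [smul_eq_mul]
  linarith [this]

/-- The sub-mean value inequality over a circle, as a Lebesgue integral in polar coordinates. -/
theorem enorm_rpow_le_lintegral_circle {f : ℂ → ℂ} {c : ℂ} {R p : ℝ} (hR : 0 < R) (hp : 0 < p)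
    (hf : AnalyticOnNhd ℂ f (Metric.closedBall c R)) :
    ENNReal.ofReal (2 * Real.pi) * ‖f c‖ₑ ^ p ≤
      ∫⁻ θ in Ioo (-Real.pi) Real.pi, ‖f (circleMap c R θ)‖ₑ ^ p := by
  have h := norm_rpow_le_circleAverage hR hp hf
  have hcont : Continuous fun θ : ℝ => ‖f (circleMap c R θ)‖ ^ p := by
    refine Continuous.rpow_const (Continuous.norm ?_) (fun _ => Or.inr hp.le)
    refine hf.continuousOn.comp_continuous (continuous_circleMap c R) fun θ => ?_
    exact circleMap_mem_closedBall c hR.le θ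
  rw [Real.circleAverage_eq_integral_add (-Real.pi), smul_eq_mul,
    intervalIntegral.integral_comp_add_right
    (fun θ => ‖f (circleMap c R θ)‖ ^ p)] at h
  have h2 : 2 * Real.pi * ‖f c‖ ^ p ≤ ∫ θ in (-Real.pi)..Real.pi, ‖f (circleMap c R θ)‖ ^ p := by
    have : (2 * Real.pi)⁻¹ * (2 * Real.pi) = 1 := by field_simp
    have h3 : (0 + -Real.pi : ℝ) = -Real.pi := by ring
    have h4 : (2 * Real.pi + -Real.pi : ℝ) = Real.pi := by ring
    rw [h3, h4] at h
    calc _ ≤ 2 * Real.pi * ((2 * Real.pi)⁻¹ *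
          ∫ θ in (-Real.pi)..Real.pi, ‖f (circleMap c R θ)‖ ^ p) := by
          gcongr
      _ = _ := by rw [← mul_assoc, mul_comm (2 * Real.pi), this, one_mul]
  have hle : -Real.pi ≤ Real.pi := by linarith [Real.pi_pos]
  rw [intervalIntegral.integral_of_le hle, integral_Ioc_eq_integral_Ioo] at h2
  have h5 := ENNReal.ofReal_le_ofReal h2
  rw [ofReal_integral_eq_lintegral_ofReal
    ((hcont.integrableOn_Icc).mono_set Ioo_subset_Icc_self)
    (Filter.Eventually.of_forall fun _ => by positivity),
    ENNReal.ofReal_mul (by positivity)] at h5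
  simpa only [← ENNReal.ofReal_rpow_of_nonneg (norm_nonneg _) hp.le, ofReal_norm] using h5

/-- The sub-mean value inequality over a square, integrated in the two real coordinates. -/
theorem enorm_rpow_le_lintegral_square {f : ℂ → ℂ} {δ p : ℝ} (c : ℂ) (hδ : 0 < δ) (hp : 0 < p)
    (hf : DifferentiableOn ℂ f (Metric.ball c δ)) :
    ENNReal.ofReal (Real.pi * δ ^ 2) * ‖f c‖ₑ ^ p ≤
      ∫⁻ x in Ioo (-δ) δ, ∫⁻ y in Ioo (-δ) δ, ‖f (c + (x + y * Complex.I))‖ₑ ^ p := by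
  set G : ℂ → ℝ≥0∞ := (Metric.ball 0 δ).indicator (fun w => ‖f (c + w)‖ₑ ^ p) with hG
  have hmaps : MapsTo (fun w => c + w) (Metric.ball 0 δ) (Metric.ball c δ) := by
    intro w hw
    simpa using hw
  have hGm : Measurable G := by
    classical
    have h1 : ContinuousOn (fun w => ‖f (c + w)‖ₑ ^ p) (Metric.ball 0 δ) := by
      refine (ENNReal.continuous_rpow_const).comp_continuousOn ?_
      exact (hf.continuousOn.comp (by fun_prop) hmaps).enorm
    have := h1.measurable_piecewise (g := fun _ => (0 : ℝ≥0∞)) continuousOn_const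
      (Metric.isOpen_ball.measurableSet)
    rwa [hG, ← Set.piecewise_eq_indicator]
  have hlow : ENNReal.ofReal (Real.pi * δ ^ 2) * ‖f c‖ₑ ^ p ≤ ∫⁻ w, G w := by
    rw [← Complex.lintegral_comp_polarCoord_symm, polarCoord_target, Measure.volume_eq_prod,
      ← Measure.prod_restrict, lintegral_prod _ (by
        apply Measurable.aemeasurable
        refine Measurable.fun_smul (by fun_prop) (hGm.comp ?_)
        have : (Complex.polarCoord.symm : ℝ × ℝ → ℂ) = fun q =>
            (q.1 * (Real.cos q.2 + Real.sin q.2 * Complex.I) : ℂ) :=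
          funext Complex.polarCoord_symm_apply
        rw [this]
        fun_prop)]
    calc ENNReal.ofReal (Real.pi * δ ^ 2) * ‖f c‖ₑ ^ p
        = ∫⁻ ε in Ioo (0 : ℝ) δ,
          ENNReal.ofReal ε * (ENNReal.ofReal (2 * Real.pi) * ‖f c‖ₑ ^ p) := by
          rw [lintegral_mul_const _ (by fun_prop), ← mul_assoc]
          congr 1
          rw [← ofReal_integral_eq_lintegral_ofReal (f := fun x : ℝ => x)
            ((continuous_id.integrableOn_Icc (a := 0) (b := δ)).mono_set Ioo_subset_Icc_self)
            ((ae_restrict_iff' measurableSet_Ioo).2 (Filter.Eventually.of_forall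
              fun x hx => hx.1.le)), ← integral_Ioc_eq_integral_Ioo,
            ← intervalIntegral.integral_of_le hδ.le, ← ENNReal.ofReal_mul (by
              exact intervalIntegral.integral_nonneg hδ.le fun x hx => hx.1)]
          congr 1
          rw [integral_id]
          ring
      _ ≤ ∫⁻ ε in Ioo 0 δ, ∫⁻ θ in Ioo (-Real.pi) Real.pi, ENNReal.ofReal ε •
            G (Complex.polarCoord.symm (ε, θ)) := by
          refine setLIntegral_mono' measurableSet_Ioo fun ε hε => ?_
          simp only [smul_eq_mul]
          rw [lintegral_const_mul' _ _ ENNReal.ofReal_ne_top]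
          gcongr
          have han : AnalyticOnNhd ℂ f (Metric.closedBall c ε) :=
            (hf.analyticOnNhd Metric.isOpen_ball).mono (Metric.closedBall_subset_ball hε.2)
          refine (enorm_rpow_le_lintegral_circle hε.1 hp han).trans (le_of_eq ?_)
          refine lintegral_congr fun θ => ?_
          have hmem : (Complex.polarCoord.symm (ε, θ)) ∈ Metric.ball (0 : ℂ) δ := by
            rw [mem_ball_zero_iff, Complex.norm_polarCoord_symm]
            simpa [abs_of_pos hε.1] using hε.2
          rw [hG, indicator_of_mem hmem]
          congr 3
          simp only [circleMap, Complex.polarCoord_symm_apply, Complex.exp_mul_I,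
            Complex.ofReal_cos, Complex.ofReal_sin]
      _ ≤ _ := lintegral_mono_set Ioo_subset_Ioi_self
  refine hlow.trans ?_
  rw [← (Complex.volume_preserving_equiv_real_prod.symm).lintegral_comp_emb
    Complex.measurableEquivRealProd.symm.measurableEmbedding, Measure.volume_eq_prod,
    lintegral_prod (fun a => G (Complex.measurableEquivRealProd.symm a))
      (hGm.comp Complex.measurableEquivRealProd.symm.measurable).aemeasurable,
    ← lintegral_indicator measurableSet_Ioo]
  refine lintegral_mono fun x => ?_
  have habs : ∀ x y : ℝ, Complex.measurableEquivRealProd.symm (x, y) = x + y * Complex.I :=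
    fun x y => Complex.mk_eq_add_mul_I x y
  simp only [habs]
  by_cases hx : x ∈ Ioo (-δ) δ
  · rw [indicator_of_mem hx, ← lintegral_indicator measurableSet_Ioo]
    refine lintegral_mono fun y => ?_
    by_cases hy : y ∈ Ioo (-δ) δ
    · rw [indicator_of_mem hy]
      exact indicator_le_self _ _ _
    · have : (x + y * Complex.I : ℂ) ∉ Metric.ball (0 : ℂ) δ := by
        intro hmem
        rw [mem_ball_zero_iff] at hmem
        have := (Complex.abs_im_le_norm _).trans_lt hmem
        simp at this
        exact hy (abs_lt.1 this)
      rw [hG, indicator_of_notMem this]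
      exact zero_le
  · rw [indicator_of_notMem hx]
    refine le_of_eq ?_
    rw [lintegral_eq_zero_iff']
    · refine Filter.Eventually.of_forall fun y => ?_
      have : (x + y * Complex.I : ℂ) ∉ Metric.ball (0 : ℂ) δ := by
        intro hmem
        rw [mem_ball_zero_iff] at hmem
        have := (Complex.abs_re_le_norm _).trans_lt hmem
        simp at this
        exact hx (abs_lt.1 this)
      simp only [hG, indicator_of_notMem this, Pi.zero_apply]
    · exact (hGm.comp (by fun_prop)).aemeasurable

theorem exp_log_eq_toCircle {r : ℝ} (hr : 0 < r) (x y : ℝ) :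
    Complex.exp (2 * Real.pi * ((Real.log r / (2 * Real.pi) : ℝ) + (x + y * Complex.I))) =
      ((r * Real.exp (2 * Real.pi * x) : ℝ) : ℂ) *
        (AddCircle.toCircle (y : UnitAddCircle) : ℂ) := by
  rw [AddCircle.toCircle_apply_mk, Circle.coe_exp, Complex.ofReal_mul]
  conv_rhs => rw [← Real.exp_log hr]
  rw [Complex.ofReal_exp, Complex.ofReal_exp, ← Complex.exp_add, ← Complex.exp_add]
  congr 1
  push_cast
  have : (Real.pi : ℂ) ≠ 0 := by exact_mod_cast Real.pi_ne_zero
  field_simp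
  ring

/-- The `j`-th dyadic interval `[1 - 2⁻ʲ, 1 - 2⁻ʲ⁻¹)` of `[0, 1)`. -/
def dyadicIco (j : ℕ) : Set ℝ := Ico (1 - (1 / 2 : ℝ) ^ j) (1 - (1 / 2 : ℝ) ^ (j + 1))

/-- The centre `1 - (3/4) 2⁻ʲ` of the `j`-th dyadic interval. -/
def dyadicMid (j : ℕ) : ℝ := 1 - 3 / 4 * (1 / 2 : ℝ) ^ j

/-- The angular window `|y| < 2⁻ʲ / 32` attached to the `j`-th dyadic interval. -/
def window (j : ℕ) : Set ℝ := Ioo (-((1 / 2 : ℝ) ^ j / 32)) ((1 / 2 : ℝ) ^ j / 32)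

/-- Local sub-mean value inequality: the value at the centre of a dyadic interval is controlled
by the mean over a dyadic box in polar coordinates. In the logarithmic coordinate `w`,
`z = exp (2 π w)`, the box contains a square of side comparable to `2⁻ʲ`, whence the factor
`4 ^ j`; the constant `1000` is not sharp. -/
theorem enorm_rpow_le_lintegral_polar {F : ℂ → ℂ} {p : ℝ} (hp : 0 < p)
    (hF : DifferentiableOn ℂ F (Metric.ball 0 1)) (j : ℕ) (θ : UnitAddCircle) :
    ‖F (dyadicMid j * (AddCircle.toCircle θ : ℂ))‖ₑ ^ p ≤ ENNReal.ofReal (1000 * 4 ^ j) *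
      ∫⁻ R in dyadicIco j, ∫⁻ y in window j,
        ‖F (R * (AddCircle.toCircle (θ + (y : UnitAddCircle)) : ℂ))‖ₑ ^ p := by
  set r := dyadicMid j with hr
  set d : ℝ := (1 / 2 : ℝ) ^ j with hd
  have hd0 : 0 < d := by positivity
  have hd1 : d ≤ 1 := pow_le_one₀ (by norm_num) (by norm_num)
  have hrd : r = 1 - 3 / 4 * d := rfl
  have hr0 : 0 < r := by rw [hrd]; linarith
  have hds : (1 / 2 : ℝ) ^ (j + 1) = d / 2 := by rw [pow_succ]; ring
  set ζ : ℂ := (AddCircle.toCircle θ : ℂ)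
  have hζ : ‖ζ‖ = 1 := Circle.norm_coe _
  have hpi := Real.pi_pos
  have hpi4 := Real.pi_le_four
  -- the radii `r exp (2 π x)` stay inside the dyadic interval
  have hmemR : ∀ x ∈ Ioo (-(d / 32)) (d / 32), r * Real.exp (2 * Real.pi * x) ∈ dyadicIco j := by
    intro x hx
    have hx1 : 2 * Real.pi * x < d / 4 := by nlinarith [hx.2]
    have hx2 : -(d / 4) < 2 * Real.pi * x := by nlinarith [hx.1]
    have e1 : Real.exp (2 * Real.pi * x) < (1 - d / 4)⁻¹ := by
      refine (Real.exp_lt_exp.2 hx1).trans_le ?_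
      have h1 : 0 < 1 - d / 4 := by linarith
      rw [← neg_neg (d / 4), Real.exp_neg, neg_neg]
      exact inv_anti₀ h1 (by linarith [Real.add_one_le_exp (-(d / 4))])
    have e2 : 1 - d / 4 < Real.exp (2 * Real.pi * x) := by
      have := Real.add_one_le_exp (2 * Real.pi * x)
      linarith
    refine ⟨?_, ?_⟩
    · rw [← hd]
      nlinarith
    · rw [hds]
      have h1 : 0 < 1 - d / 4 := by linarith
      calc r * Real.exp (2 * Real.pi * x) < r * (1 - d / 4)⁻¹ := by gcongr
        _ ≤ 1 - d / 2 := by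
          rw [← div_eq_mul_inv, div_le_iff₀ h1, hrd]
          nlinarith
  set f : ℂ → ℂ := fun w => F (Complex.exp (2 * Real.pi * w) * ζ) with hf
  set c : ℂ := ((Real.log r / (2 * Real.pi) : ℝ) : ℂ) with hc
  have hfc : f c = F (r * ζ) := by
    have := exp_log_eq_toCircle hr0 0 0
    simp only [Complex.ofReal_zero, zero_mul, add_zero, mul_zero, Real.exp_zero, mul_one] at this
    simp only [f, c]
    rw [this]
    congr 2
    simp
  have hfd : DifferentiableOn ℂ f (Metric.ball c (d / 32)) := by
    refine hF.comp (by fun_prop) fun w hw => ?_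
    rw [mem_ball_zero_iff, norm_mul, hζ, mul_one, Complex.norm_exp]
    have hw2 : (w - c).re < d / 32 := by
      rw [Metric.mem_ball, dist_eq_norm] at hw
      exact (le_abs_self _).trans_lt ((Complex.abs_re_le_norm _).trans_lt hw)
    have hw3 : -(d / 32) < (w - c).re := by
      rw [Metric.mem_ball, dist_eq_norm] at hw
      linarith [(neg_abs_le _).trans_lt' (neg_lt_neg ((Complex.abs_re_le_norm _).trans_lt hw))]
    have h1 := (hmemR _ ⟨hw3, hw2⟩).2
    have h2 : (2 * Real.pi * w : ℂ).re = Real.log r + 2 * Real.pi * (w - c).re := by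
      simp [c, -Complex.ofReal_div]
      field_simp
      ring
    rw [h2, Real.exp_add, Real.exp_log hr0]
    linarith [h1, hds]
  have key := enorm_rpow_le_lintegral_square c (by positivity : 0 < d / 32) hp hfd
  rw [hfc] at key
  have hG : ∀ x y : ℝ, f (c + (x + y * Complex.I)) =
      F ((r * Real.exp (2 * Real.pi * x) : ℝ) *
        (AddCircle.toCircle (θ + (y : UnitAddCircle)) : ℂ)) := by
    intro x y
    simp only [f, c]
    rw [exp_log_eq_toCircle hr0, AddCircle.toCircle_add, Circle.coe_mul]
    congr 1
    ring
  simp only [hG] at key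
  set V : ℝ → ℝ≥0∞ := fun R => ∫⁻ y in window j,
    ‖F (R * (AddCircle.toCircle (θ + (y : UnitAddCircle)) : ℂ))‖ₑ ^ p with hV
  set φ : ℝ → ℝ := fun x => r * Real.exp (2 * Real.pi * x) with hφ
  set S : Set ℝ := Ioo (-(d / 32)) (d / 32) with hS
  have hcov : ∫⁻ R in φ '' S, V R = ∫⁻ x in S, ENNReal.ofReal |φ x * (2 * Real.pi)| * V (φ x) := by
    refine lintegral_image_eq_lintegral_abs_deriv_mul measurableSet_Ioo (fun x _ => ?_) ?_ V
    · have h1 : HasDerivAt (fun x : ℝ => 2 * Real.pi * x) (2 * Real.pi) x := by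
        simpa using (hasDerivAt_id x).const_mul (2 * Real.pi)
      have := (h1.exp).const_mul r
      rw [← mul_assoc] at this
      exact this.hasDerivWithinAt
    · intro x _ y _ hxy
      simp only [φ] at hxy
      have := Real.exp_injective (mul_left_cancel₀ hr0.ne' hxy)
      exact mul_left_cancel₀ (by positivity) this
  have hsub : φ '' S ⊆ dyadicIco j := by
    rintro _ ⟨x, hx, rfl⟩
    exact hmemR x hx
  have hφlow : ∀ x ∈ S, (1 : ℝ≥0∞) ≤ ENNReal.ofReal |φ x * (2 * Real.pi)| := by
    intro x hx
    rw [ENNReal.one_le_ofReal]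
    refine le_trans ?_ (le_abs_self _)
    have h1 : 1 - d / 4 < Real.exp (2 * Real.pi * x) := by
      have := Real.add_one_le_exp (2 * Real.pi * x)
      nlinarith [hx.1]
    have h2 : (1 / 4) * (3 / 4) ≤ φ x := by
      simp only [φ]
      apply mul_le_mul <;> linarith
    nlinarith [Real.pi_gt_three]
  have hfin : ENNReal.ofReal (Real.pi * (d / 32) ^ 2) * ‖F (r * ζ)‖ₑ ^ p ≤
      ∫⁻ R in dyadicIco j, V R := by
    calc _ ≤ ∫⁻ x in S, V (φ x) := key
      _ ≤ ∫⁻ x in S, ENNReal.ofReal |φ x * (2 * Real.pi)| * V (φ x) := by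
        refine setLIntegral_mono' measurableSet_Ioo fun x hx => ?_
        exact le_mul_of_one_le_left zero_le (hφlow x hx)
      _ = ∫⁻ R in φ '' S, V R := hcov.symm
      _ ≤ _ := lintegral_mono_set hsub
  have hconst : 1 ≤ ENNReal.ofReal (1000 * 4 ^ j) * ENNReal.ofReal (Real.pi * (d / 32) ^ 2) := by
    rw [← ENNReal.ofReal_mul (by positivity), ENNReal.one_le_ofReal]
    have : (4 : ℝ) ^ j * d ^ 2 = 1 := by
      rw [hd, ← pow_mul, mul_comm j 2, pow_mul, ← mul_pow]; norm_num
    nlinarith [Real.pi_gt_three]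
  calc ‖F (r * ζ)‖ₑ ^ p ≤ (ENNReal.ofReal (1000 * 4 ^ j) *
        ENNReal.ofReal (Real.pi * (d / 32) ^ 2)) * ‖F (r * ζ)‖ₑ ^ p :=
        le_mul_of_one_le_left zero_le hconst
    _ ≤ _ := by
      rw [mul_assoc]
      gcongr

/-! ### The sub-mean value inequality over dyadic boxes of the polydisc -/

/-- Tensorization: a bound of point values by integrals in each variable separately gives a bound
by the integral over the product space. -/
theorem le_lintegral_pi_of_le_lintegral {ι : Type*} [Fintype ι] [DecidableEq ι] {X : ι → Type*}
    [∀ i, MeasurableSpace (X i)] (μ : ∀ i, Measure (X i)) [∀ i, SigmaFinite (μ i)]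
    (S : ∀ i, Set (X i)) (c : ∀ i, X i) (C : ι → ℝ≥0∞) (hC : ∀ i, C i ≠ ⊤)
    (hc : ∀ i, c i ∈ S i) (hS : ∀ i, ∀ᵐ x ∂μ i, x ∈ S i)
    {G : (∀ i, X i) → ℝ≥0∞} (hG : Measurable G)
    (hsub : ∀ i, ∀ x : ∀ i, X i, (∀ k, x k ∈ S k) →
      G (Function.update x i (c i)) ≤ C i * ∫⁻ z, G (Function.update x i z) ∂μ i) :
    G c ≤ (∏ i, C i) * ∫⁻ x, G x ∂Measure.pi μ := by
  have key : ∀ s : Finset ι, ∀ x : ∀ i, X i, (∀ k, x k ∈ S k) →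
      G (s.piecewise c x) ≤ (∏ i ∈ s, C i) * (∫⋯∫⁻_s, G ∂μ) x := by
    intro s
    induction s using Finset.induction_on with
    | empty => intro x _; simp
    | insert i s hi ih =>
      intro x hx
      have hx' : ∀ k, (s.piecewise c x) k ∈ S k := by
        intro k
        by_cases hk : k ∈ s
        · simpa [hk] using hc k
        · simpa [hk] using hx k
      rw [Finset.piecewise_insert, lmarginal_insert _ hG hi, Finset.prod_insert hi, mul_assoc,
        ← lintegral_const_mul' _ _ (ENNReal.prod_ne_top fun i _ => hC i)]
      refine (hsub i _ hx').trans ?_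
      refine mul_le_mul' le_rfl (lintegral_mono_ae ?_)
      filter_upwards [hS i] with z hz
      rw [Finset.update_piecewise_of_notMem _ _ _ hi]
      refine ih _ fun k => ?_
      by_cases hk : k = i
      · subst hk; simpa using hz
      · simpa [hk] using hx k
  have := key Finset.univ c hc
  rw [Finset.piecewise_univ, lmarginal_univ] at this
  exact this

variable {n : ℕ}

/-- The dyadic box of multi-radii with index `j ∈ ℕⁿ`; these boxes tile `[0, 1)ⁿ`. -/
def dyadicBox (j : Fin n → ℕ) : Set (Fin n → ℝ) := univ.pi fun i => dyadicIco (j i)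

/-- The centre of the dyadic box with index `j`. -/
def boxMid (j : Fin n → ℕ) : Fin n → ℝ := fun i => dyadicMid (j i)

/-- The product of the angular windows attached to the dyadic box with index `j`. -/
def boxWindow (j : Fin n → ℕ) : Set (Fin n → ℝ) := univ.pi fun i => window (j i)

/-- The point of the torus with real coordinates `y`. -/
def toTorus (y : Fin n → ℝ) : UnitAddTorus (Fin n) := fun i => (y i : UnitAddCircle)

theorem dyadicIco_subset (j : ℕ) : dyadicIco j ⊆ Ico 0 1 := by
  intro x hx
  have h1 : (1 / 2 : ℝ) ^ j ≤ 1 := pow_le_one₀ (by norm_num) (by norm_num)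
  have h2 : (0 : ℝ) < (1 / 2 : ℝ) ^ (j + 1) := by positivity
  exact ⟨by linarith [hx.1], by linarith [hx.2]⟩

theorem dyadicMid_mem (j : ℕ) : dyadicMid j ∈ dyadicIco j := by
  have h2 : (0 : ℝ) < (1 / 2 : ℝ) ^ j := by positivity
  refine ⟨?_, ?_⟩ <;> simp only [dyadicMid]
  · linarith
  · rw [pow_succ]; linarith

theorem dyadicBox_subset_radii (j : Fin n → ℕ) : dyadicBox j ⊆ radii n :=
  fun _ hR i => dyadicIco_subset _ (hR i trivial)

theorem boxMid_mem_dyadicBox (j : Fin n → ℕ) : boxMid j ∈ dyadicBox j :=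
  fun i _ => dyadicMid_mem (j i)

theorem boxMid_mem_radii (j : Fin n → ℕ) : boxMid j ∈ radii n :=
  dyadicBox_subset_radii j (boxMid_mem_dyadicBox j)

theorem measurableSet_dyadicBox (j : Fin n → ℕ) : MeasurableSet (dyadicBox j) :=
  MeasurableSet.univ_pi fun _ => measurableSet_Ico

theorem radii_eq_pi : radii n = univ.pi fun _ => Ico (0 : ℝ) 1 := by
  ext r; simp [radii, mem_pi]

theorem measurableSet_radii : MeasurableSet (radii n) := by
  rw [radii_eq_pi]
  exact MeasurableSet.univ_pi fun _ => measurableSet_Ico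

theorem polydisc_eq_pi : polydisc n = univ.pi fun _ => Metric.ball (0 : ℂ) 1 := by
  ext; simp [polydisc]

theorem isOpen_polydisc : IsOpen (polydisc n) := by
  rw [polydisc_eq_pi]
  exact isOpen_set_pi finite_univ fun _ _ => Metric.isOpen_ball

theorem norm_torusPoint (r : Fin n → ℝ) (θ : UnitAddTorus (Fin n)) (i : Fin n) :
    ‖torusPoint r θ i‖ = |r i| := by
  rw [torusPoint, norm_mul, Circle.norm_coe, mul_one, Complex.norm_real, Real.norm_eq_abs]

theorem torusPoint_mem_polydisc {r : Fin n → ℝ} (hr : r ∈ radii n) (θ : UnitAddTorus (Fin n)) :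
    torusPoint r θ ∈ polydisc n := by
  intro i
  rw [norm_torusPoint, abs_of_nonneg (hr i).1]
  exact (hr i).2

@[fun_prop]
theorem continuous_torusPoint :
    Continuous fun x : (Fin n → ℝ) × UnitAddTorus (Fin n) => torusPoint x.1 x.2 := by
  refine continuous_pi fun i => ?_
  have h : Continuous fun x : UnitAddCircle => (AddCircle.toCircle x : ℂ) :=
    continuous_subtype_val.comp AddCircle.continuous_toCircle
  have h2 : Continuous fun x : (Fin n → ℝ) × UnitAddTorus (Fin n) => x.2 i := by fun_prop
  exact (by fun_prop : Continuous fun x : (Fin n → ℝ) × UnitAddTorus (Fin n) =>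
    ((x.1 i : ℝ) : ℂ)).mul (h.comp h2)

@[fun_prop]
theorem continuous_toTorus : Continuous (toTorus : (Fin n → ℝ) → UnitAddTorus (Fin n)) :=
  continuous_pi fun i => (AddCircle.continuous_mk' 1).comp (continuous_apply i)

/-- The function `f`, replaced by zero outside of the polydisc; unlike `f`, it is measurable. -/
def cutoff (f : (Fin n → ℂ) → ℂ) : (Fin n → ℂ) → ℂ := (polydisc n).indicator f

theorem measurable_cutoff {f : (Fin n → ℂ) → ℂ} (hf : f ∈ holo n) : Measurable (cutoff f) := by
  classical
  have hf' : ContinuousOn f (polydisc n) := DifferentiableOn.continuousOn hf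
  have := hf'.measurable_piecewise (g := fun _ => (0 : ℂ)) continuousOn_const
    isOpen_polydisc.measurableSet
  rw [cutoff, ← Set.piecewise_eq_indicator]
  exact this

theorem cutoff_torusPoint (f : (Fin n → ℂ) → ℂ) {r : Fin n → ℝ} (hr : r ∈ radii n)
    (θ : UnitAddTorus (Fin n)) : cutoff f (torusPoint r θ) = f (torusPoint r θ) :=
  indicator_of_mem (torusPoint_mem_polydisc hr θ) f

theorem measurable_cutoff_torusPoint {f : (Fin n → ℂ) → ℂ} (hf : f ∈ holo n) (p : ℝ) :
    Measurable fun x : (Fin n → ℝ) × UnitAddTorus (Fin n) => ‖cutoff f (torusPoint x.1 x.2)‖ₑ ^ p :=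
  (((measurable_cutoff hf).comp continuous_torusPoint.measurable).enorm).pow_const p

/-- Slices of a holomorphic function in one variable are holomorphic. -/
theorem differentiableOn_slice {f : (Fin n → ℂ) → ℂ} (hf : f ∈ holo n) {z : Fin n → ℂ}
    (hz : z ∈ polydisc n) (i : Fin n) :
    DifferentiableOn ℂ (fun w => f (Function.update z i w)) (Metric.ball 0 1) := by
  have hf' : DifferentiableOn ℂ f (polydisc n) := hf
  refine hf'.comp (f := fun w => Function.update z i w) ?_ ?_
  · intro w _
    refine DifferentiableAt.differentiableWithinAt ?_
    exact (hasFDerivAt_update z w).differentiableAt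
  · intro w hw k
    by_cases hk : k = i
    · subst hk; simpa using hw
    · simpa [hk] using hz k

/-- Sub-mean value inequality over a dyadic box and its angular window, for every exponent
`p > 0`. -/
theorem enorm_rpow_le_lintegral_box {f : (Fin n → ℂ) → ℂ} (hf : f ∈ holo n) {p : ℝ} (hp : 0 < p)
    (j : Fin n → ℕ) (θ : UnitAddTorus (Fin n)) :
    ‖f (torusPoint (boxMid j) θ)‖ₑ ^ p ≤ (∏ i, ENNReal.ofReal (1000 * 4 ^ j i)) *
      ∫⁻ y in boxWindow j, ∫⁻ R in dyadicBox j, ‖f (torusPoint R (θ + toTorus y))‖ₑ ^ p := by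
  classical
  set T : (Fin n → ℝ × ℝ) → (Fin n → ℂ) :=
    fun x => torusPoint (fun i => (x i).1) (θ + toTorus fun i => (x i).2) with hT
  set G : (Fin n → ℝ × ℝ) → ℝ≥0∞ := fun x => ‖cutoff f (T x)‖ₑ ^ p with hG
  have hTc : Continuous T := continuous_torusPoint.comp
    (by fun_prop : Continuous fun x : Fin n → ℝ × ℝ =>
      ((fun i => (x i).1 : Fin n → ℝ), θ + toTorus fun i => (x i).2))
  have hGm : Measurable G := (((measurable_cutoff hf).comp hTc.measurable).enorm).pow_const p
  set S : Fin n → Set (ℝ × ℝ) := fun i => dyadicIco (j i) ×ˢ univ with hS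
  set μ : Fin n → Measure (ℝ × ℝ) := fun i =>
    (volume.restrict (dyadicIco (j i))).prod (volume.restrict (window (j i))) with hμ
  have hrad : ∀ x : Fin n → ℝ × ℝ, (∀ k, x k ∈ S k) → (fun i => (x i).1) ∈ radii n :=
    fun x hx i => dyadicIco_subset _ (hx i).1
  have hupd : ∀ (x : Fin n → ℝ × ℝ) i (z : ℝ × ℝ), T (Function.update x i z) =
      Function.update (T x) i (z.1 * (AddCircle.toCircle (θ i + (z.2 : UnitAddCircle)) : ℂ)) := by
    intro x i z
    funext k
    by_cases hk : k = i
    · subst hk; simp [T, torusPoint, toTorus]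
    · simp [T, torusPoint, toTorus, hk]
  have key := le_lintegral_pi_of_le_lintegral μ S (fun i => (dyadicMid (j i), (0 : ℝ)))
    (fun i => ENNReal.ofReal (1000 * 4 ^ j i)) (fun _ => ENNReal.ofReal_ne_top)
    (fun i => ⟨dyadicMid_mem _, trivial⟩) (by
      intro i
      have h1 : ∀ᵐ x ∂(volume.restrict (dyadicIco (j i))), x ∈ dyadicIco (j i) :=
        ae_restrict_mem measurableSet_Ico
      have h2 := (Measure.quasiMeasurePreserving_fst
        (μ := volume.restrict (dyadicIco (j i))) (ν := volume.restrict (window (j i)))).ae h1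
      filter_upwards [h2] with x hx
      exact ⟨hx, trivial⟩) hGm (by
      intro i x hx
      have hz : T x ∈ polydisc n := torusPoint_mem_polydisc (hrad x hx) _
      have h1 := enorm_rpow_le_lintegral_polar hp (differentiableOn_slice hf hz i) (j i) (θ i)
      have hcut : ∀ z : ℝ × ℝ, z.1 ∈ dyadicIco (j i) →
          G (Function.update x i z) = ‖f (Function.update (T x) i
            (z.1 * (AddCircle.toCircle (θ i + (z.2 : UnitAddCircle)) : ℂ)))‖ₑ ^ p := by
        intro z hz1
        simp only [G]
        rw [cutoff, indicator_of_mem, hupd]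
        refine torusPoint_mem_polydisc (hrad _ fun k => ?_) _
        by_cases hk : k = i
        · subst hk; simpa [S] using hz1
        · simpa [hk] using hx k
      rw [hcut _ (dyadicMid_mem _), hμ, lintegral_prod _ (by
        exact (hGm.comp (measurable_update x)).aemeasurable)]
      simp only [AddCircle.coe_zero, add_zero]
      refine h1.trans (le_of_eq ?_)
      congr 1
      refine setLIntegral_congr_fun measurableSet_Ico fun R hR => ?_
      refine lintegral_congr fun y => ?_
      rw [hcut (R, y) hR])
  have hprod := (measurePreserving_arrowProdEquivProdArrow ℝ ℝ (Fin n)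
    (fun i => volume.restrict (dyadicIco (j i))) (fun i => volume.restrict (window (j i))))
  have hGform : ∀ x, G x = (fun q : (Fin n → ℝ) × (Fin n → ℝ) =>
      ‖cutoff f (torusPoint q.1 (θ + toTorus q.2))‖ₑ ^ p)
      (MeasurableEquiv.arrowProdEquivProdArrow ℝ ℝ (Fin n) x) := fun x => rfl
  have hGm2 : Measurable fun q : (Fin n → ℝ) × (Fin n → ℝ) =>
      ‖cutoff f (torusPoint q.1 (θ + toTorus q.2))‖ₑ ^ p :=
    (((measurable_cutoff hf).comp (continuous_torusPoint.comp
      (by fun_prop : Continuous fun q : (Fin n → ℝ) × (Fin n → ℝ) =>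
        (q.1, θ + toTorus q.2))).measurable).enorm).pow_const p
  simp only [hGform] at key
  rw [hprod.lintegral_comp hGm2, ← Measure.restrict_pi_pi, ← Measure.restrict_pi_pi,
    lintegral_prod_symm _ hGm2.aemeasurable] at key
  have hmid : (fun q : (Fin n → ℝ) × (Fin n → ℝ) =>
      ‖cutoff f (torusPoint q.1 (θ + toTorus q.2))‖ₑ ^ p)
      (MeasurableEquiv.arrowProdEquivProdArrow ℝ ℝ (Fin n) fun i => (dyadicMid (j i), (0 : ℝ))) =
      ‖f (torusPoint (boxMid j) θ)‖ₑ ^ p := by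
    change ‖cutoff f (torusPoint (boxMid j) (θ + toTorus fun _ => 0))‖ₑ ^ p = _
    rw [cutoff_torusPoint f (boxMid_mem_radii j)]
    congr 4
    funext i
    simp [toTorus]
  refine hmid.symm.le.trans (key.trans (le_of_eq ?_))
  congr 1
  refine lintegral_congr fun y => ?_
  refine setLIntegral_congr_fun (measurableSet_dyadicBox j) fun R hR => ?_
  simp only [cutoff_torusPoint f (dyadicBox_subset_radii j hR)]

/-! ### Monotonicity of the integral means -/

/-- The `p`-th power `∫ |f(r ξ)| ^ p dξ` of the integral mean `M_p(f, r)`. -/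
def powerMean (p : ℝ) (f : (Fin n → ℂ) → ℂ) (r : Fin n → ℝ) : ℝ≥0∞ :=
  ∫⁻ θ : UnitAddTorus (Fin n), ‖f (torusPoint r θ)‖ₑ ^ p

theorem integralMean_eq (p : ℝ) (f : (Fin n → ℂ) → ℂ) (r : Fin n → ℝ) :
    integralMean p f r = powerMean p f r ^ (1 / p) := rfl

theorem exists_eq_norm_mul_toCircle (w : ℂ) :
    ∃ s : UnitAddCircle, w = (‖w‖ : ℂ) * (AddCircle.toCircle s : ℂ) := by
  refine ⟨((Complex.arg w / (2 * Real.pi) : ℝ) : UnitAddCircle), ?_⟩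
  rw [AddCircle.toCircle_apply_mk, Circle.coe_exp]
  conv_lhs => rw [← Complex.norm_mul_exp_arg_mul_I w]
  congr 3
  have := Real.pi_ne_zero
  push_cast
  field_simp

/-- Rotation invariance: the mean of `f` over the torus, with the `i`-th radius replaced by a
complex number `w`, depends on the modulus of `w` only. -/
theorem lintegral_update_eq_powerMean (p : ℝ) (f : (Fin n → ℂ) → ℂ) (r : Fin n → ℝ) (i : Fin n)
    (w : ℂ) :
    ∫⁻ θ : UnitAddTorus (Fin n), ‖f (Function.update (torusPoint r θ) i
      (w * (AddCircle.toCircle (θ i) : ℂ)))‖ₑ ^ p = powerMean p f (Function.update r i ‖w‖) := by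
  obtain ⟨s, hs⟩ := exists_eq_norm_mul_toCircle w
  have hshift := lintegral_add_right_eq_self (μ := (volume : Measure (UnitAddTorus (Fin n))))
    (fun θ => ‖f (torusPoint (Function.update r i ‖w‖) θ)‖ₑ ^ p) (Pi.single i s)
  rw [powerMean, ← hshift]
  refine lintegral_congr fun θ => ?_
  congr 3
  funext k
  by_cases hk : k = i
  · subst hk
    simp only [Function.update_self, torusPoint, Pi.add_apply, Pi.single_eq_same,
      AddCircle.toCircle_add, Circle.coe_mul]
    conv_lhs => rw [hs]
    ring
  · simp [torusPoint, hk]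

theorem continuous_enorm_rpow_torusPoint {f : (Fin n → ℂ) → ℂ} (hf : f ∈ holo n) {p : ℝ}
    (hp : 0 < p) {r : Fin n → ℝ} (hr : r ∈ radii n) :
    Continuous fun θ : UnitAddTorus (Fin n) => ‖f (torusPoint r θ)‖ ^ p := by
  have hf' : ContinuousOn f (polydisc n) := DifferentiableOn.continuousOn hf
  refine Continuous.rpow_const (Continuous.norm ?_) fun _ => Or.inr hp.le
  exact hf'.comp_continuous (continuous_torusPoint.comp (by fun_prop :
    Continuous fun θ : UnitAddTorus (Fin n) => (r, θ))) fun θ => torusPoint_mem_polydisc hr θ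

theorem lintegral_circle_normSq (w : ℂ) (ε : ℝ) :
    ∫ φ in (-Real.pi)..Real.pi, ‖circleMap w ε φ‖ ^ 2 = 2 * Real.pi * (‖w‖ ^ 2 + ε ^ 2) := by
  have h : ∀ φ : ℝ, ‖circleMap w ε φ‖ ^ 2 =
      (‖w‖ ^ 2 + ε ^ 2) + (2 * ε * w.re * Real.cos φ + 2 * ε * w.im * Real.sin φ) := by
    intro φ
    rw [← Complex.normSq_eq_norm_sq, ← Complex.normSq_eq_norm_sq, Complex.normSq_apply,
      Complex.normSq_apply]
    simp only [circleMap, Complex.exp_mul_I, Complex.add_re, Complex.mul_re, Complex.ofReal_re,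
      Complex.add_im, Complex.mul_im, Complex.ofReal_im, Complex.I_re, Complex.I_im,
      ← Complex.ofReal_cos, ← Complex.ofReal_sin]
    linear_combination ε ^ 2 * Real.sin_sq_add_cos_sq φ
  simp only [h]
  generalize ‖w‖ ^ 2 + ε ^ 2 = A
  rw [intervalIntegral.integral_add (by simp) (by apply Continuous.intervalIntegrable; fun_prop),
    intervalIntegral.integral_add (by apply Continuous.intervalIntegrable; fun_prop)
      (by apply Continuous.intervalIntegrable; fun_prop),
    intervalIntegral.integral_const_mul, intervalIntegral.integral_const_mul]
  simp only [intervalIntegral.integral_const, integral_cos, integral_sin, Real.sin_neg,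
    Real.sin_pi, Real.cos_neg, smul_eq_mul]
  ring

/-- The integral means increase in each radius: this is the maximum principle for the radial
subharmonic function `w ↦ ∫ |f(…, w ξᵢ, …)| ^ p dξ`, made strictly subharmonic by adding
`η |w| ^ 2`. -/
theorem powerMean_update_mono {f : (Fin n → ℂ) → ℂ} (hf : f ∈ holo n) {p : ℝ} (hp : 0 < p)
    {r : Fin n → ℝ} (hr : r ∈ radii n) (i : Fin n) {x R : ℝ} (hx : 0 ≤ x) (hxR : x ≤ R)
    (hR : R < 1) :
    powerMean p f (Function.update r i x) ≤ powerMean p f (Function.update r i R) := by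
  set pt : ℂ → UnitAddTorus (Fin n) → (Fin n → ℂ) := fun w θ =>
    Function.update (torusPoint r θ) i (w * (AddCircle.toCircle (θ i) : ℂ)) with hpt
  have hptc : Continuous fun q : ℂ × UnitAddTorus (Fin n) => pt q.1 q.2 := by
    refine Continuous.update (continuous_torusPoint.comp (by fun_prop :
      Continuous fun q : ℂ × UnitAddTorus (Fin n) => (r, q.2))) i ?_
    refine continuous_fst.mul (continuous_subtype_val.comp
      (AddCircle.continuous_toCircle.comp (by fun_prop)))
  have hptm : ∀ w θ, ‖w‖ < 1 → pt w θ ∈ polydisc n := by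
    intro w θ hw k
    by_cases hk : k = i
    · subst hk
      simp only [pt, Function.update_self]
      rw [norm_mul, Circle.norm_coe, mul_one]
      exact hw
    · simpa [pt, hk] using torusPoint_mem_polydisc hr θ k
  have hfc : ContinuousOn f (polydisc n) := DifferentiableOn.continuousOn hf
  set U : ℂ → ℝ := fun w => ∫ θ, ‖f (pt w θ)‖ ^ p with hU
  have hUE : ∀ w, ‖w‖ < 1 →
      ENNReal.ofReal (U w) = powerMean p f (Function.update r i ‖w‖) := by
    intro w hw
    rw [← lintegral_update_eq_powerMean, hU]
    have hc : Continuous fun θ => ‖f (pt w θ)‖ ^ p := by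
      refine Continuous.rpow_const (Continuous.norm ?_) fun _ => Or.inr hp.le
      exact hfc.comp_continuous (hptc.comp (by fun_prop :
        Continuous fun θ : UnitAddTorus (Fin n) => (w, θ))) fun θ => hptm w θ hw
    rw [ofReal_integral_eq_lintegral_ofReal
      (hc.integrable_of_hasCompactSupport (HasCompactSupport.of_compactSpace _))
      (Filter.Eventually.of_forall fun _ => by positivity)]
    refine lintegral_congr fun θ => ?_
    rw [← ENNReal.ofReal_rpow_of_nonneg (norm_nonneg _) hp.le, ofReal_norm]
  have hUc : ContinuousOn U (Metric.closedBall 0 R) := by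
    rw [continuousOn_iff_continuous_domRestrict]
    have hc : Continuous (Function.uncurry fun (w : Metric.closedBall (0 : ℂ) R)
        (θ : UnitAddTorus (Fin n)) => ‖f (pt w θ)‖ ^ p) := by
      refine Continuous.rpow_const (Continuous.norm ?_) fun _ => Or.inr hp.le
      refine hfc.comp_continuous (hptc.comp (by fun_prop : Continuous
        fun q : (Metric.closedBall (0 : ℂ) R) × UnitAddTorus (Fin n) => ((q.1 : ℂ), q.2))) ?_
      rintro ⟨w, θ⟩
      exact hptm _ _ ((mem_closedBall_zero_iff.1 w.2).trans_lt hR)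
    have := continuous_parametric_integral_of_continuous (μ := (volume :
      Measure (UnitAddTorus (Fin n)))) hc isCompact_univ
    simp only [setIntegral_univ] at this
    exact this
  have hR0 : 0 ≤ R := hx.trans hxR
  have hU0 : ∀ w, 0 ≤ U w := fun w => integral_nonneg fun θ => by positivity
  have main : ∀ η > 0, U x ≤ U R + η * R ^ 2 := by
    intro η hη
    obtain ⟨w, hw, hmax⟩ := (isCompact_closedBall (0 : ℂ) R).exists_isMaxOn
      ⟨0, by simpa using hR0⟩ (hUc.add (by fun_prop :
        ContinuousOn (fun w : ℂ => η * ‖w‖ ^ 2) (Metric.closedBall 0 R)))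
    have hmax' : ∀ v ∈ Metric.closedBall (0 : ℂ) R, U v + η * ‖v‖ ^ 2 ≤ U w + η * ‖w‖ ^ 2 :=
      fun v hv => hmax hv
    rw [mem_closedBall_zero_iff] at hw
    rcases hw.lt_or_eq with hlt | heq
    · exfalso
      set ε := (R - ‖w‖) / 2 with hε
      have hε0 : 0 < ε := by rw [hε]; linarith
      have hcirc : ∀ φ, circleMap w ε φ ∈ Metric.closedBall (0 : ℂ) R := by
        intro φ
        have h1 := circleMap_mem_closedBall w hε0.le φ
        rw [mem_closedBall_iff_norm] at h1
        rw [mem_closedBall_zero_iff]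
        have := norm_add_le (circleMap w ε φ - w) w
        rw [sub_add_cancel] at this
        linarith
      have h1 : ENNReal.ofReal (2 * Real.pi) * ENNReal.ofReal (U w) ≤
          ∫⁻ φ in Ioo (-Real.pi) Real.pi, ENNReal.ofReal (U (circleMap w ε φ)) := by
        have e1 : ∀ φ, ENNReal.ofReal (U (circleMap w ε φ)) =
            ∫⁻ θ, ‖cutoff f (pt (circleMap w ε φ) θ)‖ₑ ^ p := by
          intro φ
          have hlt1 : ‖circleMap w ε φ‖ < 1 :=
            (mem_closedBall_zero_iff.1 (hcirc φ)).trans_lt hR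
          rw [hUE _ hlt1, ← lintegral_update_eq_powerMean]
          refine lintegral_congr fun θ => ?_
          rw [cutoff, indicator_of_mem (hptm _ _ hlt1)]
        simp only [e1]
        rw [lintegral_lintegral_swap, hUE _ (hw.trans_lt hR), ← lintegral_update_eq_powerMean,
          ← lintegral_const_mul' _ _ ENNReal.ofReal_ne_top]
        · refine lintegral_mono fun θ => ?_
          have hsl : DifferentiableOn ℂ (fun v => f (pt v θ)) (Metric.ball 0 1) := by
            refine (differentiableOn_slice hf (torusPoint_mem_polydisc hr θ) i).comp
              (f := fun v : ℂ => v * (AddCircle.toCircle (θ i) : ℂ)) (by fun_prop) ?_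
            intro v hv
            rw [mem_ball_zero_iff] at hv ⊢
            rwa [norm_mul, Circle.norm_coe, mul_one]
          have han : AnalyticOnNhd ℂ (fun v => f (pt v θ)) (Metric.closedBall w ε) := by
            refine (hsl.analyticOnNhd Metric.isOpen_ball).mono fun v hv => ?_
            rw [mem_closedBall_iff_norm] at hv
            rw [mem_ball_zero_iff]
            have := norm_add_le (v - w) w
            rw [sub_add_cancel] at this
            linarith
          refine (enorm_rpow_le_lintegral_circle hε0 hp han).trans (le_of_eq ?_)
          refine lintegral_congr fun φ => ?_
          rw [cutoff, indicator_of_mem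
            (hptm _ _ ((mem_closedBall_zero_iff.1 (hcirc φ)).trans_lt hR))]
        · refine Measurable.aemeasurable ?_
          exact (((measurable_cutoff hf).comp (hptc.comp (by fun_prop :
            Continuous fun q : ℝ × UnitAddTorus (Fin n) =>
              (circleMap w ε q.1, q.2))).measurable).enorm).pow_const p
      set g : ℝ → ℝ := fun φ => (U w + η * ‖w‖ ^ 2) - η * ‖circleMap w ε φ‖ ^ 2 with hg
      have hUg : ∀ φ, U (circleMap w ε φ) ≤ g φ := by
        intro φ
        have := hmax' _ (hcirc φ)
        simp only [g]; linarith
      have hgc : Continuous g := by fun_prop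
      have h2 : ∫⁻ φ in Ioo (-Real.pi) Real.pi, ENNReal.ofReal (U (circleMap w ε φ)) ≤
          ENNReal.ofReal (∫ φ in (-Real.pi)..Real.pi, g φ) := by
        rw [intervalIntegral.integral_of_le (by linarith [Real.pi_pos]),
          integral_Ioc_eq_integral_Ioo, ofReal_integral_eq_lintegral_ofReal
          (hgc.integrableOn_Icc.mono_set Ioo_subset_Icc_self)
          (Filter.Eventually.of_forall fun φ => (hU0 _).trans (hUg φ))]
        exact lintegral_mono fun φ => ENNReal.ofReal_le_ofReal (hUg φ)
      have h3 : ∫ φ in (-Real.pi)..Real.pi, g φ = 2 * Real.pi * (U w - η * ε ^ 2) := by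
        simp only [g]
        rw [intervalIntegral.integral_sub (by simp)
          (by apply Continuous.intervalIntegrable; fun_prop), intervalIntegral.integral_const_mul,
          lintegral_circle_normSq]
        simp
        ring
      rw [h3] at h2
      have h4 := h1.trans h2
      have h5 : 0 ≤ 2 * Real.pi * (U w - η * ε ^ 2) := by
        rw [← h3]
        exact intervalIntegral.integral_nonneg (by linarith [Real.pi_pos])
          fun φ _ => (hU0 _).trans (hUg φ)
      rw [← ENNReal.ofReal_mul (by positivity), ENNReal.ofReal_le_ofReal_iff h5] at h4
      have : 0 < 2 * Real.pi * (η * ε ^ 2) := by positivity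
      nlinarith
    · have h1 := hmax' (x : ℂ) (by simpa [abs_of_nonneg hx] using hxR)
      have h2 : U w = U R := by
        have e1 := hUE w (hw.trans_lt hR)
        have e2 := hUE (R : ℂ) (by simpa [abs_of_nonneg hR0] using hR)
        rw [heq] at e1
        rw [Complex.norm_real, Real.norm_of_nonneg hR0, ← e1] at e2
        exact ((ENNReal.ofReal_eq_ofReal_iff (hU0 _) (hU0 _)).1 e2).symm
      rw [h2, heq] at h1
      have : 0 ≤ η * ‖(x : ℂ)‖ ^ 2 := by positivity
      linarith
  have hle : U x ≤ U R := by
    refine le_of_forall_pos_le_add fun δ hδ => ?_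
    have hR2 : R ^ 2 ≤ 1 := by nlinarith
    have := main δ hδ
    nlinarith
  have e1 := hUE (x : ℂ) (by simpa [abs_of_nonneg hx] using hxR.trans_lt hR)
  have e2 := hUE (R : ℂ) (by simpa [abs_of_nonneg hR0] using hR)
  rw [Complex.norm_real, Real.norm_of_nonneg hx] at e1
  rw [Complex.norm_real, Real.norm_of_nonneg hR0] at e2
  rw [← e1, ← e2]
  exact ENNReal.ofReal_le_ofReal hle

/-- The integral means are nondecreasing functions of the multi-radius. -/
theorem powerMean_mono {f : (Fin n → ℂ) → ℂ} (hf : f ∈ holo n) {p : ℝ} (hp : 0 < p)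
    {r R : Fin n → ℝ} (hr : r ∈ radii n) (hR : R ∈ radii n) (h : r ≤ R) :
    powerMean p f r ≤ powerMean p f R := by
  classical
  have key : ∀ s : Finset (Fin n), powerMean p f r ≤ powerMean p f (s.piecewise R r) := by
    intro s
    induction s using Finset.induction_on with
    | empty => simp
    | insert i s hi ih =>
      refine ih.trans ?_
      have hmem : s.piecewise R r ∈ radii n := by
        intro k
        by_cases hk : k ∈ s
        · simpa [hk] using hR k
        · simpa [hk] using hr k
      have := powerMean_update_mono hf hp hmem i (hr i).1 (h i) (hR i).2
      rw [Finset.piecewise_insert]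
      refine le_trans (le_of_eq ?_) this
      congr 1
      rw [Function.eq_update_iff]
      exact ⟨by simp [hi], fun _ _ => rfl⟩
  simpa using key Finset.univ

/-! ### Dyadic weights and the dyadic tiling of the cube of multi-radii -/

/-- The dyadic weight `2 ^ (-a |j|)`, where `|j| = j₁ + ⋯ + jₙ`. -/
def dyad (j : Fin n → ℕ) (a : ℝ) : ℝ≥0∞ := 2 ^ (-(a * ∑ i, (j i : ℝ)))

/-- The multi-index `j + (k, …, k)`. -/
def shift (j : Fin n → ℕ) (k : ℕ) : Fin n → ℕ := fun i => j i + k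

theorem shift_injective (k : ℕ) : Function.Injective fun j : Fin n → ℕ => shift j k := by
  intro j j' h
  funext i
  have := congrFun h i
  simp only [shift] at this
  omega

theorem dyad_add (j : Fin n → ℕ) (a b : ℝ) : dyad j (a + b) = dyad j a * dyad j b := by
  rw [dyad, dyad, dyad, ← ENNReal.rpow_add _ _ (by norm_num) (by norm_num)]
  congr 1; ring

theorem dyad_rpow (j : Fin n → ℕ) (a s : ℝ) : dyad j a ^ s = dyad j (a * s) := by
  rw [dyad, dyad, ← ENNReal.rpow_mul]
  congr 1; ring

@[simp]
theorem dyad_zero (j : Fin n → ℕ) : dyad j 0 = 1 := by simp [dyad]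

theorem dyad_ne_top (j : Fin n → ℕ) (a : ℝ) : dyad j a ≠ ⊤ :=
  ENNReal.rpow_ne_top_of_ne_zero (by norm_num) (by norm_num)

theorem dyad_mul_neg (j : Fin n → ℕ) (a : ℝ) : dyad j a * dyad j (-a) = 1 := by
  rw [← dyad_add]; simp

theorem dyad_eq_prod (j : Fin n → ℕ) (a : ℝ) : dyad j a = ∏ i, (2 : ℝ≥0∞) ^ (-(a * (j i : ℝ))) := by
  rw [dyad, Finset.mul_sum, ← Finset.sum_neg_distrib]
  induction (Finset.univ : Finset (Fin n)) using Finset.induction_on with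
  | empty => simp
  | insert i s hi ih =>
    rw [Finset.sum_insert hi, Finset.prod_insert hi,
      ENNReal.rpow_add _ _ (by norm_num) (by norm_num), ih]

theorem dyad_shift (j : Fin n → ℕ) (k : ℕ) (a : ℝ) :
    dyad (shift j k) a = 2 ^ (-(a * (n * k))) * dyad j a := by
  rw [dyad, dyad, ← ENNReal.rpow_add _ _ (by norm_num) (by norm_num)]
  congr 1
  simp only [shift, Nat.cast_add, Finset.sum_add_distrib, Finset.sum_const, Finset.card_univ,
    Fintype.card_fin, nsmul_eq_mul]
  ring

/-- Shifting a multi-index changes its dyadic weights by a bounded factor. -/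
theorem exists_dyad_le_dyad_shift (n k : ℕ) (a : ℝ) :
    ∃ K : ℝ≥0∞, K ≠ ⊤ ∧ ∀ j : Fin n → ℕ,
      dyad j a ≤ K * dyad (shift j k) a ∧ dyad (shift j k) a ≤ K * dyad j a := by
  have h0 : (2 : ℝ≥0∞) ≠ 0 := by norm_num
  have h1 : (2 : ℝ≥0∞) ≠ ⊤ := by norm_num
  refine ⟨2 ^ |a * (n * k)|, ENNReal.rpow_ne_top_of_ne_zero h0 h1, fun j => ⟨?_, ?_⟩⟩
  · rw [dyad_shift, ← mul_assoc, ← ENNReal.rpow_add _ _ h0 h1]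
    refine le_mul_of_one_le_left zero_le ?_
    rw [← ENNReal.rpow_zero (x := 2)]
    refine ENNReal.rpow_le_rpow_of_exponent_le (by norm_num) ?_
    linarith [le_abs_self (a * (n * k))]
  · rw [dyad_shift]
    refine mul_le_mul' (ENNReal.rpow_le_rpow_of_exponent_le (by norm_num) (neg_le_abs _)) le_rfl

theorem ofReal_half_pow (k : ℕ) : ENNReal.ofReal ((1 / 2 : ℝ) ^ k) = 2 ^ (-(k : ℝ)) := by
  rw [ENNReal.ofReal_pow (by norm_num), one_div, ENNReal.ofReal_inv_of_pos (by norm_num),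
    ENNReal.rpow_neg, ENNReal.rpow_natCast, ENNReal.inv_pow]
  norm_num

theorem volume_dyadicBox (j : Fin n → ℕ) : volume (dyadicBox j) = dyad (shift j 1) 1 := by
  rw [dyadicBox, volume_pi_pi, dyad_eq_prod]
  refine Finset.prod_congr rfl fun i _ => ?_
  rw [dyadicIco, Real.volume_Ico, one_mul, shift, ← ofReal_half_pow]
  congr 1
  rw [pow_succ]; ring

theorem volume_dyadicBox_le (j : Fin n → ℕ) : volume (dyadicBox j) ≤ dyad j 1 := by
  rw [volume_dyadicBox, dyad_shift]
  refine mul_le_of_le_one_left zero_le ?_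
  rw [← ENNReal.rpow_zero (x := 2)]
  refine ENNReal.rpow_le_rpow_of_exponent_le (by norm_num) ?_
  have : (0 : ℝ) ≤ 1 * (n * (1 : ℕ)) := by positivity
  linarith

theorem volume_boxWindow_le (j : Fin n → ℕ) : volume (boxWindow j) ≤ dyad j 1 := by
  rw [boxWindow, volume_pi_pi, dyad_eq_prod]
  refine Finset.prod_le_prod' fun i _ => ?_
  rw [window, Real.volume_Ioo, one_mul, ← ofReal_half_pow]
  apply ENNReal.ofReal_le_ofReal
  have : (0 : ℝ) < (1 / 2) ^ j i := by positivity
  linarith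

theorem prod_ofReal_four_pow (j : Fin n → ℕ) :
    ∏ i, ENNReal.ofReal (1000 * 4 ^ j i) = 1000 ^ n * dyad j (-2) := by
  have : ∀ i, ENNReal.ofReal (1000 * 4 ^ j i) = 1000 * 2 ^ (-(-2 * (j i : ℝ))) := by
    intro i
    rw [ENNReal.ofReal_mul (by norm_num), ENNReal.ofReal_pow (by norm_num),
      show -(-2 * (j i : ℝ)) = 2 * (j i : ℝ) by ring, ENNReal.rpow_mul, ENNReal.rpow_natCast]
    norm_num
  simp only [this]
  rw [Finset.prod_mul_distrib, dyad_eq_prod]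
  simp

theorem rpow_le_two_rpow_abs {x : ℝ} (γ : ℝ) (h1 : 1 / 2 ≤ x) (h2 : x ≤ 2) : x ^ γ ≤ 2 ^ |γ| := by
  have hx : 0 < x := by linarith
  rw [Real.rpow_def_of_pos hx, Real.rpow_def_of_pos (by norm_num : (0 : ℝ) < 2)]
  apply Real.exp_le_exp.2
  have hl : |Real.log x| ≤ Real.log 2 := by
    rw [abs_le]
    refine ⟨?_, Real.log_le_log hx h2⟩
    rw [← Real.log_inv]
    exact Real.log_le_log (by norm_num) (by linarith)
  calc Real.log x * γ ≤ |Real.log x * γ| := le_abs_self _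
    _ = |Real.log x| * |γ| := abs_mul _ _
    _ ≤ _ := by gcongr

/-- On a dyadic box the weight `(1 - R) ^ γ` is comparable to the dyadic weight `2 ^ (-γ |j|)`. -/
theorem exists_weight_comparable (n : ℕ) (γ : ℝ) :
    ∃ K : ℝ≥0∞, K ≠ ⊤ ∧ ∀ j : Fin n → ℕ, ∀ R ∈ dyadicBox j,
      weight γ R ≤ K * dyad j γ ∧ dyad j γ ≤ K * weight γ R := by
  refine ⟨ENNReal.ofReal (2 ^ |γ|) ^ n, ENNReal.pow_ne_top ENNReal.ofReal_ne_top,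
    fun j R hR => ?_⟩
  have h0 : ∀ i, (1 / 2 : ℝ) ^ j i / 2 ≤ 1 - R i ∧ 1 - R i ≤ (1 / 2 : ℝ) ^ j i := by
    intro i
    have h := hR i trivial
    have h2 := h.2
    rw [pow_succ] at h2
    exact ⟨by linarith, by linarith [h.1]⟩
  have hpos : ∀ i, 0 < (1 / 2 : ℝ) ^ j i := fun i => by positivity
  have hpos' : ∀ i, 0 < 1 - R i := fun i => by linarith [(h0 i).1, hpos i]
  have hd : ∀ i, (2 : ℝ≥0∞) ^ (-(γ * (j i : ℝ))) = ENNReal.ofReal (((1 / 2 : ℝ) ^ j i) ^ γ) := by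
    intro i
    rw [← ENNReal.ofReal_rpow_of_pos (hpos i), ofReal_half_pow, ← ENNReal.rpow_mul]
    congr 1; ring
  have hw : weight γ R = ∏ i, ENNReal.ofReal ((1 - R i) ^ γ) := by
    rw [weight, ENNReal.ofReal_prod_of_nonneg fun i _ => by have := hpos' i; positivity]
  have hc : ENNReal.ofReal (2 ^ |γ|) ^ n = ∏ _i : Fin n, ENNReal.ofReal (2 ^ |γ|) := by simp
  rw [hw, dyad_eq_prod, hc, ← Finset.prod_mul_distrib, ← Finset.prod_mul_distrib]
  constructor
  · refine Finset.prod_le_prod' fun i _ => ?_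
    rw [hd, ← ENNReal.ofReal_mul (by positivity)]
    apply ENNReal.ofReal_le_ofReal
    rw [← div_le_iff₀ (by have := hpos i; positivity), ← Real.div_rpow (hpos' i).le (hpos i).le]
    apply rpow_le_two_rpow_abs
    · rw [le_div_iff₀ (hpos i)]; linarith [(h0 i).1]
    · rw [div_le_iff₀ (hpos i)]; linarith [(h0 i).2, hpos i]
  · refine Finset.prod_le_prod' fun i _ => ?_
    rw [hd, ← ENNReal.ofReal_mul (by positivity)]
    apply ENNReal.ofReal_le_ofReal
    rw [← div_le_iff₀ (by have := hpos' i; positivity), ← Real.div_rpow (hpos i).le (hpos' i).le]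
    apply rpow_le_two_rpow_abs
    · rw [le_div_iff₀ (hpos' i)]; linarith [(h0 i).2, hpos i]
    · rw [div_le_iff₀ (hpos' i)]; linarith [(h0 i).1]

theorem exists_mem_dyadicIco {x : ℝ} (h0 : 0 ≤ x) (h1 : x < 1) : ∃ j, x ∈ dyadicIco j := by
  obtain ⟨j, hj1, hj2⟩ := exists_nat_pow_near_of_lt_one (x := 1 - x) (y := (1 / 2 : ℝ))
    (by linarith) (by linarith) (by norm_num) (by norm_num)
  exact ⟨j, by linarith, by linarith⟩

theorem dyadicIco_disjoint {j k : ℕ} (h : j ≠ k) : Disjoint (dyadicIco j) (dyadicIco k) := by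
  have key : ∀ j k : ℕ, j < k → Disjoint (dyadicIco j) (dyadicIco k) := by
    intro j k hjk
    rw [Set.disjoint_left]
    intro x hx hx'
    have h1 : (1 / 2 : ℝ) ^ k ≤ (1 / 2 : ℝ) ^ (j + 1) :=
      pow_le_pow_of_le_one (by norm_num) (by norm_num) hjk
    linarith [hx.2, hx'.1]
  rcases h.lt_or_gt with h | h
  · exact key _ _ h
  · exact (key _ _ h).symm

theorem radii_eq_iUnion : radii n = ⋃ j : Fin n → ℕ, dyadicBox j := by
  ext R
  simp only [mem_iUnion]
  constructor
  · intro hR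
    choose j hj using fun i => exists_mem_dyadicIco (hR i).1 (hR i).2
    exact ⟨j, fun i _ => hj i⟩
  · rintro ⟨j, hj⟩
    exact dyadicBox_subset_radii j hj

theorem lintegral_radii_eq_tsum (F : (Fin n → ℝ) → ℝ≥0∞) :
    ∫⁻ R in radii n, F R = ∑' j : Fin n → ℕ, ∫⁻ R in dyadicBox j, F R := by
  rw [radii_eq_iUnion, lintegral_iUnion measurableSet_dyadicBox]
  intro j k hjk
  obtain ⟨_, hi⟩ := Function.ne_iff.1 hjk
  rw [Function.onFun, Set.disjoint_left]
  intro R hR hR'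
  exact Set.disjoint_left.1 (dyadicIco_disjoint hi) (hR _ trivial) (hR' _ trivial)

theorem le_boxMid_shift {j : Fin n → ℕ} {R : Fin n → ℝ} (hR : R ∈ dyadicBox j) :
    R ≤ boxMid (shift j 1) := by
  intro i
  have h := (hR i trivial).2
  have : (0 : ℝ) < (1 / 2) ^ (j i + 1) := by positivity
  simp only [boxMid, shift, dyadicMid]
  linarith

theorem boxMid_le_of_mem_shift {j : Fin n → ℕ} {R : Fin n → ℝ} (hR : R ∈ dyadicBox (shift j 1)) :
    boxMid j ≤ R := by
  intro i
  have h := (hR i trivial).1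
  have : (0 : ℝ) < (1 / 2) ^ j i := by positivity
  simp only [shift, pow_succ] at h
  simp only [boxMid, dyadicMid]
  linarith

theorem boxMid_mono {j k : Fin n → ℕ} (h : j ≤ k) : boxMid j ≤ boxMid k := by
  intro i
  have : (1 / 2 : ℝ) ^ k i ≤ (1 / 2 : ℝ) ^ j i :=
    pow_le_pow_of_le_one (by norm_num) (by norm_num) (h i)
  simp only [boxMid, dyadicMid]
  linarith

theorem le_shift (j : Fin n → ℕ) (k : ℕ) : j ≤ shift j k := fun _ => Nat.le_add_right _ _

theorem powerMean_boxMid_mono {f : (Fin n → ℂ) → ℂ} (hf : f ∈ holo n) {p : ℝ} (hp : 0 < p)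
    {j k : Fin n → ℕ} (h : j ≤ k) : powerMean p f (boxMid j) ≤ powerMean p f (boxMid k) :=
  powerMean_mono hf hp (boxMid_mem_radii j) (boxMid_mem_radii k) (boxMid_mono h)

/-! ### Inequalities for sums and integrals of nonnegative functions -/

/-- Jensen's inequality for `x ↦ x ^ P` on a space of finite measure. -/
theorem lintegral_rpow_le {α : Type*} [MeasurableSpace α] (μ : Measure α) {F : α → ℝ≥0∞}
    (hF : AEMeasurable F μ) {P : ℝ} (hP : 1 ≤ P) :
    (∫⁻ x, F x ∂μ) ^ P ≤ μ univ ^ (P - 1) * ∫⁻ x, F x ^ P ∂μ := by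
  rcases hP.eq_or_lt with rfl | hP
  · simp
  have hP0 : 0 < P := by linarith
  have hpq : P.HolderConjugate (P / (P - 1)) := Real.HolderConjugate.conjExponent hP
  have h := ENNReal.lintegral_mul_le_Lp_mul_Lq μ hpq hF (aemeasurable_const (b := (1 : ℝ≥0∞)))
  simp only [Pi.mul_apply, mul_one, ENNReal.one_rpow, lintegral_const, one_mul] at h
  calc (∫⁻ x, F x ∂μ) ^ P
      ≤ ((∫⁻ x, F x ^ P ∂μ) ^ (1 / P) * μ univ ^ (1 / (P / (P - 1)))) ^ P := by gcongr
    _ = _ := by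
      rw [ENNReal.mul_rpow_of_nonneg _ _ hP0.le, ← ENNReal.rpow_mul, ← ENNReal.rpow_mul,
        one_div_mul_cancel hP0.ne', ENNReal.rpow_one, mul_comm]
      congr 2
      field_simp

theorem tsum_rpow_le_rpow_tsum {ι : Type*} (F : ι → ℝ≥0∞) {P : ℝ} (hP : 1 ≤ P) :
    ∑' j, F j ^ P ≤ (∑' j, F j) ^ P := by
  rw [ENNReal.tsum_eq_iSup_sum]
  refine iSup_le fun s => ?_
  refine le_trans ?_ (ENNReal.rpow_le_rpow (ENNReal.sum_le_tsum s) (by linarith))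
  classical
  induction s using Finset.induction_on with
  | empty => simp
  | insert i s hi ih =>
    rw [Finset.sum_insert hi, Finset.sum_insert hi]
    exact (add_le_add le_rfl ih).trans (ENNReal.add_rpow_le_rpow_add _ _ hP)

theorem rpow_tsum_le_tsum_rpow {ι : Type*} (F : ι → ℝ≥0∞) {s : ℝ} (hs0 : 0 < s) (hs : s ≤ 1) :
    (∑' j, F j) ^ s ≤ ∑' j, F j ^ s := by
  have h := tsum_rpow_le_rpow_tsum (fun j => F j ^ s) (P := 1 / s) (by
    rw [le_div_iff₀ hs0]; linarith)
  simp only [← ENNReal.rpow_mul, mul_one_div_cancel hs0.ne', ENNReal.rpow_one] at h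
  calc (∑' j, F j) ^ s ≤ ((∑' j, F j ^ s) ^ (1 / s)) ^ s := by gcongr
    _ = _ := by rw [← ENNReal.rpow_mul, one_div_mul_cancel hs0.ne', ENNReal.rpow_one]

/-- Minkowski's inequality for countable sums of nonnegative functions. -/
theorem lintegral_rpow_tsum_le {α ι : Type*} [MeasurableSpace α] [Countable ι] (μ : Measure α)
    {F : ι → α → ℝ≥0∞} (hF : ∀ j, AEMeasurable (F j) μ) {P : ℝ} (hP : 1 ≤ P) :
    (∫⁻ x, (∑' j, F j x) ^ P ∂μ) ^ (1 / P) ≤ ∑' j, (∫⁻ x, F j x ^ P ∂μ) ^ (1 / P) := by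
  classical
  have hP0 : 0 < P := by linarith
  have hfin : ∀ s : Finset ι, (∫⁻ x, (∑ j ∈ s, F j x) ^ P ∂μ) ^ (1 / P) ≤
      ∑ j ∈ s, (∫⁻ x, F j x ^ P ∂μ) ^ (1 / P) := by
    intro s
    induction s using Finset.induction_on with
    | empty => simp [hP0, ENNReal.zero_rpow_of_pos]
    | insert i s hi ih =>
      simp only [Finset.sum_insert hi]
      refine (ENNReal.lintegral_Lp_add_le (hF i)
        (Finset.aemeasurable_fun_sum s fun j _ => hF j) hP).trans ?_
      gcongr
  have hsup : ∀ x, (∑' j, F j x) ^ P = ⨆ s : Finset ι, (∑ j ∈ s, F j x) ^ P := by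
    intro x
    rw [ENNReal.tsum_eq_iSup_sum]
    exact (ENNReal.orderIsoRpow P hP0).map_iSup _
  have hle : ∫⁻ x, (∑' j, F j x) ^ P ∂μ ≤ (∑' j, (∫⁻ x, F j x ^ P ∂μ) ^ (1 / P)) ^ P := by
    simp only [hsup]
    rw [lintegral_iSup_directed
      (fun s => (Finset.aemeasurable_fun_sum s fun j _ => hF j).pow_const P)]
    · refine iSup_le fun s => ?_
      have h1 := (hfin s).trans (ENNReal.sum_le_tsum s)
      have h2 := ENNReal.rpow_le_rpow h1 hP0.le
      rwa [← ENNReal.rpow_mul, one_div_mul_cancel hP0.ne', ENNReal.rpow_one] at h2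
    · refine directed_of_isDirected_le fun s t hst x => ?_
      exact ENNReal.rpow_le_rpow (Finset.sum_le_sum_of_subset hst) hP0.le
  calc _ ≤ ((∑' j, (∫⁻ x, F j x ^ P ∂μ) ^ (1 / P)) ^ P) ^ (1 / P) :=
        ENNReal.rpow_le_rpow hle (by positivity)
    _ = _ := by rw [← ENNReal.rpow_mul, mul_one_div_cancel hP0.ne', ENNReal.rpow_one]

/-- Minkowski's inequality, with the discrete norm outside and the integral inside. -/
theorem tsum_rpow_lintegral_le {α ι : Type*} [MeasurableSpace α] (μ : Measure α)
    {W : ι → α → ℝ≥0∞} (hW : ∀ j, AEMeasurable (W j) μ) {P : ℝ} (hP : 1 ≤ P) :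
    ∑' j, (∫⁻ x, W j x ∂μ) ^ P ≤ (∫⁻ x, (∑' j, W j x ^ P) ^ (1 / P) ∂μ) ^ P := by
  rcases hP.eq_or_lt with rfl | hP1
  · simp only [ENNReal.rpow_one, div_one]
    rw [ENNReal.tsum_eq_iSup_sum]
    refine iSup_le fun s => ?_
    rw [← lintegral_finsetSum' _ fun j _ => hW j]
    exact lintegral_mono fun x => ENNReal.sum_le_tsum s
  have hP0 : 0 < P := by linarith
  have hpq : P.HolderConjugate (P / (P - 1)) := Real.HolderConjugate.conjExponent hP1
  set N := ∫⁻ x, (∑' j, W j x ^ P) ^ (1 / P) ∂μ with hN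
  rcases eq_or_ne N ⊤ with hNt | hNt
  · rw [hNt, ENNReal.top_rpow_of_pos hP0]; exact le_top
  have hA : ∀ j, ∫⁻ x, W j x ∂μ ≤ N := by
    intro j
    refine lintegral_mono fun x => ?_
    calc W j x = (W j x ^ P) ^ (1 / P) := by
          rw [← ENNReal.rpow_mul, mul_one_div_cancel hP0.ne', ENNReal.rpow_one]
      _ ≤ _ := ENNReal.rpow_le_rpow (ENNReal.le_tsum j) (by positivity)
  rw [ENNReal.tsum_eq_iSup_sum]
  refine iSup_le fun s => ?_
  set A : ι → ℝ≥0∞ := fun j => ∫⁻ x, W j x ∂μ with hAdef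
  have hAt : ∀ j, A j ≠ ⊤ := fun j => ((hA j).trans_lt hNt.lt_top).ne
  set X := ∑ j ∈ s, A j ^ P with hX
  have hXt : X ≠ ⊤ := ENNReal.sum_ne_top.2 fun j _ => ENNReal.rpow_ne_top_of_nonneg hP0.le (hAt j)
  have hq0 : 0 < P - 1 := by linarith
  have h1 : X ≤ N * X ^ (1 / (P / (P - 1))) := by
    calc X = ∑ j ∈ s, ∫⁻ x, W j x * A j ^ (P - 1) ∂μ := by
          refine Finset.sum_congr rfl fun j _ => ?_
          rw [lintegral_mul_const'' _ (hW j)]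
          change A j ^ P = A j * A j ^ (P - 1)
          conv_rhs => rw [← ENNReal.rpow_one (A j), ← ENNReal.rpow_mul, one_mul]
          rw [← ENNReal.rpow_add_of_nonneg _ _ zero_le_one hq0.le]
          congr 1; ring
      _ = ∫⁻ x, ∑ j ∈ s, W j x * A j ^ (P - 1) ∂μ :=
          (lintegral_finsetSum' _ fun j _ => (hW j).mul_const _).symm
      _ ≤ ∫⁻ x, (∑' j, W j x ^ P) ^ (1 / P) * X ^ (1 / (P / (P - 1))) ∂μ := by
          refine lintegral_mono fun x => ?_
          refine (ENNReal.inner_le_Lp_mul_Lq s (fun j => W j x)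
            (fun j => A j ^ (P - 1)) hpq).trans ?_
          gcongr ?_ * ?_
          · exact ENNReal.rpow_le_rpow (ENNReal.sum_le_tsum s) (by positivity)
          · refine le_of_eq ?_
            congr 1
            refine Finset.sum_congr rfl fun j _ => ?_
            rw [← ENNReal.rpow_mul]
            congr 1
            field_simp
      _ = _ := by
          rw [lintegral_mul_const']
          exact ENNReal.rpow_ne_top_of_nonneg (by positivity) hXt
  rcases eq_or_ne X 0 with hX0 | hX0
  · rw [hX0]; exact zero_le
  have h2 : X ^ (1 / P) ≤ N := by
    have h3 : X = X ^ (1 / P) * X ^ (1 / (P / (P - 1))) := by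
      rw [← ENNReal.rpow_add _ _ hX0 hXt]
      have : 1 / P + 1 / (P / (P - 1)) = 1 := by field_simp; ring
      rw [this, ENNReal.rpow_one]
    have hne : X ^ (1 / (P / (P - 1))) ≠ 0 := (ENNReal.rpow_pos hX0.bot_lt hXt).ne'
    have hnt : X ^ (1 / (P / (P - 1))) ≠ ⊤ := ENNReal.rpow_ne_top_of_nonneg (by positivity) hXt
    exact (ENNReal.mul_le_mul_iff_left hne hnt).1 (h3.symm.le.trans h1)
  rwa [one_div, ENNReal.rpow_inv_le_iff hP0] at h2

/-! ### Dyadic description of the mixed norm and Lizorkin–Triebel spaces -/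

theorem lintegral_boxWindow_le {V : UnitAddTorus (Fin n) → ℝ≥0∞} (hV : Measurable V)
    (θ : UnitAddTorus (Fin n)) (j : Fin n → ℕ) :
    ∫⁻ y in boxWindow j, V (θ + toTorus y) ≤ ∫⁻ η, V η := by
  have hmp : MeasurePreserving (toTorus : (Fin n → ℝ) → UnitAddTorus (Fin n))
      (Measure.pi fun _ => volume.restrict (Ioc (-(1 / 2) : ℝ) (-(1 / 2) + 1))) volume :=
    measurePreserving_pi _ _ fun _ => UnitAddCircle.measurePreserving_mk (-(1 / 2))
  have hVθ : Measurable fun η => V (θ + η) := hV.comp (measurable_const_add θ)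
  rw [← lintegral_add_left_eq_self V θ, ← hmp.lintegral_comp hVθ, ← Measure.restrict_pi_pi]
  refine lintegral_mono_set fun y hy i _ => ?_
  have h := hy i trivial
  have h1 : (1 / 2 : ℝ) ^ j i ≤ 1 := pow_le_one₀ (by norm_num) (by norm_num)
  exact ⟨by linarith [h.1], by linarith [h.2]⟩

theorem measurable_weight (γ : ℝ) : Measurable (weight γ : (Fin n → ℝ) → ℝ≥0∞) := by
  unfold weight
  refine ENNReal.measurable_ofReal.comp (Finset.measurable_fun_prod _ fun i _ => ?_)
  exact (measurable_const.sub (measurable_pi_apply i)).pow_const γ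

/-- Point evaluation at the centre of a dyadic box is bounded by a slightly larger mean. -/
theorem enorm_rpow_le_powerMean {f : (Fin n → ℂ) → ℂ} (hf : f ∈ holo n) {p : ℝ} (hp : 0 < p)
    (j : Fin n → ℕ) (θ : UnitAddTorus (Fin n)) :
    ‖f (torusPoint (boxMid j) θ)‖ₑ ^ p ≤
      1000 ^ n * dyad j (-1) * powerMean p f (boxMid (shift j 1)) := by
  refine (enorm_rpow_le_lintegral_box hf hp j θ).trans ?_
  have h1 : ∫⁻ y in boxWindow j, ∫⁻ R in dyadicBox j, ‖f (torusPoint R (θ + toTorus y))‖ₑ ^ p ≤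
      dyad j 1 * powerMean p f (boxMid (shift j 1)) := by
    calc _ = ∫⁻ y in boxWindow j, ∫⁻ R in dyadicBox j,
            ‖cutoff f (torusPoint R (θ + toTorus y))‖ₑ ^ p := by
          refine lintegral_congr fun y => ?_
          refine setLIntegral_congr_fun (measurableSet_dyadicBox j) fun R hR => ?_
          simp only [cutoff_torusPoint f (dyadicBox_subset_radii j hR)]
      _ = ∫⁻ R in dyadicBox j, ∫⁻ y in boxWindow j,
            ‖cutoff f (torusPoint R (θ + toTorus y))‖ₑ ^ p := by
          have hc : Continuous fun q : (Fin n → ℝ) × (Fin n → ℝ) => (q.2, θ + toTorus q.1) := by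
            fun_prop
          have hm : Measurable fun q : (Fin n → ℝ) × (Fin n → ℝ) =>
              ‖cutoff f (torusPoint q.2 (θ + toTorus q.1))‖ₑ ^ p :=
            ((measurable_cutoff hf).comp
              (continuous_torusPoint.comp hc).measurable).enorm.pow_const p
          exact lintegral_lintegral_swap (f := fun y R =>
            ‖cutoff f (torusPoint R (θ + toTorus y))‖ₑ ^ p) hm.aemeasurable
      _ ≤ ∫⁻ _R in dyadicBox j, powerMean p f (boxMid (shift j 1)) := by
          refine setLIntegral_mono' (measurableSet_dyadicBox j) fun R hR => ?_
          have hm : Measurable fun η => ‖cutoff f (torusPoint R η)‖ₑ ^ p :=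
            ((measurable_cutoff hf).comp (continuous_torusPoint.comp
              (Continuous.prodMk_right R)).measurable).enorm.pow_const p
          refine (lintegral_boxWindow_le hm θ j).trans ?_
          simp only [cutoff_torusPoint f (dyadicBox_subset_radii j hR)]
          exact powerMean_mono hf hp (dyadicBox_subset_radii j hR) (boxMid_mem_radii _)
            (le_boxMid_shift hR)
      _ ≤ _ := by
          rw [setLIntegral_const, mul_comm]
          gcongr
          exact volume_dyadicBox_le j
  calc _ ≤ 1000 ^ n * dyad j (-2) * (dyad j 1 * powerMean p f (boxMid (shift j 1))) := by
        rw [prod_ofReal_four_pow]; gcongr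
    _ = _ := by
        rw [show (-1 : ℝ) = -2 + 1 by norm_num, dyad_add]
        ring

/-- The inclusion of Hardy-type means: for `p ≤ t`, `M_t` is controlled by `M_p` with the loss
`2 ^ (|j| (1/p - 1/t))`. -/
theorem powerMean_le_powerMean_rpow {f : (Fin n → ℂ) → ℂ} (hf : f ∈ holo n) {p t : ℝ}
    (hp : 0 < p) (hpt : p ≤ t) (j : Fin n → ℕ) :
    powerMean t f (boxMid j) ≤ (1000 ^ n) ^ (t / p - 1) * dyad j (1 - t / p) *
      powerMean p f (boxMid (shift j 1)) ^ (t / p) := by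
  have hs : 0 ≤ t / p - 1 := by rw [sub_nonneg, le_div_iff₀ hp]; linarith
  set M := powerMean p f (boxMid (shift j 1))
  calc powerMean t f (boxMid j)
      ≤ ∫⁻ θ, (1000 ^ n * dyad j (-1) * M) ^ (t / p - 1) * ‖f (torusPoint (boxMid j) θ)‖ₑ ^ p := by
        refine lintegral_mono fun θ => ?_
        have h1 : ‖f (torusPoint (boxMid j) θ)‖ₑ ^ t = (‖f (torusPoint (boxMid j) θ)‖ₑ ^ p) ^
            (t / p - 1) * ‖f (torusPoint (boxMid j) θ)‖ₑ ^ p := by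
          rw [← ENNReal.rpow_mul, ← ENNReal.rpow_add_of_nonneg _ _ (by positivity) hp.le]
          congr 1
          field_simp
          ring
        simp only [h1]
        gcongr
        exact enorm_rpow_le_powerMean hf hp j θ
    _ = (1000 ^ n * dyad j (-1) * M) ^ (t / p - 1) * powerMean p f (boxMid j) := by
        rw [powerMean, lintegral_const_mul'' _ (by
          have := (continuous_enorm_rpow_torusPoint hf hp (boxMid_mem_radii j)).measurable
          have h2 := (ENNReal.measurable_ofReal.comp this).aemeasurable
            (μ := (volume : Measure (UnitAddTorus (Fin n))))
          refine h2.congr (Filter.Eventually.of_forall fun θ => ?_)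
          simp only [Function.comp]
          rw [← ENNReal.ofReal_rpow_of_nonneg (norm_nonneg _) hp.le, ofReal_norm])]
    _ ≤ (1000 ^ n * dyad j (-1) * M) ^ (t / p - 1) * M := by
        gcongr
        exact powerMean_boxMid_mono hf hp (le_shift j 1)
    _ = _ := by
        rw [ENNReal.mul_rpow_of_nonneg _ _ hs, ENNReal.mul_rpow_of_nonneg _ _ hs, dyad_rpow,
          show -1 * (t / p - 1) = 1 - t / p by ring, mul_assoc (_ * _)]
        congr 1
        conv_lhs => rw [← ENNReal.rpow_one M, ← ENNReal.rpow_mul, one_mul]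
        rw [← ENNReal.rpow_add_of_nonneg _ _ hs zero_le_one]
        congr 1; ring

/-- The part over a dyadic box of the inner integral of the Lizorkin–Triebel norm, with the weight
`(1 - R) ^ γ`. -/
def boxInt (q γ : ℝ) (f : (Fin n → ℂ) → ℂ) (j : Fin n → ℕ) (θ : UnitAddTorus (Fin n)) : ℝ≥0∞ :=
  ∫⁻ R in dyadicBox j, ‖f (torusPoint R θ)‖ₑ ^ q * weight γ R

theorem lintegral_radii_eq_tsum_boxInt (q γ : ℝ) (f : (Fin n → ℂ) → ℂ)
    (θ : UnitAddTorus (Fin n)) :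
    ∫⁻ R in radii n, ‖f (torusPoint R θ)‖ₑ ^ q * weight γ R = ∑' j, boxInt q γ f j θ :=
  lintegral_radii_eq_tsum _

theorem measurable_boxInt {f : (Fin n → ℂ) → ℂ} (hf : f ∈ holo n) (q γ : ℝ) (j : Fin n → ℕ) :
    Measurable (boxInt q γ f j) := by
  have h : boxInt q γ f j = fun θ => ∫⁻ R in dyadicBox j,
      ‖cutoff f (torusPoint R θ)‖ₑ ^ q * weight γ R := by
    funext θ
    refine setLIntegral_congr_fun (measurableSet_dyadicBox j) fun R hR => ?_
    simp only [cutoff_torusPoint f (dyadicBox_subset_radii j hR)]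
  rw [h]
  refine Measurable.lintegral_prod_left' (f := fun x : (Fin n → ℝ) × UnitAddTorus (Fin n) =>
    ‖cutoff f (torusPoint x.1 x.2)‖ₑ ^ q * weight γ x.1) ?_
  exact (measurable_cutoff_torusPoint hf q).mul ((measurable_weight γ).comp measurable_fst)

/-- Over a dyadic box the weight `(1 - R) ^ γ` may be replaced by the dyadic weight. -/
theorem exists_boxInt_comparable (n : ℕ) (γ : ℝ) :
    ∃ K : ℝ≥0∞, K ≠ ⊤ ∧ ∀ (q : ℝ) (f : (Fin n → ℂ) → ℂ) (j : Fin n → ℕ)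
      (θ : UnitAddTorus (Fin n)),
      boxInt q γ f j θ ≤ K * dyad j γ * ∫⁻ R in dyadicBox j, ‖f (torusPoint R θ)‖ₑ ^ q ∧
      ∫⁻ R in dyadicBox j, ‖f (torusPoint R θ)‖ₑ ^ q ≤ K * dyad j (-γ) * boxInt q γ f j θ := by
  obtain ⟨K, hK, hw⟩ := exists_weight_comparable n γ
  refine ⟨K, hK, fun q f j θ => ⟨?_, ?_⟩⟩
  · rw [← lintegral_const_mul' _ _ (ENNReal.mul_ne_top hK (dyad_ne_top j γ))]
    refine setLIntegral_mono' (measurableSet_dyadicBox j) fun R hR => ?_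
    rw [mul_comm]
    gcongr
    exact (hw j R hR).1
  · rw [boxInt, ← lintegral_const_mul' _ _ (ENNReal.mul_ne_top hK (dyad_ne_top j _))]
    refine setLIntegral_mono' (measurableSet_dyadicBox j) fun R hR => ?_
    calc ‖f (torusPoint R θ)‖ₑ ^ q = (dyad j γ * dyad j (-γ)) * ‖f (torusPoint R θ)‖ₑ ^ q := by
          rw [dyad_mul_neg, one_mul]
      _ ≤ (K * weight γ R * dyad j (-γ)) * ‖f (torusPoint R θ)‖ₑ ^ q := by
          gcongr
          exact (hw j R hR).2
      _ = _ := by ring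

theorem measurable_enorm_torusPoint_box {f : (Fin n → ℂ) → ℂ} (hf : f ∈ holo n) (q : ℝ)
    (j : Fin n → ℕ) (θ : UnitAddTorus (Fin n)) :
    AEMeasurable (fun R => ‖f (torusPoint R θ)‖ₑ ^ q) (volume.restrict (dyadicBox j)) := by
  refine ((measurable_cutoff_torusPoint hf q).comp (by fun_prop :
    Measurable fun R : Fin n → ℝ => (R, θ))).aemeasurable.congr ?_
  filter_upwards [ae_restrict_mem (measurableSet_dyadicBox j)] with R hR
  simp only [Function.comp, cutoff_torusPoint f (dyadicBox_subset_radii j hR)]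

/-- Integrating over the torus first gives the integral means over a box. -/
theorem lintegral_lintegral_box {f : (Fin n → ℂ) → ℂ} (hf : f ∈ holo n) (p : ℝ)
    (j : Fin n → ℕ) :
    ∫⁻ θ, ∫⁻ R in dyadicBox j, ‖f (torusPoint R θ)‖ₑ ^ p =
      ∫⁻ R in dyadicBox j, powerMean p f R := by
  calc _ = ∫⁻ θ, ∫⁻ R in dyadicBox j, ‖cutoff f (torusPoint R θ)‖ₑ ^ p := by
        refine lintegral_congr fun θ => ?_
        refine setLIntegral_congr_fun (measurableSet_dyadicBox j) fun R hR => ?_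
        simp only [cutoff_torusPoint f (dyadicBox_subset_radii j hR)]
    _ = ∫⁻ R in dyadicBox j, ∫⁻ θ, ‖cutoff f (torusPoint R θ)‖ₑ ^ p := by
        have hm : Measurable fun q : UnitAddTorus (Fin n) × (Fin n → ℝ) =>
            ‖cutoff f (torusPoint q.2 q.1)‖ₑ ^ p :=
          ((measurable_cutoff hf).comp
            (continuous_torusPoint.comp continuous_swap).measurable).enorm.pow_const p
        exact lintegral_lintegral_swap (f := fun θ R => ‖cutoff f (torusPoint R θ)‖ₑ ^ p)
          hm.aemeasurable
    _ = _ := by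
        refine setLIntegral_congr_fun (measurableSet_dyadicBox j) fun R hR => ?_
        simp only [cutoff_torusPoint f (dyadicBox_subset_radii j hR), powerMean]

theorem measure_restrict_univ_box (j : Fin n → ℕ) :
    (volume.restrict (dyadicBox j)) univ = dyad (shift j 1) 1 := by
  rw [Measure.restrict_apply_univ, volume_dyadicBox]

/-- Lower bound of the Lizorkin–Triebel norm, case `p ≤ q`: Jensen's inequality in the radii and
monotonicity of the means. -/
theorem exists_powerMean_le_lintegral_of_le (n : ℕ) {p q : ℝ} (hp : 0 < p) (hpq : p ≤ q) :
    ∃ K : ℝ≥0∞, K ≠ ⊤ ∧ ∀ f ∈ holo n, ∀ j : Fin n → ℕ,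
      powerMean p f (boxMid j) ≤ K * dyad (shift j 1) (-(p / q)) *
        ∫⁻ θ, (∫⁻ R in dyadicBox (shift j 1), ‖f (torusPoint R θ)‖ₑ ^ q) ^ (p / q) := by
  have hq : 0 < q := by linarith
  have hP : 1 ≤ q / p := by rwa [le_div_iff₀ hp, one_mul]
  obtain ⟨K1, hK1, hsh1⟩ := exists_dyad_le_dyad_shift n 1 (-1)
  obtain ⟨K2, hK2, hsh2⟩ := exists_dyad_le_dyad_shift n 1 (1 - p / q)
  refine ⟨K1 * K2, ENNReal.mul_ne_top hK1 hK2, fun f hf j => ?_⟩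
  set k := shift j 1 with hk
  set V := volume (dyadicBox k) with hV
  have hVeq : V = dyad (shift k 1) 1 := volume_dyadicBox k
  have h1 : V * powerMean p f (boxMid j) ≤ ∫⁻ R in dyadicBox k, powerMean p f R := by
    rw [hV, mul_comm, ← setLIntegral_const]
    refine setLIntegral_mono' (measurableSet_dyadicBox k) fun R hR => ?_
    exact powerMean_mono hf hp (boxMid_mem_radii j) (dyadicBox_subset_radii k hR)
      (boxMid_le_of_mem_shift hR)
  have h2 : ∀ θ, ∫⁻ R in dyadicBox k, ‖f (torusPoint R θ)‖ₑ ^ p ≤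
      dyad (shift k 1) (1 - p / q) *
        (∫⁻ R in dyadicBox k, ‖f (torusPoint R θ)‖ₑ ^ q) ^ (p / q) := by
    intro θ
    have h := lintegral_rpow_le (volume.restrict (dyadicBox k))
      (measurable_enorm_torusPoint_box hf p k θ) hP
    simp only [← ENNReal.rpow_mul, mul_div_cancel₀ q hp.ne', measure_restrict_univ_box,
      dyad_rpow] at h
    have h3 := ENNReal.rpow_le_rpow h (by positivity : 0 ≤ p / q)
    rw [← ENNReal.rpow_mul, show q / p * (p / q) = 1 by field_simp, ENNReal.rpow_one,
      ENNReal.mul_rpow_of_nonneg _ _ (by positivity), dyad_rpow,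
      show 1 * (q / p - 1) * (p / q) = 1 - p / q by field_simp] at h3
    exact h3
  have h3 : V * powerMean p f (boxMid j) ≤ dyad (shift k 1) (1 - p / q) *
      ∫⁻ θ, (∫⁻ R in dyadicBox k, ‖f (torusPoint R θ)‖ₑ ^ q) ^ (p / q) := by
    refine h1.trans ?_
    rw [← lintegral_lintegral_box hf, ← lintegral_const_mul' _ _ (dyad_ne_top _ _)]
    exact lintegral_mono h2
  set I := ∫⁻ θ, (∫⁻ R in dyadicBox k, ‖f (torusPoint R θ)‖ₑ ^ q) ^ (p / q)
  calc powerMean p f (boxMid j) = dyad (shift k 1) (-1) * (V * powerMean p f (boxMid j)) := by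
        rw [hVeq, ← mul_assoc, ← dyad_add]; simp
    _ ≤ dyad (shift k 1) (-1) * (dyad (shift k 1) (1 - p / q) * I) := by gcongr
    _ ≤ (K1 * dyad k (-1)) * ((K2 * dyad k (1 - p / q)) * I) := by
        gcongr
        · exact (hsh1 k).2
        · exact (hsh2 k).2
    _ = _ := by
        rw [show -(p / q) = -1 + (1 - p / q) by ring, dyad_add]; ring

/-- Lower bound of the Lizorkin–Triebel norm, case `q ≤ p`: the sub-mean value inequality and
Jensen's inequality in the angles. -/
theorem powerMean_le_lintegral_of_le {p q : ℝ} (hq : 0 < q) (hqp : q ≤ p)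
    {f : (Fin n → ℂ) → ℂ} (hf : f ∈ holo n) (j : Fin n → ℕ) :
    powerMean p f (boxMid j) ≤ (1000 ^ n) ^ (p / q) * dyad j (-(p / q)) *
        ∫⁻ θ, (∫⁻ R in dyadicBox j, ‖f (torusPoint R θ)‖ₑ ^ q) ^ (p / q) := by
  have hp : 0 < p := by linarith
  have hP : 1 ≤ p / q := by rwa [le_div_iff₀ hq, one_mul]
  set W : UnitAddTorus (Fin n) → ℝ≥0∞ :=
    fun θ => ∫⁻ R in dyadicBox j, ‖f (torusPoint R θ)‖ₑ ^ q with hW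
  have hWm : Measurable W := by
    have := measurable_boxInt hf q 0 j
    have h2 : boxInt q 0 f j = W := by
      funext θ; simp [boxInt, W, weight]
    rwa [h2] at this
  have hpt : ∀ θ, ‖f (torusPoint (boxMid j) θ)‖ₑ ^ p ≤ (1000 ^ n * dyad j (-2)) ^ (p / q) *
      (dyad j 1 ^ (p / q - 1) * ∫⁻ y in boxWindow j, W (θ + toTorus y) ^ (p / q)) := by
    intro θ
    have h := enorm_rpow_le_lintegral_box hf hq j θ
    rw [prod_ofReal_four_pow] at h
    have h1 := ENNReal.rpow_le_rpow h (by positivity : 0 ≤ p / q)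
    rw [← ENNReal.rpow_mul, mul_div_cancel₀ p hq.ne',
      ENNReal.mul_rpow_of_nonneg _ _ (by positivity)] at h1
    refine h1.trans ?_
    gcongr
    refine (lintegral_rpow_le _ (hWm.comp (by fun_prop :
      Continuous fun y : Fin n → ℝ => θ + toTorus y).measurable).aemeasurable hP).trans ?_
    rw [Measure.restrict_apply_univ]
    exact mul_le_mul' (ENNReal.rpow_le_rpow (volume_boxWindow_le j) (by linarith)) le_rfl
  calc powerMean p f (boxMid j)
      ≤ ∫⁻ θ, (1000 ^ n * dyad j (-2)) ^ (p / q) *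
        (dyad j 1 ^ (p / q - 1) * ∫⁻ y in boxWindow j, W (θ + toTorus y) ^ (p / q)) :=
        lintegral_mono hpt
    _ = (1000 ^ n * dyad j (-2)) ^ (p / q) * (dyad j 1 ^ (p / q - 1) *
          ∫⁻ θ, ∫⁻ y in boxWindow j, W (θ + toTorus y) ^ (p / q)) := by
        have hm : Measurable fun x : UnitAddTorus (Fin n) × (Fin n → ℝ) =>
            W (x.1 + toTorus x.2) ^ (p / q) :=
          (hWm.comp (by fun_prop : Continuous fun x : UnitAddTorus (Fin n) × (Fin n → ℝ) =>
            x.1 + toTorus x.2).measurable).pow_const _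
        rw [lintegral_const_mul _ (hm.lintegral_prod_right'.const_mul _),
          lintegral_const_mul _ hm.lintegral_prod_right']
    _ = (1000 ^ n * dyad j (-2)) ^ (p / q) * (dyad j 1 ^ (p / q - 1) *
          ∫⁻ _y in boxWindow j, ∫⁻ θ, W θ ^ (p / q)) := by
        rw [lintegral_lintegral_swap (Measurable.aemeasurable ((hWm.comp (by fun_prop :
          Continuous fun x : UnitAddTorus (Fin n) × (Fin n → ℝ) =>
            x.1 + toTorus x.2).measurable).pow_const _))]
        congr 2
        refine lintegral_congr fun y => ?_
        exact lintegral_add_right_eq_self (fun θ => W θ ^ (p / q)) (toTorus y)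
    _ ≤ (1000 ^ n * dyad j (-2)) ^ (p / q) * (dyad j 1 ^ (p / q - 1) *
          ((∫⁻ θ, W θ ^ (p / q)) * dyad j 1)) := by
        rw [setLIntegral_const]
        gcongr
        exact volume_boxWindow_le j
    _ = _ := by
        rw [ENNReal.mul_rpow_of_nonneg _ _ (by positivity), dyad_rpow, dyad_rpow,
          show -(p / q) = -2 * (p / q) + (1 * (p / q - 1) + 1) by ring, dyad_add, dyad_add]
        ring

/-- Lower bound of the Lizorkin–Triebel norm, for arbitrary exponents. -/
theorem exists_powerMean_le_lintegral_boxInt (n : ℕ) {p q : ℝ} (hp : 0 < p) (hq : 0 < q) (α : ℝ) :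
    ∃ (k : ℕ) (K : ℝ≥0∞), K ≠ ⊤ ∧ ∀ f ∈ holo n, ∀ j : Fin n → ℕ,
      dyad j (α * p) * powerMean p f (boxMid j) ≤
        K * ∫⁻ θ, boxInt q (α * q - 1) f (shift j k) θ ^ (p / q) := by
  obtain ⟨k, K, hK, h⟩ : ∃ (k : ℕ) (K : ℝ≥0∞), K ≠ ⊤ ∧ ∀ f ∈ holo n, ∀ j : Fin n → ℕ,
      powerMean p f (boxMid j) ≤ K * dyad (shift j k) (-(p / q)) *
        ∫⁻ θ, (∫⁻ R in dyadicBox (shift j k), ‖f (torusPoint R θ)‖ₑ ^ q) ^ (p / q) := by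
    rcases le_total p q with hpq | hqp
    · obtain ⟨K, hK, h⟩ := exists_powerMean_le_lintegral_of_le n hp hpq
      exact ⟨1, K, hK, h⟩
    · exact ⟨0, (1000 ^ n) ^ (p / q), ENNReal.rpow_ne_top_of_nonneg (by positivity)
        (ENNReal.pow_ne_top (by norm_num)), fun f hf j => powerMean_le_lintegral_of_le hq hqp hf j⟩
  obtain ⟨K1, hK1, hsh⟩ := exists_dyad_le_dyad_shift n k (α * p)
  obtain ⟨K2, hK2, hb⟩ := exists_boxInt_comparable n (α * q - 1)
  have hP : 0 ≤ p / q := by positivity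
  refine ⟨k, K1 * K * K2 ^ (p / q), ENNReal.mul_ne_top (ENNReal.mul_ne_top hK1 hK)
    (ENNReal.rpow_ne_top_of_nonneg hP hK2), fun f hf j => ?_⟩
  set l := shift j k
  calc dyad j (α * p) * powerMean p f (boxMid j)
      ≤ (K1 * dyad l (α * p)) * (K * dyad l (-(p / q)) *
        ∫⁻ θ, (K2 * dyad l (-(α * q - 1)) * boxInt q (α * q - 1) f l θ) ^ (p / q)) := by
        gcongr
        · exact (hsh j).1
        · refine (h f hf j).trans ?_
          gcongr with θ
          exact (hb q f l θ).2
    _ = (K1 * dyad l (α * p)) * (K * dyad l (-(p / q)) * ((K2 ^ (p / q) *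
        dyad l (-(α * q - 1) * (p / q))) * ∫⁻ θ, boxInt q (α * q - 1) f l θ ^ (p / q))) := by
        simp only [ENNReal.mul_rpow_of_nonneg _ _ hP, dyad_rpow]
        rw [lintegral_const_mul' _ _ (ENNReal.mul_ne_top (ENNReal.rpow_ne_top_of_nonneg hP hK2)
          (dyad_ne_top _ _))]
    _ = K1 * K * K2 ^ (p / q) * (dyad l (α * p) * dyad l (-(p / q)) *
          dyad l (-(α * q - 1) * (p / q))) * ∫⁻ θ, boxInt q (α * q - 1) f l θ ^ (p / q) := by
        ring
    _ = _ := by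
        rw [← dyad_add, ← dyad_add, show α * p + -(p / q) + -(α * q - 1) * (p / q) = 0 by
          field_simp; ring, dyad_zero, mul_one]

/-- The dyadic form `∑ⱼ 2 ^ (-α q |j|) M_p(f, ρⱼ) ^ q` of the norm of `A^{p,q}_α`, where `ρⱼ` is
the centre of the dyadic box with index `j`. -/
def dyadicNorm (p q α : ℝ) (f : (Fin n → ℂ) → ℂ) : ℝ≥0∞ :=
  ∑' j : Fin n → ℕ, dyad j (α * q) * powerMean p f (boxMid j) ^ (q / p)

/-- Monotonicity of the spaces `A^{p,τ}_α` in `τ`. -/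
theorem dyadicNorm_le_rpow (p α : ℝ) {τ s : ℝ} (hτ : 0 < τ) (hτs : τ ≤ s) (f : (Fin n → ℂ) → ℂ) :
    dyadicNorm p s α f ≤ dyadicNorm p τ α f ^ (s / τ) := by
  have hs : 0 < s := hτ.trans_le hτs
  calc _ = ∑' k : Fin n → ℕ,
        (dyad k (α * τ) * powerMean p f (boxMid k) ^ (τ / p)) ^ (s / τ) := by
        refine tsum_congr fun k => ?_
        rw [ENNReal.mul_rpow_of_nonneg _ _ (by positivity), dyad_rpow, ← ENNReal.rpow_mul]
        congr 2 <;> field_simp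
    _ ≤ _ := tsum_rpow_le_rpow_tsum _ (by rwa [le_div_iff₀ hτ, one_mul])

theorem integralMean_rpow (p q : ℝ) (f : (Fin n → ℂ) → ℂ) (r : Fin n → ℝ) :
    integralMean p f r ^ q = powerMean p f r ^ (q / p) := by
  rw [integralMean_eq, ← ENNReal.rpow_mul]
  congr 1; ring

/-- Since the means increase with the radii, the integral over a dyadic box lies between the values
at the centres of neighbouring boxes. -/
theorem mem_mixedNormSpace_iff {f : (Fin n → ℂ) → ℂ} (hf : f ∈ holo n) {p q : ℝ} (hp : 0 < p)
    (hq : 0 < q) (α : ℝ) : f ∈ mixedNormSpace n p q α ↔ dyadicNorm p q α f < ⊤ := by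
  have hP : 0 ≤ q / p := by positivity
  obtain ⟨K, hK, hw⟩ := exists_weight_comparable n (α * q - 1)
  obtain ⟨K1, hK1, hsh⟩ := exists_dyad_le_dyad_shift n 1 (α * q)
  obtain ⟨K2, hK2, hsh2⟩ := exists_dyad_le_dyad_shift n 1 1
  have hmem : f ∈ mixedNormSpace n p q α ↔ ∑' j : Fin n → ℕ, ∫⁻ R in dyadicBox j,
      powerMean p f R ^ (q / p) * weight (α * q - 1) R < ⊤ := by
    rw [mixedNormSpace, mem_ofPred_eq, lintegral_radii_eq_tsum]
    simp only [integralMean_rpow, hf, true_and]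
  rw [hmem]
  constructor
  · intro h
    refine lt_of_le_of_lt ?_ (ENNReal.mul_lt_top (ENNReal.mul_lt_top (ENNReal.mul_lt_top hK1.lt_top
      hK2.lt_top) hK.lt_top) h)
    rw [dyadicNorm, ← ENNReal.tsum_mul_left]
    refine le_trans ?_ (ENNReal.tsum_comp_le_tsum_of_injective (shift_injective 1) _)
    refine ENNReal.tsum_le_tsum fun j => ?_
    set k := shift j 1
    have h1 : volume (dyadicBox k) * dyad k (α * q - 1) * powerMean p f (boxMid j) ^ (q / p) ≤
        K * ∫⁻ R in dyadicBox k, powerMean p f R ^ (q / p) * weight (α * q - 1) R := by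
      rw [mul_assoc, mul_comm, ← setLIntegral_const, ← lintegral_const_mul' _ _ hK]
      refine setLIntegral_mono' (measurableSet_dyadicBox k) fun R hR => ?_
      calc _ ≤ (K * weight (α * q - 1) R) * powerMean p f R ^ (q / p) := by
            gcongr
            · exact (hw k R hR).2
            · exact powerMean_mono hf hp (boxMid_mem_radii j) (dyadicBox_subset_radii k hR)
                (boxMid_le_of_mem_shift hR)
        _ = _ := by ring
    calc dyad j (α * q) * powerMean p f (boxMid j) ^ (q / p)
        ≤ (K1 * dyad k (α * q)) * powerMean p f (boxMid j) ^ (q / p) := by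
          gcongr
          exact (hsh j).1
      _ = K1 * (dyad k 1 * dyad k (α * q - 1) * powerMean p f (boxMid j) ^ (q / p)) := by
          rw [← dyad_add]
          rw [show 1 + (α * q - 1) = α * q by ring]
          ring
      _ ≤ K1 * ((K2 * volume (dyadicBox k)) * dyad k (α * q - 1) *
            powerMean p f (boxMid j) ^ (q / p)) := by
          gcongr
          rw [volume_dyadicBox]
          exact (hsh2 k).1
      _ = K1 * K2 * (volume (dyadicBox k) * dyad k (α * q - 1) *
            powerMean p f (boxMid j) ^ (q / p)) := by ring
      _ ≤ K1 * K2 * (K * ∫⁻ R in dyadicBox k,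
            powerMean p f R ^ (q / p) * weight (α * q - 1) R) := by gcongr
      _ = _ := by ring
  · intro h
    refine lt_of_le_of_lt ?_ (ENNReal.mul_lt_top (ENNReal.mul_lt_top hK.lt_top hK1.lt_top) h)
    rw [dyadicNorm, ← ENNReal.tsum_mul_left]
    refine le_trans ?_ (ENNReal.tsum_comp_le_tsum_of_injective (shift_injective 1) _)
    refine ENNReal.tsum_le_tsum fun j => ?_
    set k := shift j 1
    calc ∫⁻ R in dyadicBox j, powerMean p f R ^ (q / p) * weight (α * q - 1) R
        ≤ ∫⁻ _R in dyadicBox j, powerMean p f (boxMid k) ^ (q / p) * (K * dyad j (α * q - 1)) := by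
          refine setLIntegral_mono' (measurableSet_dyadicBox j) fun R hR => ?_
          gcongr
          · exact powerMean_mono hf hp (dyadicBox_subset_radii j hR) (boxMid_mem_radii k)
              (le_boxMid_shift hR)
          · exact (hw j R hR).1
      _ ≤ powerMean p f (boxMid k) ^ (q / p) * (K * dyad j (α * q - 1)) * dyad j 1 := by
          rw [setLIntegral_const]
          gcongr
          exact volume_dyadicBox_le j
      _ = K * dyad j (α * q) * powerMean p f (boxMid k) ^ (q / p) := by
          have : dyad j (α * q) = dyad j (α * q - 1) * dyad j 1 := by rw [← dyad_add]; ring_nf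
          rw [this]; ring
      _ ≤ K * (K1 * dyad k (α * q)) * powerMean p f (boxMid k) ^ (q / p) := by
          gcongr
          exact (hsh j).1
      _ = _ := by ring

theorem mem_lizorkinTriebelSpace_iff {f : (Fin n → ℂ) → ℂ} (hf : f ∈ holo n) (p q α : ℝ) :
    f ∈ lizorkinTriebelSpace n p q α ↔
      ∫⁻ θ, (∑' j, boxInt q (α * q - 1) f j θ) ^ (p / q) < ⊤ := by
  rw [lizorkinTriebelSpace, mem_ofPred_eq]
  simp only [lintegral_radii_eq_tsum_boxInt, hf, true_and]

/-- `F^{p,q}_α ⊆ A^{p,max(p,q)}_α`. -/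
theorem dyadicNorm_lt_top_of_mem_lizorkinTriebelSpace {f : (Fin n → ℂ) → ℂ} {p q α : ℝ}
    (hp : 0 < p) (hq : 0 < q) (h : f ∈ lizorkinTriebelSpace n p q α) :
    dyadicNorm p (max p q) α f < ⊤ := by
  have hf : f ∈ holo n := h.1
  rw [mem_lizorkinTriebelSpace_iff hf] at h
  obtain ⟨k, K, hK, hlow⟩ := exists_powerMean_le_lintegral_boxInt n hp hq α
  rcases le_total p q with hpq | hqp
  · rw [max_eq_right hpq]
    have hP : 1 ≤ q / p := by rwa [le_div_iff₀ hp, one_mul]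
    have hP0 : 0 ≤ q / p := by positivity
    have hle : dyadicNorm p q α f ≤ K ^ (q / p) *
        (∫⁻ θ, (∑' j, boxInt q (α * q - 1) f j θ) ^ (p / q)) ^ (q / p) := by
      calc dyadicNorm p q α f
          ≤ ∑' j, (K * ∫⁻ θ, boxInt q (α * q - 1) f (shift j k) θ ^ (p / q)) ^ (q / p) := by
            refine ENNReal.tsum_le_tsum fun j => ?_
            have := ENNReal.rpow_le_rpow (hlow f hf j) hP0
            rw [ENNReal.mul_rpow_of_nonneg _ _ hP0, dyad_rpow,
              show α * p * (q / p) = α * q by field_simp] at this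
            exact this
        _ = K ^ (q / p) * ∑' j,
              (∫⁻ θ, boxInt q (α * q - 1) f (shift j k) θ ^ (p / q)) ^ (q / p) := by
            rw [← ENNReal.tsum_mul_left]
            simp only [ENNReal.mul_rpow_of_nonneg _ _ hP0]
        _ ≤ K ^ (q / p) * ∑' j, (∫⁻ θ, boxInt q (α * q - 1) f j θ ^ (p / q)) ^ (q / p) := by
            refine mul_le_mul' le_rfl ?_
            exact ENNReal.tsum_comp_le_tsum_of_injective (shift_injective k)
              fun j => (∫⁻ θ, boxInt q (α * q - 1) f j θ ^ (p / q)) ^ (q / p)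
        _ ≤ _ := by
            gcongr
            refine (tsum_rpow_lintegral_le _ (fun j =>
              ((measurable_boxInt hf q (α * q - 1) j).pow_const (p / q)).aemeasurable) hP).trans ?_
            simp only [← ENNReal.rpow_mul, show p / q * (q / p) = 1 by field_simp,
              ENNReal.rpow_one, one_div_div]
            exact le_rfl
    refine hle.trans_lt (ENNReal.mul_lt_top ?_ ?_)
    · exact (ENNReal.rpow_ne_top_of_nonneg hP0 hK).lt_top
    · exact (ENNReal.rpow_ne_top_of_nonneg hP0 h.ne).lt_top
  · rw [max_eq_left hqp]
    have hP : 1 ≤ p / q := by rwa [le_div_iff₀ hq, one_mul]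
    refine lt_of_le_of_lt ?_ (ENNReal.mul_lt_top hK.lt_top h)
    calc dyadicNorm p p α f
        ≤ ∑' j, K * ∫⁻ θ, boxInt q (α * q - 1) f (shift j k) θ ^ (p / q) := by
          refine ENNReal.tsum_le_tsum fun j => ?_
          rw [div_self hp.ne', ENNReal.rpow_one]
          exact hlow f hf j
      _ = K * ∑' j, ∫⁻ θ, boxInt q (α * q - 1) f (shift j k) θ ^ (p / q) :=
          ENNReal.tsum_mul_left
      _ ≤ K * ∑' j, ∫⁻ θ, boxInt q (α * q - 1) f j θ ^ (p / q) := by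
          refine mul_le_mul' le_rfl ?_
          exact ENNReal.tsum_comp_le_tsum_of_injective (shift_injective k)
            fun j => ∫⁻ θ, boxInt q (α * q - 1) f j θ ^ (p / q)
      _ = K * ∫⁻ θ, ∑' j, boxInt q (α * q - 1) f j θ ^ (p / q) := by
          rw [lintegral_tsum fun j =>
            ((measurable_boxInt hf q (α * q - 1) j).pow_const (p / q)).aemeasurable]
      _ ≤ _ := by
          gcongr with θ
          exact tsum_rpow_le_rpow_tsum _ hP

/-- `A^{p,q}_α ⊆ F^{p,q}_α` for `q ≤ p`. -/
theorem mem_lizorkinTriebelSpace_of_dyadicNorm {f : (Fin n → ℂ) → ℂ} (hf : f ∈ holo n)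
    {p q α : ℝ} (hq : 0 < q) (hqp : q ≤ p) (h : dyadicNorm p q α f < ⊤) :
    f ∈ lizorkinTriebelSpace n p q α := by
  have hp : 0 < p := by linarith
  rw [mem_lizorkinTriebelSpace_iff hf]
  have hP : 1 ≤ p / q := by rwa [le_div_iff₀ hq, one_mul]
  have hP0 : 0 < p / q := by positivity
  obtain ⟨K, hK, hb⟩ := exists_boxInt_comparable n (α * q - 1)
  obtain ⟨K1, hK1, hsh⟩ := exists_dyad_le_dyad_shift n 1 (α * q)
  have hbox : ∀ j : Fin n → ℕ, (∫⁻ θ, boxInt q (α * q - 1) f j θ ^ (p / q)) ^ (1 / (p / q)) ≤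
      K * K1 * (dyad (shift j 1) (α * q) * powerMean p f (boxMid (shift j 1)) ^ (q / p)) := by
    intro j
    have h1 : ∀ θ, boxInt q (α * q - 1) f j θ ^ (p / q) ≤
        (K * dyad j (α * q - 1)) ^ (p / q) * (dyad j 1 ^ (p / q - 1) *
          ∫⁻ R in dyadicBox j, ‖f (torusPoint R θ)‖ₑ ^ p) := by
      intro θ
      refine (ENNReal.rpow_le_rpow (hb q f j θ).1 hP0.le).trans ?_
      rw [ENNReal.mul_rpow_of_nonneg _ _ hP0.le]
      gcongr
      refine (lintegral_rpow_le _ (measurable_enorm_torusPoint_box hf q j θ) hP).trans ?_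
      simp only [← ENNReal.rpow_mul, mul_div_cancel₀ p hq.ne']
      rw [Measure.restrict_apply_univ]
      exact mul_le_mul' (ENNReal.rpow_le_rpow (volume_dyadicBox_le j) (by linarith)) le_rfl
    have h2 : ∫⁻ θ, boxInt q (α * q - 1) f j θ ^ (p / q) ≤
        (K * dyad j (α * q - 1)) ^ (p / q) * (dyad j 1 ^ (p / q - 1) *
          (powerMean p f (boxMid (shift j 1)) * dyad j 1)) := by
      refine (lintegral_mono h1).trans ?_
      rw [lintegral_const_mul' _ _ (ENNReal.rpow_ne_top_of_nonneg hP0.le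
          (ENNReal.mul_ne_top hK (dyad_ne_top _ _))), lintegral_const_mul' _ _
          (ENNReal.rpow_ne_top_of_nonneg (by linarith) (dyad_ne_top _ _)),
        lintegral_lintegral_box hf]
      gcongr
      calc ∫⁻ R in dyadicBox j, powerMean p f R
          ≤ ∫⁻ _R in dyadicBox j, powerMean p f (boxMid (shift j 1)) := by
            refine setLIntegral_mono' (measurableSet_dyadicBox j) fun R hR => ?_
            exact powerMean_mono hf hp (dyadicBox_subset_radii j hR) (boxMid_mem_radii _)
              (le_boxMid_shift hR)
        _ ≤ _ := by
            rw [setLIntegral_const]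
            gcongr
            exact volume_dyadicBox_le j
    set M := powerMean p f (boxMid (shift j 1))
    have h3 : (K * dyad j (α * q - 1)) ^ (p / q) * (dyad j 1 ^ (p / q - 1) * (M * dyad j 1)) =
        (K * dyad j (α * q) * M ^ (q / p)) ^ (p / q) := by
      rw [ENNReal.mul_rpow_of_nonneg _ _ hP0.le, ENNReal.mul_rpow_of_nonneg _ _ hP0.le,
        ENNReal.mul_rpow_of_nonneg _ _ hP0.le, ← ENNReal.rpow_mul M,
        show q / p * (p / q) = 1 by field_simp, ENNReal.rpow_one, dyad_rpow, dyad_rpow, dyad_rpow,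
        show α * q * (p / q) = (α * q - 1) * (p / q) + (1 * (p / q - 1) + 1) by ring, dyad_add,
        dyad_add]
      ring
    rw [h3] at h2
    calc _ ≤ ((K * dyad j (α * q) * M ^ (q / p)) ^ (p / q)) ^ (1 / (p / q)) :=
          ENNReal.rpow_le_rpow h2 (by positivity)
      _ = K * dyad j (α * q) * M ^ (q / p) := by
          rw [← ENNReal.rpow_mul, mul_one_div_cancel hP0.ne', ENNReal.rpow_one]
      _ ≤ K * (K1 * dyad (shift j 1) (α * q)) * M ^ (q / p) := by
          gcongr
          exact (hsh j).1
      _ = _ := by ring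
  have hM := lintegral_rpow_tsum_le volume
    (fun j => (measurable_boxInt hf q (α * q - 1) j).aemeasurable) hP
  have hfin : (∫⁻ θ, (∑' j, boxInt q (α * q - 1) f j θ) ^ (p / q)) ^ (1 / (p / q)) < ⊤ := by
    refine hM.trans_lt (lt_of_le_of_lt (ENNReal.tsum_le_tsum hbox) ?_)
    rw [ENNReal.tsum_mul_left]
    refine ENNReal.mul_lt_top (ENNReal.mul_lt_top hK.lt_top hK1.lt_top) (lt_of_le_of_lt ?_ h)
    exact ENNReal.tsum_comp_le_tsum_of_injective (shift_injective 1)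
      fun j => dyad j (α * q) * powerMean p f (boxMid j) ^ (q / p)
  exact (ENNReal.rpow_lt_top_iff_of_pos (by positivity)).1 hfin

/-! ### Power series in the polydisc -/

/-- A finite product of series is the multiple series of the products. -/
theorem hasSum_pi_prod {n : ℕ} {u : Fin n → ℕ → ℂ} {S : Fin n → ℂ}
    (h : ∀ i, HasSum (u i) (S i)) :
    HasSum (fun k : Fin n → ℕ => ∏ i, u i (k i)) (∏ i, S i) := by
  induction n with
  | zero =>
    simp
  | succ n ih =>
    have h1 := ih (u := fun i => u i.succ) (S := fun i => S i.succ) fun i => h i.succ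
    have h2 := summable_mul_of_summable_norm (h 0).summable.norm h1.summable.norm
    have h3 := (h 0).mul h1 h2
    rw [Fin.prod_univ_succ, ← (Fin.consEquiv fun _ => ℕ).hasSum_iff]
    have h4 : ((fun k : Fin (n + 1) → ℕ => ∏ i, u i (k i)) ∘ Fin.consEquiv fun _ => ℕ) =
        fun x : ℕ × (Fin n → ℕ) => u 0 x.1 * ∏ i : Fin n, u i.succ (x.2 i) := by
      funext x
      rw [Function.comp, Fin.prod_univ_succ]
      rfl
    rw [h4]
    exact h3

theorem norm_monom (k : Fin n → ℕ) (z : Fin n → ℂ) : ‖monom k z‖ = ∏ i, ‖z i‖ ^ k i := by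
  simp [monom, norm_prod]

theorem monom_mul (k : Fin n → ℕ) (z w : Fin n → ℂ) :
    monom k (fun i => z i * w i) = monom k z * monom k w := by
  simp [monom, mul_pow, Finset.prod_mul_distrib]

theorem continuous_monom (k : Fin n → ℕ) : Continuous (monom k : (Fin n → ℂ) → ℂ) := by
  unfold monom; fun_prop

theorem differentiable_monom (k : Fin n → ℕ) :
    Differentiable ℂ (monom k : (Fin n → ℂ) → ℂ) := by
  unfold monom; fun_prop

theorem polydisc_eq_ball : polydisc n = Metric.ball 0 1 := by
  ext z
  simp [polydisc, pi_norm_lt_iff]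

/-- A power series converging at all points of the polydisc has a holomorphic sum. -/
theorem holo_of_hasExpansion {f : (Fin n → ℂ) → ℂ} {a : (Fin n → ℕ) → ℂ}
    (h : HasExpansion f a) : f ∈ holo n := by
  intro z hz
  have hz1 : ‖z‖ < 1 := by rw [polydisc_eq_ball] at hz; simpa using hz
  obtain ⟨ρ, hρ, hρ1⟩ := exists_between hz1
  obtain ⟨σ, hσ, hσ1⟩ := exists_between hρ1
  have hρ0 : 0 < ρ := (norm_nonneg z).trans_lt hρ
  have hσ0 : 0 < σ := hρ0.trans hσ
  set w : Fin n → ℂ := fun _ => (σ : ℂ) with hw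
  have hwp : w ∈ polydisc n := fun i => by simp [hw, abs_of_pos hσ0, hσ1]
  have hM : ∀ k, 0 < ‖monom k w‖ := fun k => by
    rw [norm_monom]; exact Finset.prod_pos fun i _ => by simp [hw, hσ0.ne']
  have hbd : ∀ k, ∀ y ∈ Metric.ball (0 : Fin n → ℂ) σ, ‖monom k y‖ ≤ ‖monom k w‖ := by
    intro k y hy
    rw [norm_monom, norm_monom]
    refine Finset.prod_le_prod (fun _ _ => by positivity) fun i _ => ?_
    have : ‖y i‖ ≤ ‖w i‖ := by
      refine (norm_le_pi_norm y i).trans ?_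
      rw [mem_ball_zero_iff] at hy
      simpa [hw, abs_of_pos hσ0] using hy.le
    gcongr
  have hder : ∀ k, ∀ y ∈ Metric.ball (0 : Fin n → ℂ) ρ,
      ‖fderiv ℂ (monom k) y‖ ≤ 3 * ‖monom k w‖ / (σ - ρ) := by
    intro k y hy
    have hsub : Metric.ball y (σ - ρ) ⊆ Metric.ball (0 : Fin n → ℂ) σ := by
      refine Metric.ball_subset_ball' ?_
      have : dist y 0 < ρ := hy
      linarith
    refine Complex.norm_fderiv_le_div_of_mapsTo_ball (differentiable_monom k).differentiableOn
      (fun x hx => ?_) (by linarith)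
    rw [Metric.mem_closedBall, dist_eq_norm]
    have h1 := hbd k x (hsub hx)
    have h2 := hbd k y (Metric.ball_subset_ball hσ.le hy)
    linarith [norm_sub_le (monom k x) (monom k y), hM k]
  have key := hasFDerivAt_tsum_of_isPreconnected (𝕜 := ℂ)
    (f := fun k y => a k * monom k y) (f' := fun k y => a k • fderiv ℂ (monom k) y)
    (u := fun k => ‖a k * monom k w‖ * (3 / (σ - ρ)))
    ((h w hwp).summable.norm.mul_right _) (Metric.isOpen_ball (x := (0 : Fin n → ℂ)) (ε := ρ))
    (convex_ball _ _).isPreconnected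
    (fun k y _ => ((differentiable_monom k y).hasFDerivAt.const_mul (a k)))
    (fun k y hy => by
      rw [norm_smul, norm_mul]
      calc _ ≤ ‖a k‖ * (3 * ‖monom k w‖ / (σ - ρ)) := by gcongr; exact hder k y hy
        _ = _ := by ring)
    (x₀ := z) (by simpa using hρ) (h z hz).summable (x := z) (by simpa using hρ)
  refine (key.differentiableAt.congr_of_eventuallyEq ?_).differentiableWithinAt
  filter_upwards [isOpen_polydisc.mem_nhds hz] with y hy
  exact (h y hy).tsum_eq.symm

/-- The Hadamard product of two power series. -/
theorem HasExpansion.summable_mul {f₁ f₂ : (Fin n → ℂ) → ℂ} {a b : (Fin n → ℕ) → ℂ}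
    (h₁ : HasExpansion f₁ a) (h₂ : HasExpansion f₂ b) {z : Fin n → ℂ} (hz : z ∈ polydisc n) :
    Summable fun k => ‖a k * b k * monom k z‖ := by
  set w : Fin n → ℂ := fun i => (Real.sqrt ‖z i‖ : ℂ) with hw
  have hwp : w ∈ polydisc n := fun i => by
    have h0 := Real.sqrt_nonneg ‖z i‖
    simp only [hw, Complex.norm_real, Real.norm_eq_abs, abs_of_nonneg h0]
    exact (Real.sqrt_lt' one_pos).2 (by simpa using hz i)
  have h := ((h₁ w hwp).summable.norm.mul_of_nonneg (h₂ w hwp).summable.norm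
    (fun _ => norm_nonneg _) (fun _ => norm_nonneg _)).comp_injective
    (i := fun k : Fin n → ℕ => (k, k)) (fun k l hkl => (Prod.ext_iff.1 hkl).1)
  refine h.congr fun k => ?_
  have : ‖monom k z‖ = ‖monom k w‖ * ‖monom k w‖ := by
    rw [norm_monom, norm_monom, ← Finset.prod_mul_distrib]
    refine Finset.prod_congr rfl fun i _ => ?_
    rw [← mul_pow]
    simp [hw, abs_of_nonneg (Real.sqrt_nonneg _)]
  simp only [Function.comp, norm_mul, this]
  ring

/-- The sum of the Hadamard product of two power series. -/
def hadamard (a b : (Fin n → ℕ) → ℂ) (z : Fin n → ℂ) : ℂ := ∑' k, a k * b k * monom k z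

theorem HasExpansion.hadamard {f₁ f₂ : (Fin n → ℂ) → ℂ} {a b : (Fin n → ℕ) → ℂ}
    (h₁ : HasExpansion f₁ a) (h₂ : HasExpansion f₂ b) :
    HasExpansion (hadamard a b) fun k => a k * b k :=
  fun _ hz => (h₁.summable_mul h₂ hz).of_norm.hasSum

/-- The coefficients `∏ᵢ (kᵢ + m choose m)` of `∏ᵢ (1 - zᵢ) ^ (-(m + 1))`, which are also the
multipliers defining the fractional derivative of integral order `m`. -/
def binomCoeff (m : ℕ) (k : Fin n → ℕ) : ℂ := ∏ i, ((k i + m).choose m : ℂ)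

/-- The function `∏ᵢ (1 - wᵢ zᵢ) ^ (-(m + 1))`. -/
def kernelFun (m : ℕ) (w z : Fin n → ℂ) : ℂ := ∏ i, 1 / (1 - w i * z i) ^ (m + 1)

theorem hasExpansion_kernelFun (m : ℕ) {w : Fin n → ℂ} (hw : ∀ i, ‖w i‖ ≤ 1) :
    HasExpansion (kernelFun m w) fun k => binomCoeff m k * monom k w := by
  intro z hz
  have h := hasSum_pi_prod (u := fun i j => ((j + m).choose m : ℂ) * (w i * z i) ^ j)
    (S := fun i => 1 / (1 - w i * z i) ^ (m + 1)) fun i => by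
      refine hasSum_choose_mul_geometric_of_norm_lt_one m ?_
      rw [norm_mul]
      exact (mul_le_of_le_one_left (norm_nonneg _) (hw i)).trans_lt (hz i)
  refine (funext fun k => ?_ : (fun k => binomCoeff m k * monom k w * monom k z) = _) ▸ h
  rw [mul_assoc, ← monom_mul, binomCoeff, monom, ← Finset.prod_mul_distrib]

theorem hasExpansion_binomCoeff (n m : ℕ) :
    HasExpansion (kernelFun m fun _ : Fin n => 1) (binomCoeff m) := by
  have h1 := hasExpansion_kernelFun m (w := fun _ : Fin n => 1) (by simp)
  have h2 : (fun k : Fin n → ℕ => binomCoeff m k * monom k fun _ => 1) = binomCoeff m := by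
    funext k; simp [monom]
  rwa [h2] at h1

theorem fracDeriv_eq (m : ℕ) (a : (Fin n → ℕ) → ℂ) :
    fracDeriv m a = hadamard (binomCoeff m) a := by
  funext z
  refine tsum_congr fun k => ?_
  congr 2
  rw [binomCoeff, Complex.ofReal_prod]
  refine Finset.prod_congr rfl fun i _ => ?_
  rw [show (k i : ℝ) + m + 1 = ((k i + m : ℕ) : ℝ) + 1 by push_cast; ring,
    Real.Gamma_nat_eq_factorial, Real.Gamma_nat_eq_factorial, Real.Gamma_nat_eq_factorial,
    Nat.cast_choose ℂ (Nat.le_add_left m (k i))]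
  push_cast
  simp

theorem hasExpansion_fracDeriv (m : ℕ) {g : (Fin n → ℂ) → ℂ} {c : (Fin n → ℕ) → ℂ}
    (h : HasExpansion g c) : HasExpansion (fracDeriv m c) fun k => binomCoeff m k * c k := by
  rw [fracDeriv_eq]
  exact (hasExpansion_binomCoeff n m).hadamard h

/-! ### Convolution on the torus -/

theorem integral_toCircle_pow_mul (k l : ℕ) (ξ : UnitAddCircle) :
    ∫ η : UnitAddCircle, (AddCircle.toCircle η : ℂ) ^ k * (AddCircle.toCircle (ξ - η) : ℂ) ^ l =
      if k = l then (AddCircle.toCircle ξ : ℂ) ^ k else 0 := by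
  have h : ∀ η : UnitAddCircle, (AddCircle.toCircle η : ℂ) ^ k *
      (AddCircle.toCircle (ξ - η) : ℂ) ^ l =
      (AddCircle.toCircle ξ : ℂ) ^ l * fourier ((k : ℤ) - l) η := by
    intro η
    rw [sub_eq_add_neg ξ, AddCircle.toCircle_add, AddCircle.toCircle_neg, fourier_apply, sub_smul,
      sub_eq_add_neg, AddCircle.toCircle_add, AddCircle.toCircle_neg, natCast_zsmul,
      natCast_zsmul, AddCircle.toCircle_nsmul, AddCircle.toCircle_nsmul]
    push_cast
    rw [mul_pow, inv_pow]
    ring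
  simp only [h, integral_const_mul]
  split_ifs with hkl
  · subst hkl
    have h1 : (volume : Measure UnitAddCircle).real univ = 1 := by
      rw [measureReal_def, UnitAddCircle.measure_univ, ENNReal.toReal_one]
    simp [h1]
  · have h0 : (k : ℤ) - l ≠ 0 := by omega
    rw [integral_eq_zero_of_add_right_eq_neg (fourier_add_half_inv_index h0 one_pos), mul_zero]

theorem volume_torus_univ : (volume : Measure (UnitAddTorus (Fin n))) univ = 1 := by
  rw [volume_pi, Measure.pi_univ]
  simp

theorem torusPoint_apply (r : Fin n → ℝ) (θ : UnitAddTorus (Fin n)) (i : Fin n) :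
    torusPoint r θ i = (r i : ℂ) * (AddCircle.toCircle (θ i) : ℂ) := rfl

theorem integral_monom_mul_monom (k l : Fin n → ℕ) (R r : Fin n → ℝ) (ξ : UnitAddTorus (Fin n)) :
    ∫ η, monom k (torusPoint R η) * monom l (torusPoint r (ξ - η)) =
      if k = l then monom k (torusPoint (fun i => R i * r i) ξ) else 0 := by
  have h : ∀ η : UnitAddTorus (Fin n), monom k (torusPoint R η) * monom l (torusPoint r (ξ - η)) =
      ∏ i, ((R i : ℂ) ^ k i * (r i : ℂ) ^ l i * ((AddCircle.toCircle (η i) : ℂ) ^ k i *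
        (AddCircle.toCircle (ξ i - η i) : ℂ) ^ l i)) := by
    intro η
    rw [monom, monom, ← Finset.prod_mul_distrib]
    refine Finset.prod_congr rfl fun i _ => ?_
    rw [torusPoint_apply, torusPoint_apply, mul_pow, mul_pow, Pi.sub_apply]
    ring
  simp only [h]
  rw [integral_fintype_prod_volume_eq_prod (fun i (η : UnitAddCircle) =>
    ((R i : ℂ) ^ k i * (r i : ℂ) ^ l i * ((AddCircle.toCircle η : ℂ) ^ k i *
        (AddCircle.toCircle (ξ i - η) : ℂ) ^ l i)))]
  simp only [integral_const_mul, integral_toCircle_pow_mul]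
  split_ifs with hkl
  · subst hkl
    simp only [monom, torusPoint_apply, if_true]
    refine Finset.prod_congr rfl fun i _ => ?_
    push_cast
    ring
  · obtain ⟨i, hi⟩ := Function.ne_iff.1 hkl
    exact Finset.prod_eq_zero (Finset.mem_univ i) (by simp [hi])

theorem norm_monom_torusPoint (k : Fin n → ℕ) (r : Fin n → ℝ) (θ : UnitAddTorus (Fin n)) :
    ‖monom k (torusPoint r θ)‖ = ‖monom k (torusPoint r 0)‖ := by
  simp [norm_monom, norm_torusPoint]

theorem continuous_comp_torusPoint {f : (Fin n → ℂ) → ℂ} (hf : f ∈ holo n) {r : Fin n → ℝ}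
    (hr : r ∈ radii n) : Continuous fun θ => f (torusPoint r θ) := by
  have hf' : ContinuousOn f (polydisc n) := DifferentiableOn.continuousOn hf
  exact hf'.comp_continuous (continuous_torusPoint.comp (Continuous.prodMk_right r))
    fun θ => torusPoint_mem_polydisc hr θ

theorem integrable_of_continuous_torus {F : UnitAddTorus (Fin n) → ℂ} (hF : Continuous F) :
    Integrable F :=
  hF.integrable_of_hasCompactSupport (HasCompactSupport.of_compactSpace F)

theorem continuous_monom_torusPoint (k : Fin n → ℕ) (r : Fin n → ℝ) :
    Continuous fun θ => monom k (torusPoint r θ) :=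
  (continuous_monom k).comp (continuous_torusPoint.comp (Continuous.prodMk_right r))

theorem integral_monom_mul {f : (Fin n → ℂ) → ℂ} {a : (Fin n → ℕ) → ℂ} (hf : HasExpansion f a)
    (k : Fin n → ℕ) (R : Fin n → ℝ) {r : Fin n → ℝ} (hr : r ∈ radii n)
    (ξ : UnitAddTorus (Fin n)) :
    ∫ η, monom k (torusPoint R η) * f (torusPoint r (ξ - η)) =
      a k * monom k (torusPoint (fun i => R i * r i) ξ) := by
  have hI : ∀ l, Integrable fun η =>
      monom k (torusPoint R η) * (a l * monom l (torusPoint r (ξ - η))) := fun l => by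
    have hc : Continuous fun η => monom l (torusPoint r (ξ - η)) :=
      (continuous_monom_torusPoint l r).comp (continuous_const.sub continuous_id)
    exact integrable_of_continuous_torus
      ((continuous_monom_torusPoint k R).mul (continuous_const.mul hc))
  have hS : Summable fun l => ∫ η, ‖monom k (torusPoint R η) *
      (a l * monom l (torusPoint r (ξ - η)))‖ := by
    have h1 := (hf _ (torusPoint_mem_polydisc hr 0)).summable.norm.mul_left
      ‖monom k (torusPoint R 0)‖
    refine h1.congr fun l => ?_
    have h2 : ∀ η, ‖monom k (torusPoint R η) * (a l * monom l (torusPoint r (ξ - η)))‖ =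
        ‖monom k (torusPoint R 0)‖ * ‖a l * monom l (torusPoint r 0)‖ := fun η => by
      rw [norm_mul, norm_mul, norm_mul, norm_monom_torusPoint k R, norm_monom_torusPoint l r]
    simp only [h2]
    rw [integral_const, measureReal_def, volume_torus_univ, ENNReal.toReal_one, one_smul]
  have h := hasSum_integral_of_summable_integral_norm hI hS
  have h2 : (fun η => ∑' l, monom k (torusPoint R η) * (a l * monom l (torusPoint r (ξ - η)))) =
      fun η => monom k (torusPoint R η) * f (torusPoint r (ξ - η)) := by
    funext η
    rw [tsum_mul_left, (hf _ (torusPoint_mem_polydisc hr _)).tsum_eq]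
  rw [h2] at h
  have h3 : ∀ l, ∫ η, monom k (torusPoint R η) * (a l * monom l (torusPoint r (ξ - η))) =
      if k = l then a k * monom k (torusPoint (fun i => R i * r i) ξ) else 0 := by
    intro l
    simp only [mul_left_comm _ (a l), integral_const_mul, integral_monom_mul_monom]
    split_ifs with hkl
    · rw [hkl]
    · simp
  simp only [h3] at h
  exact h.unique (hasSum_ite_eq' k _)

/-- The Hadamard product of two power series as a convolution on the torus. -/
theorem integral_mul_eq_hadamard {G f : (Fin n → ℂ) → ℂ} {b a : (Fin n → ℕ) → ℂ}
    (hG : HasExpansion G b) (hf : HasExpansion f a) {R r : Fin n → ℝ} (hR : R ∈ radii n)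
    (hr : r ∈ radii n) (ξ : UnitAddTorus (Fin n)) :
    ∫ η, G (torusPoint R η) * f (torusPoint r (ξ - η)) =
      hadamard b a (torusPoint (fun i => R i * r i) ξ) := by
  have hfc : Continuous fun η => f (torusPoint r (ξ - η)) :=
    (continuous_comp_torusPoint (holo_of_hasExpansion hf) hr).comp
      (continuous_const.sub continuous_id)
  have hI : ∀ k, Integrable fun η =>
      b k * (monom k (torusPoint R η) * f (torusPoint r (ξ - η))) := fun k =>
    integrable_of_continuous_torus
      (continuous_const.mul ((continuous_monom_torusPoint k R).mul hfc))
  have hS : Summable fun k => ∫ η, ‖b k * (monom k (torusPoint R η) *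
      f (torusPoint r (ξ - η)))‖ := by
    have h1 := (hG _ (torusPoint_mem_polydisc hR 0)).summable.norm.mul_right
      (∫ η, ‖f (torusPoint r (ξ - η))‖)
    refine h1.congr fun k => ?_
    have h2 : ∀ η, ‖b k * (monom k (torusPoint R η) * f (torusPoint r (ξ - η)))‖ =
        ‖b k * monom k (torusPoint R 0)‖ * ‖f (torusPoint r (ξ - η))‖ := fun η => by
      rw [norm_mul, norm_mul, norm_mul, norm_monom_torusPoint k R, mul_assoc]
    simp only [h2, integral_const_mul]
  have h := hasSum_integral_of_summable_integral_norm hI hS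
  simp only [integral_const_mul, integral_monom_mul hf _ R hr] at h
  rw [hadamard]
  simp only [mul_assoc]
  rw [h.tsum_eq]
  refine integral_congr_ae (Filter.Eventually.of_forall fun η => ?_)
  simp only [← mul_assoc]
  rw [tsum_mul_right, (hG _ (torusPoint_mem_polydisc hR _)).tsum_eq]

/-! ### The Beta integral -/

theorem integral_one_sub_pow_mul_pow {m : ℕ} (hm : 1 ≤ m) (k : ℕ) :
    ∫ x in Ico (0 : ℝ) 1, (m : ℂ) * (1 - x : ℂ) ^ (m - 1) * (x : ℂ) ^ k =
      ((k + m).choose m : ℂ)⁻¹ := by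
  have hb := Complex.Gamma_mul_Gamma_eq_betaIntegral (s := (k : ℂ) + 1) (t := m)
    (by simp; positivity) (by simp; omega)
  obtain ⟨m, rfl⟩ : ∃ l, m = l + 1 := ⟨m - 1, by omega⟩
  have e1 : (k : ℂ) + 1 + ((m + 1 : ℕ) : ℂ) = ((k + m + 1 : ℕ) : ℂ) + 1 := by push_cast; ring
  rw [e1, Complex.Gamma_nat_eq_factorial, Complex.Gamma_nat_eq_factorial, Nat.cast_succ m,
    Complex.Gamma_nat_eq_factorial] at hb
  have hbeta : Complex.betaIntegral ((k : ℂ) + 1) ((m : ℂ) + 1) =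
      ∫ x in Ico (0 : ℝ) 1, (1 - x : ℂ) ^ m * (x : ℂ) ^ k := by
    rw [Complex.betaIntegral, intervalIntegral.integral_of_le zero_le_one,
      integral_Ico_eq_integral_Ioo, integral_Ioc_eq_integral_Ioo]
    refine integral_congr_ae (Filter.Eventually.of_forall fun x => ?_)
    simp only [add_sub_cancel_right, Complex.cpow_natCast]
    ring
  simp only [mul_assoc, integral_const_mul, Nat.add_sub_cancel]
  rw [← hbeta, Nat.cast_choose ℂ (Nat.le_add_left (m + 1) k)]
  have hf : ((k + m + 1).factorial : ℂ) ≠ 0 := by exact_mod_cast Nat.factorial_ne_zero _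
  have hk : (k.factorial : ℂ) ≠ 0 := by exact_mod_cast Nat.factorial_ne_zero _
  have hmf : (m.factorial : ℂ) ≠ 0 := by exact_mod_cast Nat.factorial_ne_zero _
  have hm1 : ((m + 1).factorial : ℂ) = (m + 1) * m.factorial := by
    rw [Nat.factorial_succ]; push_cast; ring
  rw [Nat.add_sub_cancel, hm1, ← add_assoc k m 1]
  have : Complex.betaIntegral ((k : ℂ) + 1) ((m : ℂ) + 1) =
      k.factorial * m.factorial / (k + m + 1).factorial := by
    rw [eq_div_iff hf, hb]; ring
  rw [this]
  push_cast
  field_simp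

/-- The density `∏ᵢ m (1 - xᵢ) ^ (m - 1)` on the cube of radii. -/
def betaDensity (m : ℕ) (x : Fin n → ℝ) : ℂ := ∏ i, ((m : ℂ) * (1 - x i : ℂ) ^ (m - 1))

theorem integral_betaDensity_mul_monom {m : ℕ} (hm : 1 ≤ m) (k : Fin n → ℕ) :
    ∫ x in radii n, betaDensity m x * monom k (fun i => (x i : ℂ)) = (binomCoeff m k)⁻¹ := by
  have h : ∀ x : Fin n → ℝ, betaDensity m x * monom k (fun i => (x i : ℂ)) =
      ∏ i, ((m : ℂ) * (1 - x i : ℂ) ^ (m - 1) * (x i : ℂ) ^ k i) := fun x => by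
    rw [betaDensity, monom, ← Finset.prod_mul_distrib]
  simp only [h]
  rw [radii_eq_pi, volume_pi, Measure.restrict_pi_pi,
    integral_fintype_prod_eq_prod fun i (x : ℝ) => (m : ℂ) * (1 - x : ℂ) ^ (m - 1) * (x : ℂ) ^ k i]
  simp only [integral_one_sub_pow_mul_pow hm, binomCoeff, Finset.prod_inv_distrib]

/-! ### Hadamard products and the fractional derivative -/

theorem volume_radii : volume (radii n) = 1 := by
  rw [radii_eq_pi, volume_pi_pi]
  simp

theorem norm_betaDensity_le (m : ℕ) {x : Fin n → ℝ} (hx : x ∈ Icc (0 : Fin n → ℝ) 1) :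
    ‖betaDensity m x‖ ≤ (m : ℝ) ^ n := by
  have h : ∀ i, ‖(m : ℂ) * (1 - x i : ℂ) ^ (m - 1)‖ ≤ m := fun i => by
    have h0 : 0 ≤ x i := hx.1 i
    have h1 : x i ≤ 1 := hx.2 i
    rw [norm_mul, norm_pow, Complex.norm_natCast, ← Complex.ofReal_one, ← Complex.ofReal_sub,
      Complex.norm_real, Real.norm_eq_abs, abs_of_nonneg (by linarith)]
    exact mul_le_of_le_one_right (by positivity) (pow_le_one₀ (by linarith) (by linarith))
  rw [betaDensity, norm_prod]
  refine (Finset.prod_le_prod (fun _ _ => norm_nonneg _) fun i _ => h i).trans ?_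
  simp

theorem enorm_prod_complex {ι : Type*} (s : Finset ι) (u : ι → ℂ) :
    ‖∏ i ∈ s, u i‖ₑ = ∏ i ∈ s, ‖u i‖ₑ := by
  simp only [← ofReal_norm, norm_prod, ENNReal.ofReal_prod_of_nonneg fun i _ => norm_nonneg (u i)]

theorem enorm_betaDensity_le {m : ℕ} (hm : 1 ≤ m) {j : Fin n → ℕ} {x : Fin n → ℝ}
    (hx : x ∈ dyadicBox j) : ‖betaDensity m x‖ₑ ≤ (m : ℝ≥0∞) ^ n * dyad j ((m : ℝ) - 1) := by
  have h : ∀ i, ‖(m : ℂ) * (1 - x i : ℂ) ^ (m - 1)‖ₑ ≤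
      (m : ℝ≥0∞) * 2 ^ (-(((m : ℝ) - 1) * (j i : ℝ))) := fun i => by
    have hi : x i ∈ dyadicIco (j i) := hx i trivial
    have h1 : 1 - x i ≤ (1 / 2) ^ j i := by linarith [hi.1]
    have h2 : 0 ≤ 1 - x i := by linarith [(dyadicIco_subset _ hi).2]
    have e : -(((m : ℝ) - 1) * (j i : ℝ)) = -(j i : ℝ) * ((m - 1 : ℕ) : ℝ) := by
      rw [Nat.cast_sub hm]; push_cast; ring
    rw [e, ENNReal.rpow_mul, ENNReal.rpow_natCast, ← ofReal_half_pow, ← ofReal_norm,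
      norm_mul, norm_pow, Complex.norm_natCast, ← Complex.ofReal_one, ← Complex.ofReal_sub,
      Complex.norm_real, Real.norm_eq_abs, abs_of_nonneg h2,
      ENNReal.ofReal_mul (by positivity), ENNReal.ofReal_natCast, ENNReal.ofReal_pow h2]
    gcongr
  rw [betaDensity, enorm_prod_complex, dyad_eq_prod]
  refine (Finset.prod_le_prod' fun i _ => h i).trans ?_
  simp [Finset.prod_mul_distrib]

theorem continuous_betaDensity (m : ℕ) : Continuous (betaDensity m : (Fin n → ℝ) → ℂ) := by
  unfold betaDensity; fun_prop

theorem radii_subset_Icc : radii n ⊆ Icc 0 1 :=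
  fun _ hx => ⟨fun i => (hx i).1, fun i => (hx i).2.le⟩

theorem norm_monom_le_one (k : Fin n → ℕ) {x : Fin n → ℝ} (hx : x ∈ Icc (0 : Fin n → ℝ) 1) :
    ‖monom k fun i => (x i : ℂ)‖ ≤ 1 := by
  rw [norm_monom]
  refine Finset.prod_le_one (fun _ _ => by positivity) fun i _ => ?_
  have h0 : 0 ≤ x i := hx.1 i
  have h1 : x i ≤ 1 := hx.2 i
  refine pow_le_one₀ (norm_nonneg _) ?_
  rwa [Complex.norm_real, Real.norm_eq_abs, abs_of_nonneg h0]

theorem binomCoeff_ne_zero (m : ℕ) (k : Fin n → ℕ) : binomCoeff m k ≠ 0 := by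
  refine Finset.prod_ne_zero_iff.2 fun i _ => ?_
  exact_mod_cast (Nat.choose_pos (Nat.le_add_left m (k i))).ne'

/-- The Beta integral recovers a Hadamard product with `c` from one with the coefficients of the
fractional derivative. -/
theorem hadamard_eq_integral {m : ℕ} (hm : 1 ≤ m) {G f : (Fin n → ℂ) → ℂ}
    {c a : (Fin n → ℕ) → ℂ} (hG : HasExpansion G fun k => binomCoeff m k * c k)
    (hf : HasExpansion f a) {z : Fin n → ℂ} (hz : z ∈ polydisc n) :
    hadamard c a z = ∫ x in radii n, betaDensity m x *
      hadamard (fun k => binomCoeff m k * c k) a (fun i => (x i : ℂ) * z i) := by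
  have hfin : volume (radii n) ≠ ⊤ := by simp [volume_radii]
  have hcont : ∀ k : Fin n → ℕ, Continuous fun x : Fin n → ℝ => (binomCoeff m k * c k * a k *
      monom k z) * (betaDensity m x * monom k fun i => (x i : ℂ)) := fun k =>
    continuous_const.mul ((continuous_betaDensity m).mul
      ((continuous_monom k).comp (by fun_prop)))
  have hI : ∀ k : Fin n → ℕ, Integrable (fun x : Fin n → ℝ => (binomCoeff m k * c k * a k *
      monom k z) * (betaDensity m x * monom k fun i => (x i : ℂ)))
      (volume.restrict (radii n)) := fun k =>
    (((hcont k).continuousOn.integrableOn_compact isCompact_Icc).mono_set radii_subset_Icc)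
  have hS : Summable fun k : Fin n → ℕ => ∫ x in radii n, ‖(binomCoeff m k * c k * a k *
      monom k z) * (betaDensity m x * monom k fun i => (x i : ℂ))‖ := by
    refine Summable.of_nonneg_of_le (fun k => by positivity) (fun k => ?_)
      ((hG.summable_mul hf hz).mul_right ((m : ℝ) ^ n))
    have h1 := norm_setIntegral_le_of_norm_le_const (μ := volume) (s := radii n)
      (f := fun x => ‖(binomCoeff m k * c k * a k *
        monom k z) * (betaDensity m x * monom k fun i => (x i : ℂ))‖)
      (C := ‖binomCoeff m k * c k * a k * monom k z‖ * (m : ℝ) ^ n) hfin.lt_top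
      (fun x hx => by
        have hx' := radii_subset_Icc hx
        rw [norm_norm, norm_mul _ (betaDensity m x * _), norm_mul (betaDensity m x)]
        gcongr
        calc _ ≤ (m : ℝ) ^ n * 1 := by
              gcongr
              exacts [norm_betaDensity_le m hx', norm_monom_le_one k hx']
          _ = _ := mul_one _)
    rw [measureReal_def, volume_radii, ENNReal.toReal_one, mul_one] at h1
    exact (le_abs_self _).trans h1
  have h := hasSum_integral_of_summable_integral_norm hI hS
  simp only [integral_const_mul, integral_betaDensity_mul_monom hm] at h
  rw [hadamard]
  have h2 : ∀ k, c k * a k * monom k z =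
      binomCoeff m k * c k * a k * monom k z * (binomCoeff m k)⁻¹ := fun k => by
    field_simp [binomCoeff_ne_zero m k]
  simp only [h2]
  rw [h.tsum_eq]
  refine setIntegral_congr_fun measurableSet_radii fun x _ => ?_
  simp only [hadamard, ← tsum_mul_left]
  refine tsum_congr fun k => ?_
  rw [monom_mul]
  ring

/-- The integral over the torus of `|G(R η)| ^ p |f(R r ξ η⁻¹)| ^ p` in `η`. -/
def crossMean (p : ℝ) (G f : (Fin n → ℂ) → ℂ) (R r : Fin n → ℝ) (ξ : UnitAddTorus (Fin n)) :
    ℝ≥0∞ :=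
  ∫⁻ η, ‖G (torusPoint R η)‖ₑ ^ p * ‖f (torusPoint (fun i => R i * r i) (ξ - η))‖ₑ ^ p

/-- The cross means are the means of the holomorphic function
`w ↦ G(w) * conj (f(conj w * r ξ))`. -/
theorem exists_holo_powerMean_eq_crossMean {G f : (Fin n → ℂ) → ℂ} (hG : G ∈ holo n)
    (hf : f ∈ holo n) {r : Fin n → ℝ} (hr : r ∈ radii n) (ξ : UnitAddTorus (Fin n)) :
    ∃ Φ ∈ holo n, ∀ p, 0 ≤ p → ∀ R, powerMean p Φ R = crossMean p G f R r ξ := by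
  have hf' : DifferentiableOn ℂ f (polydisc n) := hf
  have hG' : DifferentiableOn ℂ G (polydisc n) := hG
  set F : (Fin n → ℂ) → ℂ := fun v => f fun i => v i * torusPoint r ξ i with hF
  have hmaps : ∀ v ∈ polydisc n, (fun i => v i * torusPoint r ξ i) ∈ polydisc n := fun v hv i => by
    rw [norm_mul]
    exact mul_lt_one_of_nonneg_of_lt_one_left (norm_nonneg _) (hv i)
      (torusPoint_mem_polydisc hr ξ i).le
  have hFd : ∀ v ∈ polydisc n, DifferentiableAt ℂ F v := fun v hv =>
    (hf'.differentiableAt (isOpen_polydisc.mem_nhds (hmaps v hv))).comp v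
      (f := fun v : Fin n → ℂ => fun i => v i * torusPoint r ξ i) (by fun_prop)
  refine ⟨fun w => G w * star (F (star w)), ?_, ?_⟩
  · intro w hw
    have hw' : star w ∈ polydisc n := fun i => by simpa using hw i
    have h1 := (hFd _ hw').star_star
    rw [star_star] at h1
    exact ((hG'.differentiableAt (isOpen_polydisc.mem_nhds hw)).mul h1).differentiableWithinAt
  · intro p hp R
    refine lintegral_congr fun η => ?_
    rw [enorm_mul, ENNReal.mul_rpow_of_nonneg _ _ hp]
    congr 2
    rw [hF, ← ofReal_norm, ← ofReal_norm, norm_star]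
    congr 3
    refine congrArg f (funext fun i => ?_)
    rw [torusPoint_apply, torusPoint_apply, Pi.star_apply, torusPoint_apply, Pi.sub_apply,
      sub_eq_add_neg, AddCircle.toCircle_add, AddCircle.toCircle_neg, Circle.coe_mul,
      Circle.coe_inv_eq_conj, star_mul']
    simp
    ring

theorem sqrt_mem_radii {x : Fin n → ℝ} (hx : x ∈ radii n) : (fun i => Real.sqrt (x i)) ∈ radii n :=
  fun i => ⟨Real.sqrt_nonneg _, (Real.sqrt_lt' one_pos).2 (by simpa using (hx i).2)⟩

theorem sqrt_le_boxMid {j : Fin n → ℕ} {x : Fin n → ℝ} (hx : x ∈ dyadicBox j) :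
    (fun i => Real.sqrt (x i)) ≤ boxMid (shift j 2) := by
  intro i
  have hi : x i ∈ dyadicIco (j i) := hx i trivial
  have h1 := hi.2
  have hp : (0 : ℝ) < (1 / 2) ^ j i := by positivity
  have hp1 : (1 / 2 : ℝ) ^ j i ≤ 1 := pow_le_one₀ (by norm_num) (by norm_num)
  rw [pow_succ] at h1
  change Real.sqrt (x i) ≤ 1 - 3 / 4 * (1 / 2) ^ (j i + 2)
  rw [pow_add]
  refine Real.sqrt_le_iff.2 ⟨by nlinarith, by nlinarith⟩

theorem mul_mem_radii {R r : Fin n → ℝ} (hR : R ∈ radii n) (hr : r ∈ radii n) :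
    (fun i => R i * r i) ∈ radii n :=
  fun i => ⟨mul_nonneg (hR i).1 (hr i).1,
    mul_lt_one_of_nonneg_of_lt_one_left (hR i).1 (hR i).2 (hr i).2.le⟩

/-- Pointwise bound of a Hadamard product by cross means over dyadic radii. -/
theorem enorm_hadamard_le {m : ℕ} (hm : 1 ≤ m) {G f : (Fin n → ℂ) → ℂ}
    {c a : (Fin n → ℕ) → ℂ} (hG : HasExpansion G fun k => binomCoeff m k * c k)
    (hf : HasExpansion f a) {r : Fin n → ℝ} (hr : r ∈ radii n) (ξ : UnitAddTorus (Fin n)) :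
    ‖hadamard c a (torusPoint r ξ)‖ₑ ≤
      ∑' j, (m : ℝ≥0∞) ^ n * dyad j m * crossMean 1 G f (boxMid (shift j 2)) r ξ := by
  obtain ⟨Φ, hΦ, hΦm⟩ := exists_holo_powerMean_eq_crossMean (holo_of_hasExpansion hG)
    (holo_of_hasExpansion hf) hr ξ
  rw [hadamard_eq_integral hm hG hf (torusPoint_mem_polydisc hr ξ)]
  refine (enorm_integral_le_lintegral_enorm _).trans ?_
  rw [lintegral_radii_eq_tsum]
  refine ENNReal.tsum_le_tsum fun j => ?_
  have hb : ∀ x ∈ dyadicBox j, ‖betaDensity m x * hadamard (fun k => binomCoeff m k * c k) a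
      (fun i => (x i : ℂ) * torusPoint r ξ i)‖ₑ ≤ (m : ℝ≥0∞) ^ n * dyad j ((m : ℝ) - 1) *
        crossMean 1 G f (boxMid (shift j 2)) r ξ := by
    intro x hx
    have hxr := dyadicBox_subset_radii j hx
    have hs := sqrt_mem_radii hxr
    rw [enorm_mul]
    gcongr
    · exact enorm_betaDensity_le hm hx
    -- The radius `x` is shared equally between the two factors of the convolution; the loss
    -- `√x ≤ ρ` costs a shift by two of the dyadic index.
    have e : (fun i => (x i : ℂ) * torusPoint r ξ i) =
        torusPoint (fun i => Real.sqrt (x i) * (Real.sqrt (x i) * r i)) ξ := by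
      funext i
      rw [torusPoint_apply, torusPoint_apply, ← mul_assoc (Real.sqrt _),
        Real.mul_self_sqrt (hxr i).1]
      push_cast
      ring
    rw [e, ← integral_mul_eq_hadamard hG hf hs (mul_mem_radii hs hr) ξ]
    refine (enorm_integral_le_lintegral_enorm _).trans ?_
    rw [← hΦm 1 zero_le_one]
    refine le_trans (le_of_eq ?_) (powerMean_mono hΦ one_pos hs (boxMid_mem_radii _)
      (sqrt_le_boxMid hx))
    rw [hΦm 1 zero_le_one, crossMean]
    simp only [ENNReal.rpow_one, enorm_mul]
  calc _ ≤ ∫⁻ _x in dyadicBox j, (m : ℝ≥0∞) ^ n * dyad j ((m : ℝ) - 1) *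
        crossMean 1 G f (boxMid (shift j 2)) r ξ :=
        setLIntegral_mono' (measurableSet_dyadicBox j) hb
    _ ≤ (m : ℝ≥0∞) ^ n * dyad j ((m : ℝ) - 1) *
        crossMean 1 G f (boxMid (shift j 2)) r ξ * dyad j 1 := by
        rw [setLIntegral_const]
        gcongr
        exact volume_dyadicBox_le j
    _ = _ := by
        rw [show (m : ℝ) = (m - 1) + 1 by ring, dyad_add]
        simp only [sub_add_cancel]
        ring

theorem lintegral_crossMean (t : ℝ) {G f : (Fin n → ℂ) → ℂ} (hG : G ∈ holo n)
    (hf : f ∈ holo n) {R r : Fin n → ℝ} (hR : R ∈ radii n) (hr : r ∈ radii n) :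
    ∫⁻ ξ, crossMean t G f R r ξ = powerMean t G R * powerMean t f fun i => R i * r i := by
  have hfc : Continuous fun q : UnitAddTorus (Fin n) × UnitAddTorus (Fin n) =>
      f (torusPoint (fun i => R i * r i) (q.1 - q.2)) :=
    (continuous_comp_torusPoint hf (mul_mem_radii hR hr)).comp
      (continuous_fst.sub continuous_snd)
  have hGc : Continuous fun q : UnitAddTorus (Fin n) × UnitAddTorus (Fin n) =>
      G (torusPoint R q.2) := (continuous_comp_torusPoint hG hR).comp continuous_snd
  have hm : Measurable fun q : UnitAddTorus (Fin n) × UnitAddTorus (Fin n) =>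
      ‖G (torusPoint R q.2)‖ₑ ^ t * ‖f (torusPoint (fun i => R i * r i) (q.1 - q.2))‖ₑ ^ t :=
    (hGc.measurable.enorm.pow_const t).mul (hfc.measurable.enorm.pow_const t)
  have hm1 : Measurable fun η => ‖G (torusPoint R η)‖ₑ ^ t :=
    (continuous_comp_torusPoint hG hR).measurable.enorm.pow_const t
  have hm2 : Measurable fun η => ‖f (torusPoint (fun i => R i * r i) η)‖ₑ ^ t :=
    (continuous_comp_torusPoint hf (mul_mem_radii hR hr)).measurable.enorm.pow_const t
  calc _ = ∫⁻ η, ∫⁻ ξ, ‖G (torusPoint R η)‖ₑ ^ t *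
        ‖f (torusPoint (fun i => R i * r i) (ξ - η))‖ₑ ^ t :=
        lintegral_lintegral_swap (f := fun ξ η => ‖G (torusPoint R η)‖ₑ ^ t *
          ‖f (torusPoint (fun i => R i * r i) (ξ - η))‖ₑ ^ t) hm.aemeasurable
    _ = ∫⁻ η, ‖G (torusPoint R η)‖ₑ ^ t * powerMean t f fun i => R i * r i := by
        refine lintegral_congr fun η => ?_
        have hm3 : Measurable fun ξ => ‖f (torusPoint (fun i => R i * r i) (ξ - η))‖ₑ ^ t :=
          hm2.comp (measurable_id.sub_const η)
        rw [lintegral_const_mul _ hm3,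
          lintegral_sub_right_eq_self fun ξ => ‖f (torusPoint (fun i => R i * r i) ξ)‖ₑ ^ t]
        rfl
    _ = _ := by rw [lintegral_mul_const _ hm1]; rfl

/-- Bound of the means of a Hadamard product by those of the factors, for exponents `t ≤ 1`. -/
theorem exists_powerMean_hadamard_le (n : ℕ) {m : ℕ} (hm : 1 ≤ m) {t : ℝ} (ht0 : 0 < t)
    (ht : t ≤ 1) : ∃ K : ℝ≥0∞, K ≠ ⊤ ∧ ∀ (G f : (Fin n → ℂ) → ℂ) (c a : (Fin n → ℕ) → ℂ),
      HasExpansion G (fun k => binomCoeff m k * c k) → HasExpansion f a → ∀ r ∈ radii n,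
      powerMean t (hadamard c a) r ≤ K * ∑' j, dyad j (m * t + t - 1) *
        (powerMean t G (boxMid (shift j 3)) *
          powerMean t f fun i => boxMid (shift j 3) i * r i) := by
  obtain ⟨K, hK, hsh⟩ := exists_dyad_le_dyad_shift n 2 (1 - 1 / t)
  refine ⟨((m : ℝ≥0∞) ^ n * ((1000 ^ n) ^ (1 / t - 1) * K)) ^ t, ?_, ?_⟩
  · have h1t : 0 ≤ 1 / t - 1 := by rw [sub_nonneg, le_div_iff₀ ht0]; linarith
    refine ENNReal.rpow_ne_top_of_nonneg ht0.le (ENNReal.mul_ne_top (by finiteness)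
      (ENNReal.mul_ne_top (ENNReal.rpow_ne_top_of_nonneg h1t (by finiteness)) hK))
  intro G f c a hG hf r hr
  have hGh := holo_of_hasExpansion hG
  have hfh := holo_of_hasExpansion hf
  set C : ℝ≥0∞ := (m : ℝ≥0∞) ^ n * ((1000 ^ n) ^ (1 / t - 1) * K) with hC
  have hpt : ∀ ξ, ‖hadamard c a (torusPoint r ξ)‖ₑ ^ t ≤ ∑' j, C ^ t * (dyad j (m * t + t - 1) *
      crossMean t G f (boxMid (shift j 3)) r ξ) := by
    intro ξ
    obtain ⟨Φ, hΦ, hΦm⟩ := exists_holo_powerMean_eq_crossMean hGh hfh hr ξ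
    calc _ ≤ (∑' j, (m : ℝ≥0∞) ^ n * dyad j m *
          crossMean 1 G f (boxMid (shift j 2)) r ξ) ^ t := by
          gcongr
          exact enorm_hadamard_le hm hG hf hr ξ
      _ ≤ ∑' j, ((m : ℝ≥0∞) ^ n * dyad j m *
          crossMean 1 G f (boxMid (shift j 2)) r ξ) ^ t := rpow_tsum_le_tsum_rpow _ ht0 ht
      _ ≤ _ := by
          refine ENNReal.tsum_le_tsum fun j => ?_
          have h1 := powerMean_le_powerMean_rpow hΦ ht0 ht (shift j 2)
          rw [hΦm 1 zero_le_one, hΦm t ht0.le] at h1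
          calc _ ≤ ((m : ℝ≥0∞) ^ n * dyad j m * ((1000 ^ n) ^ (1 / t - 1) *
                (K * dyad j (1 - 1 / t)) *
                crossMean t G f (boxMid (shift j 3)) r ξ ^ (1 / t))) ^ t := by
                gcongr
                refine h1.trans ?_
                gcongr
                · exact (hsh j).2
                · rfl
            _ = (C * dyad j (m + (1 - 1 / t)) *
                crossMean t G f (boxMid (shift j 3)) r ξ ^ (1 / t)) ^ t := by
                rw [dyad_add, hC]; congr 1; ring
            _ = _ := by
                rw [ENNReal.mul_rpow_of_nonneg _ _ ht0.le, ENNReal.mul_rpow_of_nonneg _ _ ht0.le,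
                  dyad_rpow, ← ENNReal.rpow_mul, one_div_mul_cancel ht0.ne', ENNReal.rpow_one,
                  show ((m : ℝ) + (1 - 1 / t)) * t = m * t + t - 1 by field_simp; ring, mul_assoc]
  have hmeas : ∀ j : Fin n → ℕ,
      Measurable fun ξ => crossMean t G f (boxMid (shift j 3)) r ξ := by
    intro j
    have hR := boxMid_mem_radii (shift j 3)
    have hfc : Continuous fun q : UnitAddTorus (Fin n) × UnitAddTorus (Fin n) =>
        f (torusPoint (fun i => boxMid (shift j 3) i * r i) (q.1 - q.2)) :=
      (continuous_comp_torusPoint hfh (mul_mem_radii hR hr)).comp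
        (continuous_fst.sub continuous_snd)
    have hGc : Continuous fun q : UnitAddTorus (Fin n) × UnitAddTorus (Fin n) =>
        G (torusPoint (boxMid (shift j 3)) q.2) :=
      (continuous_comp_torusPoint hGh hR).comp continuous_snd
    exact ((hGc.measurable.enorm.pow_const t).mul
      (hfc.measurable.enorm.pow_const t)).lintegral_prod_right'
  calc powerMean t (hadamard c a) r ≤ ∫⁻ ξ, ∑' j, C ^ t * (dyad j (m * t + t - 1) *
        crossMean t G f (boxMid (shift j 3)) r ξ) := lintegral_mono hpt
    _ = ∑' j, C ^ t * (dyad j (m * t + t - 1) * (powerMean t G (boxMid (shift j 3)) *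
          powerMean t f fun i => boxMid (shift j 3) i * r i)) := by
        rw [lintegral_tsum fun j => (((hmeas j).const_mul _).const_mul _).aemeasurable]
        refine tsum_congr fun j => ?_
        rw [lintegral_const_mul _ ((hmeas j).const_mul _), lintegral_const_mul _ (hmeas j),
          lintegral_crossMean t hGh hfh (boxMid_mem_radii _) hr]
    _ = _ := ENNReal.tsum_mul_left

/-! ### Sufficiency of the growth condition -/

theorem dyad_add_index (j k : Fin n → ℕ) (a : ℝ) : dyad (j + k) a = dyad j a * dyad k a := by
  simp only [dyad_eq_prod, ← Finset.prod_mul_distrib]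
  refine Finset.prod_congr rfl fun i _ => ?_
  rw [← ENNReal.rpow_add _ _ (by norm_num) (by norm_num)]
  congr 1
  rw [Pi.add_apply]
  push_cast
  ring

theorem tsum_dyad_ne_top (n : ℕ) {b : ℝ} (hb : 0 < b) : ∑' j : Fin n → ℕ, dyad j b ≠ ⊤ := by
  set x : ℝ := 2 ^ (-b) with hx
  have hx0 : 0 < x := by positivity
  have hx1 : x < 1 := Real.rpow_lt_one_of_one_lt_of_neg (by norm_num) (by linarith)
  have hs := (hasSum_pi_prod (n := n) (u := fun _ k => (x : ℂ) ^ k) fun _ =>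
    hasSum_geometric_of_norm_lt_one (by
      rwa [Complex.norm_real, Real.norm_eq_abs, abs_of_pos hx0])).summable.norm
  have h : ∀ j : Fin n → ℕ, dyad j b = ENNReal.ofReal ‖∏ i, (x : ℂ) ^ j i‖ := fun j => by
    rw [norm_prod, ENNReal.ofReal_prod_of_nonneg fun _ _ => norm_nonneg _, dyad_eq_prod]
    refine Finset.prod_congr rfl fun i _ => ?_
    rw [norm_pow, Complex.norm_real, Real.norm_eq_abs, abs_of_pos hx0, ENNReal.ofReal_pow hx0.le,
      hx, ← ENNReal.ofReal_rpow_of_pos (by norm_num), ENNReal.ofReal_ofNat, ← ENNReal.rpow_natCast,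
      ← ENNReal.rpow_mul]
    congr 1
    ring
  simp only [h]
  exact hs.tsum_ofReal_ne_top

/-- Summation over pairs of multi-indices of a quantity depending on their minimum, against
geometric weights. -/
theorem tsum_dyad_mul_tsum_inf_le (a b : ℝ) (ψ : (Fin n → ℕ) → ℝ≥0∞) :
    ∑' i, dyad i b * ∑' j, dyad j a * ψ (i ⊓ j) ≤
      (∑' u : Fin n → ℕ, dyad u b) * (∑' v : Fin n → ℕ, dyad v a) *
        ∑' k, dyad k (a + b) * ψ k := by
  set F : (Fin n → ℕ) × (Fin n → ℕ) × (Fin n → ℕ) → ℝ≥0∞ := fun q =>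
    dyad (q.1 + q.2.1) b * (dyad (q.1 + q.2.2) a * ψ q.1) with hF
  set e : (Fin n → ℕ) × (Fin n → ℕ) → (Fin n → ℕ) × (Fin n → ℕ) × (Fin n → ℕ) := fun q =>
    (q.1 ⊓ q.2, q.1 - q.1 ⊓ q.2, q.2 - q.1 ⊓ q.2) with he
  have h1 : ∀ i j : Fin n → ℕ, i ⊓ j + (i - i ⊓ j) = i := fun i j =>
    add_tsub_cancel_of_le inf_le_left
  have h2 : ∀ i j : Fin n → ℕ, i ⊓ j + (j - i ⊓ j) = j := fun i j =>
    add_tsub_cancel_of_le inf_le_right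
  have hinj : Function.Injective e := by
    rintro ⟨i, j⟩ ⟨i', j'⟩ h
    simp only [he, Prod.mk.injEq] at h
    obtain ⟨ha, hb, hc⟩ := h
    rw [Prod.mk.injEq]
    constructor
    · rw [← h1 i j, hb, ha, h1]
    · rw [← h2 i j, hc, ha, h2]
  calc _ = ∑' q : (Fin n → ℕ) × (Fin n → ℕ), F (e q) := by
        rw [ENNReal.tsum_prod']
        refine tsum_congr fun i => ?_
        rw [← ENNReal.tsum_mul_left]
        refine tsum_congr fun j => ?_
        simp only [hF, he, h1, h2]
    _ ≤ ∑' q, F q := ENNReal.tsum_comp_le_tsum_of_injective hinj F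
    _ = ∑' k, ∑' u, ∑' v, dyad u b * (dyad v a * (dyad k (a + b) * ψ k)) := by
        rw [ENNReal.tsum_prod']
        refine tsum_congr fun k => ?_
        rw [ENNReal.tsum_prod']
        refine tsum_congr fun u => tsum_congr fun v => ?_
        simp only [hF]
        rw [dyad_add_index, dyad_add_index, dyad_add]
        ring
    _ = _ := by
        simp only [ENNReal.tsum_mul_left, ENNReal.tsum_mul_right]
        ring

theorem mul_le_boxMid_inf (i j : Fin n → ℕ) :
    (fun l => boxMid j l * boxMid i l) ≤ boxMid (i ⊓ j) := by
  intro l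
  have hi := boxMid_mem_radii i l
  have hj := boxMid_mem_radii j l
  change boxMid j l * boxMid i l ≤ dyadicMid ((i ⊓ j) l)
  rw [Pi.inf_apply]
  rcases min_choice (i l) (j l) with h | h <;> rw [show i l ⊓ j l = _ from h]
  · exact mul_le_of_le_one_left hi.1 hj.2.le
  · exact mul_le_of_le_one_right hj.1 hi.2.le

/-- The growth condition on the means along the dyadic radii. -/
theorem exists_powerMean_le_of_iSup_lt_top {t γ : ℝ} (ht : 0 < t) {G : (Fin n → ℂ) → ℂ}
    (h : (⨆ r ∈ radii n, integralMean t G r * weight γ r) < ⊤) :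
    ∃ S : ℝ≥0∞, S ≠ ⊤ ∧ ∀ j : Fin n → ℕ, powerMean t G (boxMid j) ≤ S * dyad j (-(γ * t)) := by
  obtain ⟨K, hK, hw⟩ := exists_weight_comparable n γ
  set S := ⨆ r ∈ radii n, integralMean t G r * weight γ r with hS
  refine ⟨(K * S) ^ t, ENNReal.rpow_ne_top_of_nonneg ht.le (ENNReal.mul_ne_top hK h.ne), ?_⟩
  intro j
  have h1 : integralMean t G (boxMid j) * weight γ (boxMid j) ≤ S :=
    le_iSup₂ (f := fun r (_ : r ∈ radii n) => integralMean t G r * weight γ r) _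
      (boxMid_mem_radii j)
  have h2 := (hw j _ (boxMid_mem_dyadicBox j)).2
  have h3 : integralMean t G (boxMid j) ≤ K * S * dyad j (-γ) := by
    calc _ = integralMean t G (boxMid j) * (dyad j γ * dyad j (-γ)) := by
          rw [dyad_mul_neg, mul_one]
      _ ≤ integralMean t G (boxMid j) * (K * weight γ (boxMid j) * dyad j (-γ)) := by gcongr
      _ = K * (integralMean t G (boxMid j) * weight γ (boxMid j)) * dyad j (-γ) := by ring
      _ ≤ _ := by gcongr
  have h4 := integralMean_rpow t t G (boxMid j)
  rw [div_self ht.ne', ENNReal.rpow_one] at h4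
  rw [← h4]
  calc _ ≤ (K * S * dyad j (-γ)) ^ t := by gcongr
    _ = _ := by rw [ENNReal.mul_rpow_of_nonneg _ _ ht.le, dyad_rpow, neg_mul]

/-- If the means of the fractional derivative `G` obey the growth condition, the Hadamard product
with `c` maps `A^{p,τ}_α` into `A^{t,s}_β` for `τ ≤ s`. -/
theorem dyadicNorm_hadamard_lt_top {p τ α t s β : ℝ} {m : ℕ} (hm : 1 ≤ m) (hp : 0 < p)
    (hτ : 0 < τ) (hτs : τ ≤ s) (ht : t ≤ 1) (hst : s ≤ t) (hps : p ≤ s) (hβ : 0 < β)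
    (hlow : β + 1 / t < α + 1 / p) {G f : (Fin n → ℂ) → ℂ} {c a : (Fin n → ℕ) → ℂ}
    (hG : HasExpansion G fun k => binomCoeff m k * c k) (hf : HasExpansion f a)
    {S : ℝ≥0∞} (hS : S ≠ ⊤)
    (hGS : ∀ j : Fin n → ℕ, powerMean t G (boxMid j) ≤
      S * dyad j (-((m + 1 - 1 / p + β - α) * t)))
    (hfn : dyadicNorm p τ α f < ⊤) : dyadicNorm t s β (hadamard c a) < ⊤ := by
  have hs : 0 < s := hτ.trans_le hτs
  have ht0 : 0 < t := hs.trans_le hst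
  have hfh := holo_of_hasExpansion hf
  set γ := (m : ℝ) + 1 - 1 / p + β - α with hγ
  set A : ℝ := m * t + t - 1 with hA
  set d : ℝ := A - γ * t with hd
  -- The growth condition leaves the geometric factor `2 ^ (-d |j|)`, with `d` a multiple of the gap
  -- between `α + 1 / p` and `β + 1 / t`.
  have hd0 : 0 < d := by
    have : d = t * (α + 1 / p - (β + 1 / t)) := by rw [hd, hA, hγ]; field_simp; ring
    rw [this]
    exact mul_pos ht0 (by linarith)
  set φ : (Fin n → ℕ) → ℝ≥0∞ := fun k => powerMean t f (boxMid k) with hφ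
  obtain ⟨K, hK, hbound⟩ := exists_powerMean_hadamard_le n hm ht0 ht
  obtain ⟨K2, hK2, hsh2⟩ := exists_dyad_le_dyad_shift n 3 A
  obtain ⟨K3, hK3, hsh3⟩ := exists_dyad_le_dyad_shift n 1 (α * s)
  have hst0 : 0 < s / t := div_pos hs ht0
  have h1 : ∀ i : Fin n → ℕ, powerMean t (hadamard c a) (boxMid i) ≤
      K * (K2 * S) * ∑' j, dyad j d * φ (i ⊓ j) := by
    intro i
    refine (hbound G f c a hG hf _ (boxMid_mem_radii i)).trans ?_
    rw [mul_assoc]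
    gcongr
    calc _ ≤ ∑' j, K2 * S * (dyad (shift j 3) d * φ (i ⊓ shift j 3)) := by
          refine ENNReal.tsum_le_tsum fun j => ?_
          have h2 : powerMean t f (fun l => boxMid (shift j 3) l * boxMid i l) ≤
              φ (i ⊓ shift j 3) := powerMean_mono hfh ht0
            (mul_mem_radii (boxMid_mem_radii _) (boxMid_mem_radii i)) (boxMid_mem_radii _)
            (mul_le_boxMid_inf i _)
          calc _ ≤ K2 * dyad (shift j 3) A * (S * dyad (shift j 3) (-(γ * t)) *
                φ (i ⊓ shift j 3)) := by
                gcongr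
                · exact (hsh2 j).1
                · exact hGS _
            _ = _ := by
                rw [hd, sub_eq_add_neg, dyad_add]
                ring
      _ = K2 * S * ∑' j, (dyad (shift j 3) d * φ (i ⊓ shift j 3)) := ENNReal.tsum_mul_left
      _ ≤ _ := by
          exact mul_le_mul_right (ENNReal.tsum_comp_le_tsum_of_injective (shift_injective 3)
            fun j => dyad j d * φ (i ⊓ j)) _
  have h2 : dyadicNorm t s β (hadamard c a) ≤ (K * (K2 * S)) ^ (s / t) *
      ∑' i, dyad i (β * s) * ∑' j, dyad j (d * (s / t)) * φ (i ⊓ j) ^ (s / t) := by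
    rw [dyadicNorm, ← ENNReal.tsum_mul_left]
    refine ENNReal.tsum_le_tsum fun i => ?_
    calc _ ≤ dyad i (β * s) * (K * (K2 * S) * ∑' j, dyad j d * φ (i ⊓ j)) ^ (s / t) := by
          gcongr
          exact h1 i
      _ ≤ dyad i (β * s) * ((K * (K2 * S)) ^ (s / t) *
            ∑' j, (dyad j d * φ (i ⊓ j)) ^ (s / t)) := by
          rw [ENNReal.mul_rpow_of_nonneg _ _ hst0.le]
          gcongr
          exact rpow_tsum_le_tsum_rpow _ hst0 ((div_le_one ht0).2 hst)
      _ = _ := by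
          simp only [ENNReal.mul_rpow_of_nonneg _ _ hst0.le, dyad_rpow]
          ring
  have h3 := tsum_dyad_mul_tsum_inf_le (d * (s / t)) (β * s) fun k => φ k ^ (s / t)
  set C : ℝ≥0∞ := ((1000 ^ n) ^ (t / p - 1)) ^ (s / t) with hC
  have hpt : p ≤ t := hps.trans hst
  have htp : 0 ≤ t / p - 1 := by rw [sub_nonneg, le_div_iff₀ hp]; linarith
  have hCt : C ≠ ⊤ := ENNReal.rpow_ne_top_of_nonneg hst0.le
    (ENNReal.rpow_ne_top_of_nonneg htp (by finiteness))
  have h4 : ∑' k, dyad k (d * (s / t) + β * s) * φ k ^ (s / t) ≤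
      C * K3 * dyadicNorm p τ α f ^ (s / τ) := by
    calc _ ≤ ∑' k, C * K3 * (dyad (shift k 1) (α * s) *
          powerMean p f (boxMid (shift k 1)) ^ (s / p)) := by
          refine ENNReal.tsum_le_tsum fun k => ?_
          calc _ ≤ dyad k (d * (s / t) + β * s) * ((1000 ^ n) ^ (t / p - 1) *
                dyad k (1 - t / p) * powerMean p f (boxMid (shift k 1)) ^ (t / p)) ^ (s / t) := by
                gcongr
                exact powerMean_le_powerMean_rpow hfh hp hpt k
            _ = C * dyad k (d * (s / t) + β * s + (1 - t / p) * (s / t)) *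
                powerMean p f (boxMid (shift k 1)) ^ (s / p) := by
                rw [ENNReal.mul_rpow_of_nonneg _ _ hst0.le,
                  ENNReal.mul_rpow_of_nonneg _ _ hst0.le, dyad_rpow,
                  ← ENNReal.rpow_mul (powerMean p f _), show t / p * (s / t) = s / p by field_simp,
                  dyad_add k (_ + _)]
                ring
            -- The loss in passing from `M_t` to `M_p` turns the exponent into `α s`.
            _ = C * dyad k (α * s) * powerMean p f (boxMid (shift k 1)) ^ (s / p) := by
                congr 3
                rw [hd, hA, hγ]
                field_simp
                ring
            _ ≤ C * (K3 * dyad (shift k 1) (α * s)) *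
                powerMean p f (boxMid (shift k 1)) ^ (s / p) := by
                gcongr
                exact (hsh3 k).1
            _ = _ := by ring
      _ = C * K3 * ∑' k, (dyad (shift k 1) (α * s) *
          powerMean p f (boxMid (shift k 1)) ^ (s / p)) := ENNReal.tsum_mul_left
      _ ≤ C * K3 * ∑' k : Fin n → ℕ, dyad k (α * s) * powerMean p f (boxMid k) ^ (s / p) := by
          exact mul_le_mul_right (ENNReal.tsum_comp_le_tsum_of_injective (shift_injective 1)
            fun k => dyad k (α * s) * powerMean p f (boxMid k) ^ (s / p)) _
      _ ≤ _ := by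
          gcongr
          exact dyadicNorm_le_rpow p α hτ hτs f
  refine lt_top_iff_ne_top.2 (ne_top_of_le_ne_top ?_ (h2.trans
    (mul_le_mul_right (h3.trans (mul_le_mul_right h4 _)) _)))
  have e1 := tsum_dyad_ne_top n (b := β * s) (by positivity)
  have e2 := tsum_dyad_ne_top n (b := d * (s / t)) (by positivity)
  refine ENNReal.mul_ne_top (ENNReal.rpow_ne_top_of_nonneg hst0.le
    (ENNReal.mul_ne_top hK (ENNReal.mul_ne_top hK2 hS))) (ENNReal.mul_ne_top
      (ENNReal.mul_ne_top e1 e2) (ENNReal.mul_ne_top (ENNReal.mul_ne_top hCt hK3)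
        (ENNReal.rpow_ne_top_of_nonneg (by positivity) hfn.ne)))

/-- The growth condition makes `c` a multiplier into `F^{t,s}_β` from every class of functions of
finite dyadic norms. -/
theorem mem_coeffMultipliers_of_iSup_lt_top {p τ α t s β : ℝ} {m : ℕ} (hm : 1 ≤ m) (hp : 0 < p)
    (hτ : 0 < τ) (hτs : τ ≤ s) (ht : t ≤ 1) (hst : s ≤ t) (hps : p ≤ s) (hβ : 0 < β)
    (hlow : β + 1 / t < α + 1 / p) {g : (Fin n → ℂ) → ℂ} {c : (Fin n → ℕ) → ℂ}
    (hgc : HasExpansion g c)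
    (hsup : (⨆ r ∈ radii n,
      integralMean t (fracDeriv m c) r * weight (m + 1 - 1 / p + β - α) r) < ⊤)
    {X : Set ((Fin n → ℂ) → ℂ)} (hX : ∀ f ∈ X, dyadicNorm p τ α f < ⊤) :
    c ∈ coeffMultipliers X (lizorkinTriebelSpace n t s β) := by
  intro f hfX a hfa
  have hs : 0 < s := hτ.trans_le hτs
  have hh := hgc.hadamard hfa
  obtain ⟨S, hS, hGS⟩ := exists_powerMean_le_of_iSup_lt_top (hs.trans_le hst) hsup
  exact ⟨hadamard c a, mem_lizorkinTriebelSpace_of_dyadicNorm (holo_of_hasExpansion hh) hs hst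
    (dyadicNorm_hadamard_lt_top hm hp hτ hτs ht hst hps hβ hlow (hasExpansion_fracDeriv m hgc) hfa
      hS hGS (hX f hfX)), hh⟩

/-! ### The test functions -/

theorem lintegral_torus_prod {n : ℕ} {F : Fin n → UnitAddCircle → ℝ≥0∞}
    (hF : ∀ i, Measurable (F i)) :
    ∫⁻ θ : UnitAddTorus (Fin n), ∏ i, F i (θ i) = ∏ i, ∫⁻ x, F i x := by
  induction n with
  | zero => simp [volume_torus_univ]
  | succ n ih =>
    have hmp := volume_preserving_piFinSuccAbove (fun _ : Fin (n + 1) => UnitAddCircle) 0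
    have h := hmp.symm.lintegral_map_equiv (fun θ => ∏ i, F i (θ i))
    refine h.trans ?_
    rw [Fin.prod_univ_succ, ← ih fun i => hF i.succ]
    have hm : Measurable fun θ : Fin n → UnitAddCircle => ∏ i, F i.succ (θ i) :=
      Finset.measurable_fun_prod _ fun i _ => (hF i.succ).comp (measurable_pi_apply i)
    rw [← lintegral_prod_mul (hF 0).aemeasurable hm.aemeasurable]
    refine lintegral_congr fun q => ?_
    rw [Fin.prod_univ_succ]
    rfl

theorem norm_one_sub_le_two_mul {z : ℂ} (hz : ‖z‖ ≤ 1) {l : ℝ} (h0 : 0 ≤ l) (h1 : l ≤ 1) :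
    ‖1 - z‖ ≤ 2 * ‖1 - l * z‖ := by
  have hlz : ‖(l : ℂ) * z‖ ≤ l := by
    rw [norm_mul, Complex.norm_real, Real.norm_eq_abs, abs_of_nonneg h0]
    exact mul_le_of_le_one_right h0 hz
  have h2 : 1 - l ≤ ‖1 - l * z‖ := by
    have := norm_sub_norm_le (1 : ℂ) (l * z)
    rw [norm_one] at this
    linarith
  have h3 : ‖1 - z‖ ≤ ‖1 - l * z‖ + (1 - l) := by
    calc ‖1 - z‖ = ‖(1 - l * z) - (1 - l : ℝ) * z‖ := by congr 1; push_cast; ring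
      _ ≤ ‖1 - l * z‖ + ‖((1 - l : ℝ) : ℂ) * z‖ := norm_sub_le _ _
      _ ≤ _ := by
          gcongr
          rw [norm_mul, Complex.norm_real, Real.norm_eq_abs, abs_of_nonneg (by linarith)]
          exact mul_le_of_le_one_right (by linarith) hz
  linarith

theorem max_le_norm_one_sub_toCircle {x y : ℝ} (hx : 0 ≤ x) (hx1 : x ≤ 1) (hy : |y| ≤ 1 / 2) :
    max (1 - x) |y| ≤ ‖1 - (x : ℂ) * (AddCircle.toCircle (y : UnitAddCircle) : ℂ)‖ := by
  refine max_le ?_ ?_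
  · have := norm_sub_norm_le (1 : ℂ) (x * (AddCircle.toCircle (y : UnitAddCircle) : ℂ))
    rwa [norm_one, norm_mul, Circle.norm_coe, mul_one, Complex.norm_real, Real.norm_eq_abs,
      abs_of_nonneg hx] at this
  · have h1 := norm_one_sub_le_two_mul (z := (AddCircle.toCircle (y : UnitAddCircle) : ℂ))
      (Circle.norm_coe _).le hx hx1
    have h2 : ‖1 - (AddCircle.toCircle (y : UnitAddCircle) : ℂ)‖ =
        2 * |Real.sin (Real.pi * y)| := by
      rw [AddCircle.toCircle_apply_mk, Circle.coe_exp, norm_sub_rev, mul_comm _ Complex.I,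
        Complex.norm_exp_I_mul_ofReal_sub_one, norm_mul, Real.norm_eq_abs, Real.norm_eq_abs,
        abs_two]
      congr 3
      ring
    have h3 := Real.mul_abs_le_abs_sin (x := Real.pi * y) (by
      rw [abs_mul, abs_of_pos Real.pi_pos]
      nlinarith [Real.pi_pos])
    rw [abs_mul, abs_of_pos Real.pi_pos, ← mul_assoc, div_mul_cancel₀ _ Real.pi_ne_zero] at h3
    linarith [abs_nonneg y]

/-- The integral of `max(y, |θ|) ^ (-κ)` is comparable to `y ^ (1 - κ)`. -/
theorem exists_lintegral_max_rpow_le {κ : ℝ} (hκ : 1 < κ) : ∃ C : ℝ≥0∞, C ≠ ⊤ ∧ ∀ y : ℝ, 0 < y →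
    ∫⁻ θ : ℝ, ENNReal.ofReal (max y |θ|) ^ (-κ) ≤ C * ENNReal.ofReal y ^ (1 - κ) := by
  have hκ0 : 0 < κ := by linarith
  refine ⟨2 ^ (κ + 1) * ∑' k : ℕ, ((2 : ℝ≥0∞) ^ (1 - κ)) ^ k, ?_, fun y hy => ?_⟩
  · refine ENNReal.mul_ne_top (ENNReal.rpow_ne_top_of_nonneg (by linarith) (by norm_num)) ?_
    rw [ENNReal.tsum_geometric]
    refine ENNReal.inv_ne_top.2 ?_
    rw [ne_eq, tsub_eq_zero_iff_le, not_le]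
    exact ENNReal.rpow_lt_one_of_one_lt_of_neg (by norm_num) (by linarith)
  have hpt : ∀ θ : ℝ, ENNReal.ofReal (max y |θ|) ^ (-κ) ≤ ∑' k : ℕ,
      (Icc (-(2 ^ k * y)) (2 ^ k * y)).indicator
        (fun _ => ENNReal.ofReal (2 ^ k * y / 2) ^ (-κ)) θ := by
    intro θ
    have hex : ∃ k : ℕ, |θ| ≤ 2 ^ k * y := by
      obtain ⟨k, hk⟩ := pow_unbounded_of_one_lt (|θ| / y) (by norm_num : (1 : ℝ) < 2)
      exact ⟨k, ((div_lt_iff₀ hy).1 hk).le⟩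
    classical
    set k := Nat.find hex with hk
    have hk1 : |θ| ≤ 2 ^ k * y := Nat.find_spec hex
    have hk2 : 2 ^ k * y / 2 ≤ max y |θ| := by
      rcases Nat.eq_zero_or_pos k with h0 | h0
      · rw [h0, pow_zero, one_mul]
        exact le_max_of_le_left (by linarith)
      · have h3 := Nat.find_min hex (m := k - 1) (by omega)
        rw [not_le] at h3
        refine le_max_of_le_right (le_trans (le_of_eq ?_) h3.le)
        obtain ⟨l, hl⟩ : ∃ l, k = l + 1 := ⟨k - 1, by omega⟩
        rw [hl, Nat.add_sub_cancel, pow_succ]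
        ring
    refine le_trans ?_ (ENNReal.le_tsum k)
    rw [indicator_of_mem (show θ ∈ Icc _ _ from abs_le.1 hk1),
      ENNReal.rpow_neg, ENNReal.rpow_neg, ENNReal.inv_le_inv]
    gcongr
  calc _ ≤ ∫⁻ θ : ℝ, ∑' k : ℕ, (Icc (-(2 ^ k * y)) (2 ^ k * y)).indicator
        (fun _ => ENNReal.ofReal (2 ^ k * y / 2) ^ (-κ)) θ := lintegral_mono hpt
    _ = ∑' k : ℕ, ENNReal.ofReal (2 ^ k * y / 2) ^ (-κ) * ENNReal.ofReal (2 * (2 ^ k * y)) := by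
        rw [lintegral_tsum fun k => (measurable_const.indicator measurableSet_Icc).aemeasurable]
        refine tsum_congr fun k => ?_
        rw [lintegral_indicator_const measurableSet_Icc, Real.volume_Icc]
        congr 2
        ring
    _ = ∑' k : ℕ, 2 ^ (κ + 1) * ENNReal.ofReal y ^ (1 - κ) * ((2 : ℝ≥0∞) ^ (1 - κ)) ^ k := by
        refine tsum_congr fun k => ?_
        have hpos : (0 : ℝ) < 2 ^ k := by positivity
        have hx : (0 : ℝ) < 2 ^ k * y := by positivity
        rw [← ENNReal.rpow_natCast, ← ENNReal.rpow_mul, mul_comm (1 - κ) (k : ℝ), ENNReal.rpow_mul,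
          ENNReal.rpow_natCast, ← ENNReal.ofReal_ofNat, ENNReal.ofReal_rpow_of_pos (by positivity),
          ENNReal.ofReal_rpow_of_pos (by norm_num), ENNReal.ofReal_rpow_of_pos hy,
          ← ENNReal.ofReal_pow (by norm_num), ENNReal.ofReal_rpow_of_pos hpos,
          ← ENNReal.ofReal_mul (by positivity), ← ENNReal.ofReal_mul (by positivity),
          ← ENNReal.ofReal_mul (by positivity)]
        congr 1
        rw [mul_assoc, mul_comm (y ^ _), ← Real.mul_rpow hpos.le hy.le, Real.div_rpow hx.le
          (by norm_num), Real.rpow_neg (by norm_num : (0 : ℝ) ≤ 2), div_inv_eq_mul,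
          Real.rpow_add (by norm_num : (0 : ℝ) < 2), Real.rpow_one, sub_eq_add_neg 1 κ,
          Real.rpow_add hx, Real.rpow_one]
        ring
    _ = _ := by rw [ENNReal.tsum_mul_left]; ring

/-- The classical estimate `∫ |1 - x ξ| ^ (-κ) dξ ≤ C (1 - x) ^ (1 - κ)` for `κ > 1`. -/
theorem exists_lintegral_one_sub_rpow_le {κ : ℝ} (hκ : 1 < κ) : ∃ C : ℝ≥0∞, C ≠ ⊤ ∧
    ∀ x : ℝ, 0 ≤ x → x < 1 → ∫⁻ θ : UnitAddCircle,
      ‖1 - (x : ℂ) * (AddCircle.toCircle θ : ℂ)‖ₑ ^ (-κ) ≤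
        C * ENNReal.ofReal (1 - x) ^ (1 - κ) := by
  obtain ⟨C, hC, h⟩ := exists_lintegral_max_rpow_le hκ
  refine ⟨C, hC, fun x hx hx1 => le_trans ?_ (h (1 - x) (by linarith))⟩
  have hmeas : Measurable fun θ : UnitAddCircle =>
      ‖1 - (x : ℂ) * (AddCircle.toCircle θ : ℂ)‖ₑ ^ (-κ) := by
    have hc : Continuous fun θ : UnitAddCircle => 1 - (x : ℂ) * (AddCircle.toCircle θ : ℂ) :=
      continuous_const.sub (continuous_const.mul
        (continuous_subtype_val.comp AddCircle.continuous_toCircle))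
    exact hc.measurable.enorm.pow_const _
  rw [← (UnitAddCircle.measurePreserving_mk (-(1 / 2))).lintegral_comp hmeas]
  refine (setLIntegral_mono' measurableSet_Ioc fun θ hθ => ?_).trans (setLIntegral_le_lintegral _ _)
  have h1 := max_le_norm_one_sub_toCircle hx hx1.le (y := θ)
    (abs_le.2 ⟨by linarith [hθ.1], by linarith [hθ.2]⟩)
  rw [ENNReal.rpow_neg, ENNReal.rpow_neg, ENNReal.inv_le_inv, ← ofReal_norm]
  gcongr

theorem enorm_kernelFun_rpow (m : ℕ) {p : ℝ} (hp : 0 < p) {r R : Fin n → ℝ}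
    (hr : r ∈ radii n) (hR : R ∈ radii n) (θ : UnitAddTorus (Fin n)) :
    ‖kernelFun m (fun i => (r i : ℂ)) (torusPoint R θ)‖ₑ ^ p =
      ∏ i, ‖1 - ((r i * R i : ℝ) : ℂ) * (AddCircle.toCircle (θ i) : ℂ)‖ₑ ^
        (-(((m : ℝ) + 1) * p)) := by
  rw [kernelFun, enorm_prod_complex, ← ENNReal.prod_rpow_of_nonneg hp.le]
  refine Finset.prod_congr rfl fun i _ => ?_
  have hw : 1 - ((r i * R i : ℝ) : ℂ) * (AddCircle.toCircle (θ i) : ℂ) ≠ 0 := by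
    have h0 := mul_nonneg (hr i).1 (hR i).1
    refine sub_ne_zero.2 fun h => ?_
    have h1 := congrArg norm h
    rw [norm_one, norm_mul, Circle.norm_coe, mul_one, Complex.norm_real, Real.norm_eq_abs,
      abs_of_nonneg h0] at h1
    exact absurd (mul_lt_one_of_nonneg_of_lt_one_left (hr i).1 (hr i).2 (hR i).2.le) h1.symm.not_lt
  rw [torusPoint_apply, ← mul_assoc, ← Complex.ofReal_mul, one_div, enorm_inv (pow_ne_zero _ hw),
    enorm_pow, ENNReal.inv_rpow, ENNReal.rpow_neg, ← ENNReal.rpow_natCast, ← ENNReal.rpow_mul,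
    Nat.cast_succ]

/-- The means of the test function at the dyadic radius `i`, taken over the dyadic radius `j`: each
variable contributes `(1 - ρ_i ρ_j) ^ (1 - κ)`, and `1 - ρ_i ρ_j` is comparable to
`2 ^ (-min(i, j))`. -/
theorem exists_powerMean_kernelFun_le (n m : ℕ) {p : ℝ} (hp : 0 < p)
    (hκ : 1 < ((m : ℝ) + 1) * p) : ∃ C : ℝ≥0∞, C ≠ ⊤ ∧ ∀ i j : Fin n → ℕ,
      powerMean p (kernelFun m fun l => (boxMid i l : ℂ)) (boxMid j) ≤
        C * dyad (i ⊓ j) (1 - ((m : ℝ) + 1) * p) := by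
  set κ := ((m : ℝ) + 1) * p with hκd
  obtain ⟨C, hC, h⟩ := exists_lintegral_one_sub_rpow_le hκ
  refine ⟨(C * 2 ^ (κ - 1)) ^ n, ENNReal.pow_ne_top (ENNReal.mul_ne_top hC
    (ENNReal.rpow_ne_top_of_nonneg (by linarith) (by norm_num))), fun i j => ?_⟩
  have h1 : ∀ l : Fin n, ∫⁻ θ : UnitAddCircle, ‖1 - ((boxMid i l * boxMid j l : ℝ) : ℂ) *
      (AddCircle.toCircle θ : ℂ)‖ₑ ^ (-κ) ≤
      C * 2 ^ (κ - 1) * 2 ^ (-((1 - κ) * ((i ⊓ j) l : ℝ))) := by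
    intro l
    have hi := boxMid_mem_radii i l
    have hj := boxMid_mem_radii j l
    refine (h _ (mul_nonneg hi.1 hj.1)
      (mul_lt_one_of_nonneg_of_lt_one_left hi.1 hi.2 hj.2.le)).trans
      ?_
    rw [mul_assoc]
    gcongr
    have h2 : 1 / 2 * (1 / 2 : ℝ) ^ (i ⊓ j) l ≤ 1 - boxMid i l * boxMid j l := by
      have h3 := mul_le_boxMid_inf i j l
      have h4 : boxMid (i ⊓ j) l = 1 - 3 / 4 * (1 / 2) ^ (i ⊓ j) l := rfl
      have h5 : (0 : ℝ) < (1 / 2) ^ (i ⊓ j) l := by positivity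
      rw [h4, mul_comm] at h3
      linarith
    have h6 : ENNReal.ofReal (1 / 2 * (1 / 2 : ℝ) ^ (i ⊓ j) l) =
        2 ^ (-1 - ((i ⊓ j) l : ℝ)) := by
      rw [← pow_succ', ofReal_half_pow]
      congr 1
      push_cast
      ring
    calc _ ≤ ENNReal.ofReal (1 / 2 * (1 / 2 : ℝ) ^ (i ⊓ j) l) ^ (1 - κ) := by
          rw [← neg_sub κ 1, ENNReal.rpow_neg, ENNReal.rpow_neg, ENNReal.inv_le_inv]
          have : 0 ≤ κ - 1 := by linarith
          gcongr
      _ = _ := by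
          rw [h6, ← ENNReal.rpow_mul, ← ENNReal.rpow_add _ _ (by norm_num) (by norm_num)]
          congr 1
          ring
  have hmeas : ∀ l : Fin n, Measurable fun θ : UnitAddCircle =>
      ‖1 - ((boxMid i l * boxMid j l : ℝ) : ℂ) * (AddCircle.toCircle θ : ℂ)‖ₑ ^ (-κ) := fun l => by
    have hc : Continuous fun θ : UnitAddCircle =>
        1 - ((boxMid i l * boxMid j l : ℝ) : ℂ) * (AddCircle.toCircle θ : ℂ) :=
      continuous_const.sub (continuous_const.mul
        (continuous_subtype_val.comp AddCircle.continuous_toCircle))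
    exact hc.measurable.enorm.pow_const _
  rw [powerMean]
  simp only [enorm_kernelFun_rpow m hp (boxMid_mem_radii i) (boxMid_mem_radii j)]
  rw [lintegral_torus_prod hmeas, dyad_eq_prod]
  refine (Finset.prod_le_prod' fun l _ => h1 l).trans ?_
  rw [Finset.prod_mul_distrib, Finset.prod_const, Finset.card_univ, Fintype.card_fin]

/-- Summation of a geometric weight against the minimum with a fixed multi-index. -/
theorem tsum_dyad_mul_dyad_inf_le (b e : ℝ) (i : Fin n → ℕ) :
    ∑' j, dyad j b * dyad (i ⊓ j) (-e) ≤
      (∑' u : Fin n → ℕ, dyad u (e - b)) * (∑' v : Fin n → ℕ, dyad v b) * dyad i (b - e) := by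
  set E : (Fin n → ℕ) → (Fin n → ℕ) × (Fin n → ℕ) := fun j => (i - i ⊓ j, j - i ⊓ j) with hE
  have h1 : ∀ j : Fin n → ℕ, i ⊓ j + (i - i ⊓ j) = i := fun j => add_tsub_cancel_of_le inf_le_left
  have h2 : ∀ j : Fin n → ℕ, i ⊓ j + (j - i ⊓ j) = j := fun j => add_tsub_cancel_of_le inf_le_right
  have hinj : Function.Injective E := by
    intro j j' h
    simp only [hE, Prod.mk.injEq] at h
    have h3 : i ⊓ j = i ⊓ j' := by
      have ha := h1 j
      rw [h.1] at ha
      exact add_right_cancel (ha.trans (h1 j').symm)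
    rw [← h2 j, h.2, h3, h2]
  calc _ = ∑' j, dyad i (b - e) * (dyad (E j).1 (e - b) * dyad (E j).2 b) := by
        refine tsum_congr fun j => ?_
        have ha : dyad j b = dyad (i ⊓ j) b * dyad (j - i ⊓ j) b := by
          rw [← dyad_add_index, h2]
        have hb : dyad i (b - e) = dyad (i ⊓ j) (b - e) * dyad (i - i ⊓ j) (b - e) := by
          rw [← dyad_add_index, h1]
        have hc := dyad_mul_neg (i - i ⊓ j) (b - e)
        rw [neg_sub] at hc
        rw [ha, hb, sub_eq_add_neg b e, dyad_add (i ⊓ j), ← sub_eq_add_neg b e]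
        calc _ = dyad (i ⊓ j) b * dyad (i ⊓ j) (-e) * 1 * dyad (j - i ⊓ j) b := by ring
          _ = _ := by rw [← hc]; simp only [hE]; ring
    _ ≤ ∑' q : (Fin n → ℕ) × (Fin n → ℕ), dyad i (b - e) * (dyad q.1 (e - b) * dyad q.2 b) :=
        ENNReal.tsum_comp_le_tsum_of_injective hinj
          fun q => dyad i (b - e) * (dyad q.1 (e - b) * dyad q.2 b)
    _ = _ := by
        rw [ENNReal.tsum_prod']
        simp only [ENNReal.tsum_mul_left, ENNReal.tsum_mul_right]
        ring

/-- The dyadic norms of the test functions. The condition `m + 1 > α + 1 / p` makes the terms with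
`j ≥ i` and those with `j ≤ i` both sum up to their value at `j = i`. -/
theorem exists_dyadicNorm_kernelFun_le (n : ℕ) {m : ℕ} {p τ α : ℝ} (hp : 0 < p) (hτ : 0 < τ)
    (hα : 0 < α) (hδ : 0 < (m : ℝ) + 1 - α - 1 / p) : ∃ C : ℝ≥0∞, C ≠ ⊤ ∧ ∀ i : Fin n → ℕ,
      dyadicNorm p τ α (kernelFun m fun l => (boxMid i l : ℂ)) ≤
        C * dyad i (-(((m : ℝ) + 1 - α - 1 / p) * τ)) := by
  have hκ : 1 < ((m : ℝ) + 1) * p := by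
    have h1 : 1 / p < (m : ℝ) + 1 := by linarith
    rwa [div_lt_iff₀ hp] at h1
  obtain ⟨C, hC, h⟩ := exists_powerMean_kernelFun_le n m hp hκ
  set e : ℝ := (((m : ℝ) + 1) * p - 1) * (τ / p) with he
  have heq : e - α * τ = ((m : ℝ) + 1 - α - 1 / p) * τ := by rw [he]; field_simp; ring
  have he0 : 0 < e - α * τ := by rw [heq]; positivity
  have hτp : 0 ≤ τ / p := by positivity
  refine ⟨C ^ (τ / p) * ((∑' u : Fin n → ℕ, dyad u (e - α * τ)) *
    (∑' v : Fin n → ℕ, dyad v (α * τ))), ENNReal.mul_ne_top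
      (ENNReal.rpow_ne_top_of_nonneg hτp hC) (ENNReal.mul_ne_top (tsum_dyad_ne_top n he0)
        (tsum_dyad_ne_top n (by positivity))), fun i => ?_⟩
  calc _ ≤ ∑' j, C ^ (τ / p) * (dyad j (α * τ) * dyad (i ⊓ j) (-e)) := by
        refine ENNReal.tsum_le_tsum fun j => ?_
        calc _ ≤ dyad j (α * τ) * (C * dyad (i ⊓ j) (1 - ((m : ℝ) + 1) * p)) ^ (τ / p) := by
              gcongr
              exact h i j
          _ = _ := by
              rw [ENNReal.mul_rpow_of_nonneg _ _ hτp, dyad_rpow, he, ← neg_mul, neg_sub]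
              ring
    _ = C ^ (τ / p) * ∑' j, dyad j (α * τ) * dyad (i ⊓ j) (-e) := ENNReal.tsum_mul_left
    _ ≤ C ^ (τ / p) * ((∑' u : Fin n → ℕ, dyad u (e - α * τ)) *
          (∑' v : Fin n → ℕ, dyad v (α * τ)) * dyad i (α * τ - e)) :=
        mul_le_mul_right (tsum_dyad_mul_dyad_inf_le _ _ i) _
    _ = _ := by rw [← heq, neg_sub]; ring

/-! ### Series of dilations -/

theorem dilate_mem_polydisc {r : Fin n → ℝ} (hr : r ∈ radii n) {z : Fin n → ℂ}
    (hz : z ∈ polydisc n) : (fun i => (r i : ℂ) * z i) ∈ polydisc n := fun i => by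
  rw [norm_mul, Complex.norm_real, Real.norm_eq_abs, abs_of_nonneg (hr i).1]
  exact mul_lt_one_of_nonneg_of_lt_one_left (hr i).1 (hr i).2 (hz i).le

theorem HasExpansion.norm_dilate_le {B : (Fin n → ℂ) → ℂ} {b : (Fin n → ℕ) → ℂ}
    (hB : HasExpansion B b) {r : Fin n → ℝ} (hr : r ∈ radii n) {z : Fin n → ℂ}
    (hz : z ∈ polydisc n) :
    ‖B fun i => (r i : ℂ) * z i‖ ≤ ∑' l, ‖b l * monom l z‖ := by
  have h1 := hB _ (dilate_mem_polydisc hr hz)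
  rw [← h1.tsum_eq]
  refine (norm_tsum_le_tsum_norm h1.summable.norm).trans ?_
  refine h1.summable.norm.tsum_le_tsum (fun l => ?_) (hB z hz).summable.norm
  rw [monom_mul, norm_mul, norm_mul, norm_mul]
  have := norm_monom_le_one l (radii_subset_Icc hr)
  gcongr
  exact mul_le_of_le_one_left (norm_nonneg _) this

/-- The moments `∑ₖ vₖ rₖ ^ l` of a sequence of point masses. -/
def moment (v : ℕ → ℂ) (r : ℕ → Fin n → ℝ) (l : Fin n → ℕ) : ℂ :=
  ∑' k, v k * monom l fun i => (r k i : ℂ)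

/-- Superpositions of dilations multiply the coefficients by moments. -/
theorem HasExpansion.tsum_dilate {B : (Fin n → ℂ) → ℂ} {b : (Fin n → ℕ) → ℂ}
    (hB : HasExpansion B b) {v : ℕ → ℂ} (hv : Summable fun k => ‖v k‖) {r : ℕ → Fin n → ℝ}
    (hr : ∀ k, r k ∈ radii n) :
    HasExpansion (fun z => ∑' k, v k * B fun i => (r k i : ℂ) * z i)
      fun l => b l * moment v r l := by
  intro z hz
  set F : ℕ × (Fin n → ℕ) → ℂ := fun q =>
    v q.1 * (b q.2 * ((monom q.2 fun i => (r q.1 i : ℂ)) * monom q.2 z)) with hF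
  have hFs : Summable F := by
    refine Summable.of_norm_bounded
      (hv.mul_of_nonneg (hB z hz).summable.norm (fun _ => norm_nonneg _) fun _ => norm_nonneg _)
      fun q => ?_
    rw [hF]
    simp only [norm_mul]
    have := norm_monom_le_one q.2 (radii_subset_Icc (hr q.1))
    gcongr
    exact mul_le_of_le_one_left (norm_nonneg _) this
  have h1 := hFs.hasSum.prod_fiberwise (g := fun k => v k * B fun i => (r k i : ℂ) * z i)
    fun k => by
      have h := (hB _ (dilate_mem_polydisc (hr k) hz)).mul_left (v k)
      simp only [monom_mul] at h
      exact h
  have hmom : ∀ l, HasSum (fun k => F (k, l)) (b l * moment v r l * monom l z) := fun l => by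
    have hs : Summable fun k => v k * monom l fun i => (r k i : ℂ) :=
      Summable.of_norm_bounded hv fun k => by
        rw [norm_mul]
        exact mul_le_of_le_one_right (norm_nonneg _)
          (norm_monom_le_one l (radii_subset_Icc (hr k)))
    refine ((hs.hasSum.mul_left (b l)).mul_right (monom l z)).congr_fun fun k => ?_
    simp only [hF]
    ring
  have h2 := ((Equiv.prodComm (Fin n → ℕ) ℕ).hasSum_iff.2 hFs.hasSum).prod_fiberwise
    (g := fun l => b l * moment v r l * monom l z) hmom
  simp only
  rw [h1.tsum_eq]
  exact h2

theorem enorm_tsum_rpow_le {p : ℝ} (hp : 0 < p) (hp1 : p ≤ 1) (u : ℕ → ℂ) :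
    ‖∑' k, u k‖ₑ ^ p ≤ ∑' k, ‖u k‖ₑ ^ p :=
  (ENNReal.rpow_le_rpow enorm_tsum_le_tsum_enorm hp.le).trans (rpow_tsum_le_tsum_rpow _ hp hp1)

theorem measurable_enorm_rpow_torus {f : (Fin n → ℂ) → ℂ} (hf : f ∈ holo n) {R : Fin n → ℝ}
    (hR : R ∈ radii n) (p : ℝ) : Measurable fun θ => ‖f (torusPoint R θ)‖ₑ ^ p :=
  (continuous_comp_torusPoint hf hR).measurable.enorm.pow_const p

theorem powerMean_tsum_le {p : ℝ} (hp : 0 < p) (hp1 : p ≤ 1) (v : ℕ → ℂ)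
    {F : ℕ → (Fin n → ℂ) → ℂ} (hF : ∀ k, F k ∈ holo n) {R : Fin n → ℝ} (hR : R ∈ radii n) :
    powerMean p (fun z => ∑' k, v k * F k z) R ≤ ∑' k, ‖v k‖ₑ ^ p * powerMean p (F k) R := by
  calc _ ≤ ∫⁻ θ, ∑' k, ‖v k‖ₑ ^ p * ‖F k (torusPoint R θ)‖ₑ ^ p := by
        refine lintegral_mono fun θ => (enorm_tsum_rpow_le hp hp1 _).trans (le_of_eq ?_)
        simp only [enorm_mul, ENNReal.mul_rpow_of_nonneg _ _ hp.le]
    _ = _ := by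
        rw [lintegral_tsum fun k =>
          ((measurable_enorm_rpow_torus (hF k) hR p).const_mul _).aemeasurable]
        refine tsum_congr fun k => ?_
        rw [lintegral_const_mul _ (measurable_enorm_rpow_torus (hF k) hR p)]
        rfl

theorem dyadicNorm_tsum_le {p τ : ℝ} (α : ℝ) (hp : 0 < p) (hp1 : p ≤ 1) (hτ : 0 < τ) (hτp : τ ≤ p)
    (v : ℕ → ℂ) {F : ℕ → (Fin n → ℂ) → ℂ} (hF : ∀ k, F k ∈ holo n) :
    dyadicNorm p τ α (fun z => ∑' k, v k * F k z) ≤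
      ∑' k, ‖v k‖ₑ ^ τ * dyadicNorm p τ α (F k) := by
  have hq : 0 < τ / p := by positivity
  calc _ ≤ ∑' j, ∑' k, ‖v k‖ₑ ^ τ * (dyad j (α * τ) * powerMean p (F k) (boxMid j) ^ (τ / p)) := by
        refine ENNReal.tsum_le_tsum fun j => ?_
        calc _ ≤ dyad j (α * τ) *
              (∑' k, ‖v k‖ₑ ^ p * powerMean p (F k) (boxMid j)) ^ (τ / p) := by
              gcongr
              exact powerMean_tsum_le hp hp1 v hF (boxMid_mem_radii j)
          _ ≤ dyad j (α * τ) *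
              ∑' k, (‖v k‖ₑ ^ p * powerMean p (F k) (boxMid j)) ^ (τ / p) := by
              gcongr
              exact rpow_tsum_le_tsum_rpow _ hq ((div_le_one hp).2 hτp)
          _ = _ := by
              rw [← ENNReal.tsum_mul_left]
              refine tsum_congr fun k => ?_
              rw [ENNReal.mul_rpow_of_nonneg _ _ hq.le, ← ENNReal.rpow_mul,
                mul_div_cancel₀ _ hp.ne']
              ring
    _ = _ := by
        rw [ENNReal.tsum_comm]
        exact tsum_congr fun k => ENNReal.tsum_mul_left

/-! ### Membership of the superposed test functions -/

theorem tsum_two_rpow_ne_top {b : ℝ} (hb : 0 < b) :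
    ∑' k : ℕ, (2 : ℝ≥0∞) ^ (-((k : ℝ) * b)) ≠ ⊤ := by
  have h : ∀ k : ℕ, (2 : ℝ≥0∞) ^ (-((k : ℝ) * b)) = ((2 : ℝ≥0∞) ^ (-b)) ^ k := fun k => by
    rw [← ENNReal.rpow_natCast, ← ENNReal.rpow_mul]
    congr 1
    ring
  simp only [h]
  rw [ENNReal.tsum_geometric]
  refine ENNReal.inv_ne_top.2 ?_
  rw [ne_eq, tsub_eq_zero_iff_le, not_le]
  exact ENNReal.rpow_lt_one_of_one_lt_of_neg (by norm_num) (by linarith)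

theorem dyad_le_one (j : Fin n → ℕ) {a : ℝ} (ha : 0 ≤ a) : dyad j a ≤ 1 := by
  rw [dyad]
  have h : -(a * ∑ i, (j i : ℝ)) ≤ 0 := neg_nonpos.2 (by positivity)
  exact (ENNReal.rpow_le_rpow_of_exponent_le (by norm_num) h).trans_eq ENNReal.rpow_zero

/-- The amplitudes with which the test functions are superposed: `dyad (j k) δ` normalises the test
function with index `j k` in `A^{p,τ}_α` when `δ = m + 1 - α - 1 / p`, and the factor `2 ^ (-k / τ)`
makes the `τ`-th powers of the norms summable. -/
def IsAmplitude (τ δ : ℝ) (j : ℕ → Fin n → ℕ) (v : ℕ → ℂ) : Prop :=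
  ∀ k, ‖v k‖ₑ ≤ 2 ^ (-((k : ℝ) * (1 / τ))) * dyad (j k) δ

theorem IsAmplitude.summable {τ δ : ℝ} (hτ : 0 < τ) (hδ : 0 ≤ δ) {j : ℕ → Fin n → ℕ} {v : ℕ → ℂ}
    (h : IsAmplitude τ δ j v) : Summable fun k => ‖v k‖ := by
  have h1 : ∑' k, ‖v k‖ₑ ≠ ⊤ := by
    refine ne_top_of_le_ne_top (tsum_two_rpow_ne_top (b := 1 / τ) (by positivity))
      (ENNReal.tsum_le_tsum fun k => (h k).trans ?_)
    exact mul_le_of_le_one_right' (dyad_le_one _ hδ)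
  have h2 := ENNReal.summable_toReal h1
  simpa using h2

/-- The superposition of the test functions attached to the dyadic radii with indices `j k`. -/
def testSeries (m : ℕ) (j : ℕ → Fin n → ℕ) (v : ℕ → ℂ) (z : Fin n → ℂ) : ℂ :=
  ∑' k, v k * kernelFun m (fun i => (boxMid (j k) i : ℂ)) z

theorem kernelFun_dilate (m : ℕ) (r : Fin n → ℝ) (z : Fin n → ℂ) :
    kernelFun m (fun _ => 1) (fun i => (r i : ℂ) * z i) = kernelFun m (fun i => (r i : ℂ)) z := by
  simp [kernelFun]

/-- The coefficients of the superposition are those of `∏ᵢ (1 - zᵢ) ^ (-(m + 1))` times moments. Hence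
its Hadamard product with `c` is the same superposition of dilations of `fracDeriv m c`. -/
theorem hasExpansion_testSeries (m : ℕ) (j : ℕ → Fin n → ℕ) {v : ℕ → ℂ}
    (hv : Summable fun k => ‖v k‖) :
    HasExpansion (testSeries m j v) fun l =>
      binomCoeff m l * moment v (fun k => boxMid (j k)) l := by
  have h := (hasExpansion_binomCoeff n m).tsum_dilate hv (r := fun k => boxMid (j k))
    fun k => boxMid_mem_radii _
  simp only [kernelFun_dilate] at h
  exact h

theorem kernelFun_boxMid_mem_holo (m : ℕ) (j : Fin n → ℕ) :
    (kernelFun m fun i => (boxMid j i : ℂ)) ∈ holo n :=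
  holo_of_hasExpansion (hasExpansion_kernelFun m fun i => by
    have h := boxMid_mem_radii j i
    rw [Complex.norm_real, Real.norm_eq_abs, abs_of_nonneg h.1]
    exact h.2.le)

theorem IsAmplitude.tsum_dyadicNorm_ne_top {m : ℕ} {p τ α : ℝ} (hp : 0 < p) (hτ : 0 < τ)
    (hα : 0 < α) (hδ : 0 < (m : ℝ) + 1 - α - 1 / p) {j : ℕ → Fin n → ℕ} {v : ℕ → ℂ}
    (h : IsAmplitude τ ((m : ℝ) + 1 - α - 1 / p) j v) :
    ∑' k, ‖v k‖ₑ ^ τ * dyadicNorm p τ α (kernelFun m fun i => (boxMid (j k) i : ℂ)) ≠ ⊤ := by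
  obtain ⟨C, hC, hker⟩ := exists_dyadicNorm_kernelFun_le n hp hτ hα hδ
  refine ne_top_of_le_ne_top (ENNReal.mul_ne_top (tsum_two_rpow_ne_top one_pos) hC) ?_
  rw [← ENNReal.tsum_mul_right]
  refine ENNReal.tsum_le_tsum fun k => ?_
  calc _ ≤ (2 ^ (-((k : ℝ) * (1 / τ))) * dyad (j k) ((m : ℝ) + 1 - α - 1 / p)) ^ τ *
        (C * dyad (j k) (-(((m : ℝ) + 1 - α - 1 / p) * τ))) := by
        gcongr
        exacts [h k, hker _]
    _ = 2 ^ (-((k : ℝ) * 1)) * C * (dyad (j k) (((m : ℝ) + 1 - α - 1 / p) * τ) *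
        dyad (j k) (-(((m : ℝ) + 1 - α - 1 / p) * τ))) := by
        rw [ENNReal.mul_rpow_of_nonneg _ _ hτ.le, dyad_rpow, ← ENNReal.rpow_mul,
          show -((k : ℝ) * (1 / τ)) * τ = -((k : ℝ) * 1) by field_simp]
        ring
    _ = _ := by rw [dyad_mul_neg, mul_one]

theorem dyadicNorm_testSeries_lt_top {m : ℕ} {p τ α : ℝ} (hp : 0 < p) (hp1 : p ≤ 1) (hτ : 0 < τ)
    (hτp : τ ≤ p) (hα : 0 < α) (hδ : 0 < (m : ℝ) + 1 - α - 1 / p) {j : ℕ → Fin n → ℕ} {v : ℕ → ℂ}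
    (h : IsAmplitude τ ((m : ℝ) + 1 - α - 1 / p) j v) :
    dyadicNorm p τ α (testSeries m j v) < ⊤ :=
  lt_top_iff_ne_top.2 (ne_top_of_le_ne_top (h.tsum_dyadicNorm_ne_top hp hτ hα hδ)
    (dyadicNorm_tsum_le α hp hp1 hτ hτp v fun _ => kernelFun_boxMid_mem_holo m _))

theorem testSeries_mem_mixedNormSpace {m : ℕ} {p q α : ℝ} (hp : 0 < p) (hp1 : p ≤ 1) (hq : 0 < q)
    (hα : 0 < α) (hδ : 0 < (m : ℝ) + 1 - α - 1 / p) {j : ℕ → Fin n → ℕ} {v : ℕ → ℂ}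
    (h : IsAmplitude (min p q) ((m : ℝ) + 1 - α - 1 / p) j v) :
    testSeries m j v ∈ mixedNormSpace n p q α := by
  have hτ : 0 < min p q := lt_min hp hq
  have hh := holo_of_hasExpansion (hasExpansion_testSeries m j (h.summable hτ hδ.le))
  have h1 := dyadicNorm_testSeries_lt_top hp hp1 hτ (min_le_left _ _) hα hδ h
  rw [mem_mixedNormSpace_iff hh hp hq]
  exact (dyadicNorm_le_rpow p α hτ (min_le_right _ _) _).trans_lt
    (ENNReal.rpow_lt_top_of_nonneg (by positivity) h1.ne)

/-- The test functions are almost increasing in the radii. -/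
theorem enorm_kernelFun_rpow_le {m : ℕ} {p : ℝ} (hp : 0 < p) {r R R' : Fin n → ℝ}
    (hr : r ∈ radii n) (hR : R ∈ radii n) (hR' : R' ∈ radii n) (h : R ≤ R')
    (θ : UnitAddTorus (Fin n)) :
    ‖kernelFun m (fun i => (r i : ℂ)) (torusPoint R θ)‖ₑ ^ p ≤
      (2 ^ (((m : ℝ) + 1) * p)) ^ n *
        ‖kernelFun m (fun i => (r i : ℂ)) (torusPoint R' θ)‖ₑ ^ p := by
  rw [enorm_kernelFun_rpow m hp hr hR, enorm_kernelFun_rpow m hp hr hR']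
  set κ := ((m : ℝ) + 1) * p with hκ
  have hκ0 : 0 < κ := by positivity
  have h1 : ∀ i, ‖1 - ((r i * R i : ℝ) : ℂ) * (AddCircle.toCircle (θ i) : ℂ)‖ₑ ^ (-κ) ≤
      2 ^ κ * ‖1 - ((r i * R' i : ℝ) : ℂ) * (AddCircle.toCircle (θ i) : ℂ)‖ₑ ^ (-κ) := by
    intro i
    have hz : ‖((r i * R' i : ℝ) : ℂ) * (AddCircle.toCircle (θ i) : ℂ)‖ ≤ 1 := by
      rw [norm_mul, Circle.norm_coe, mul_one, Complex.norm_real, Real.norm_eq_abs,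
        abs_of_nonneg (mul_nonneg (hr i).1 (hR' i).1)]
      exact mul_le_one₀ (hr i).2.le (hR' i).1 (hR' i).2.le
    have h2 := norm_one_sub_le_two_mul hz (l := R i / R' i) (div_nonneg (hR i).1 (hR' i).1)
      (div_le_one_of_le₀ (h i) (hR' i).1)
    have h3 : ((R i / R' i : ℝ) : ℂ) * (((r i * R' i : ℝ) : ℂ) * (AddCircle.toCircle (θ i) : ℂ)) =
        ((r i * R i : ℝ) : ℂ) * (AddCircle.toCircle (θ i) : ℂ) := by
      rw [← mul_assoc, ← Complex.ofReal_mul]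
      congr 2
      rcases eq_or_ne (R' i) 0 with h0 | h0
      · have h4 : R i = 0 := le_antisymm (h0 ▸ h i) (hR i).1
        rw [h4]; simp
      · field_simp
    rw [h3] at h2
    have h5 : ‖1 - ((r i * R' i : ℝ) : ℂ) * (AddCircle.toCircle (θ i) : ℂ)‖ₑ ≤
        2 * ‖1 - ((r i * R i : ℝ) : ℂ) * (AddCircle.toCircle (θ i) : ℂ)‖ₑ := by
      rw [← ofReal_norm, ← ofReal_norm, ← ENNReal.ofReal_ofNat,
        ← ENNReal.ofReal_mul (by norm_num)]
      exact ENNReal.ofReal_le_ofReal h2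
    set w := ‖1 - ((r i * R i : ℝ) : ℂ) * (AddCircle.toCircle (θ i) : ℂ)‖ₑ
    calc w ^ (-κ) = 2 ^ κ * (2 * w) ^ (-κ) := by
          rw [ENNReal.mul_rpow_of_ne_top (by norm_num) enorm_ne_top, ← mul_assoc,
            ← ENNReal.rpow_add _ _ (by norm_num) (by norm_num), add_neg_cancel,
            ENNReal.rpow_zero, one_mul]
      _ ≤ _ := by
          rw [ENNReal.rpow_neg, ENNReal.rpow_neg _ κ]
          gcongr
  refine (Finset.prod_le_prod' fun i _ => h1 i).trans ?_
  rw [Finset.prod_mul_distrib, Finset.prod_const, Finset.card_univ, Fintype.card_fin]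

/-- Membership in `F^{p,q}_α` for `p ≤ q`. The embedding of `A^{p,p}_α` is needed only for
superpositions of test functions. These are almost increasing in the radii at each fixed angle, so
that the inner integral over a dyadic box is controlled by the values at one radius. -/
theorem testSeries_mem_lizorkinTriebelSpace_of_le {m : ℕ} {p q α : ℝ} (hp : 0 < p)
    (hp1 : p ≤ 1) (hpq : p ≤ q) (hα : 0 < α) (hδ : 0 < (m : ℝ) + 1 - α - 1 / p)
    {j : ℕ → Fin n → ℕ} {v : ℕ → ℂ} (h : IsAmplitude p ((m : ℝ) + 1 - α - 1 / p) j v) :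
    testSeries m j v ∈ lizorkinTriebelSpace n p q α := by
  have hq : 0 < q := hp.trans_le hpq
  have hh := holo_of_hasExpansion (hasExpansion_testSeries m j (h.summable hp hδ.le))
  rw [mem_lizorkinTriebelSpace_iff hh]
  set f := testSeries m j v with hf
  set ker : ℕ → (Fin n → ℂ) → ℂ := fun k => kernelFun m fun i => (boxMid (j k) i : ℂ) with hker
  have hkh : ∀ k, ker k ∈ holo n := fun k => kernelFun_boxMid_mem_holo m _
  obtain ⟨K, hK, hbox⟩ := exists_boxInt_comparable n (α * q - 1)
  obtain ⟨K2, hK2, hsh⟩ := exists_dyad_le_dyad_shift n 1 (α * p)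
  set D : ℝ≥0∞ := (2 ^ (((m : ℝ) + 1) * p)) ^ n with hD
  have hDt : D ≠ ⊤ := ENNReal.pow_ne_top (ENNReal.rpow_ne_top_of_nonneg (by positivity)
    (by norm_num))
  have hpq0 : 0 < p / q := by positivity
  set S : (Fin n → ℕ) → UnitAddTorus (Fin n) → ℝ≥0∞ := fun i θ =>
    ∑' k, ‖v k‖ₑ ^ p * ‖ker k (torusPoint (boxMid (shift i 1)) θ)‖ₑ ^ p with hS
  have h1 : ∀ i θ, ∀ R ∈ dyadicBox i, ‖f (torusPoint R θ)‖ₑ ^ q ≤ (D * S i θ) ^ (q / p) := by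
    intro i θ R hR
    have hb : ‖f (torusPoint R θ)‖ₑ ^ p ≤ D * S i θ := by
      refine (enorm_tsum_rpow_le hp hp1 _).trans ?_
      rw [hS, ← ENNReal.tsum_mul_left]
      refine ENNReal.tsum_le_tsum fun k => ?_
      rw [enorm_mul, ENNReal.mul_rpow_of_nonneg _ _ hp.le, mul_left_comm D]
      gcongr
      exact enorm_kernelFun_rpow_le hp (boxMid_mem_radii _) (dyadicBox_subset_radii i hR)
        (boxMid_mem_radii _) (le_boxMid_shift hR) θ
    calc _ = (‖f (torusPoint R θ)‖ₑ ^ p) ^ (q / p) := by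
          rw [← ENNReal.rpow_mul, mul_div_cancel₀ _ hp.ne']
      _ ≤ _ := by gcongr
  have h2 : ∀ i θ, boxInt q (α * q - 1) f i θ ^ (p / q) ≤
      K ^ (p / q) * dyad i (α * p) * (D * S i θ) := by
    intro i θ
    have h3 : boxInt q (α * q - 1) f i θ ≤ K * dyad i (α * q) * (D * S i θ) ^ (q / p) := by
      calc _ ≤ K * dyad i (α * q - 1) * ∫⁻ R in dyadicBox i, ‖f (torusPoint R θ)‖ₑ ^ q :=
            (hbox q f i θ).1
        _ ≤ K * dyad i (α * q - 1) * ((D * S i θ) ^ (q / p) * dyad i 1) := by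
            gcongr
            refine (setLIntegral_mono' (measurableSet_dyadicBox i) (h1 i θ)).trans ?_
            rw [setLIntegral_const]
            gcongr
            exact volume_dyadicBox_le i
        _ = _ := by
            rw [show α * q = α * q - 1 + 1 by ring, dyad_add i _ 1]
            simp only [add_sub_cancel_right]
            ring
    calc _ ≤ (K * dyad i (α * q) * (D * S i θ) ^ (q / p)) ^ (p / q) := by gcongr
      _ = _ := by
          rw [ENNReal.mul_rpow_of_nonneg _ _ hpq0.le, ENNReal.mul_rpow_of_nonneg _ _ hpq0.le,
            dyad_rpow, ← ENNReal.rpow_mul (D * S i θ), show q / p * (p / q) = 1 by field_simp,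
            ENNReal.rpow_one, show α * q * (p / q) = α * p by field_simp]
  have hSm : ∀ i, Measurable (S i) := fun i => Measurable.tsum fun k =>
    (measurable_enorm_rpow_torus (hkh k) (boxMid_mem_radii _) p).const_mul _
  have hSi : ∀ i, ∫⁻ θ, S i θ = ∑' k, ‖v k‖ₑ ^ p * powerMean p (ker k) (boxMid (shift i 1)) := by
    intro i
    rw [hS, lintegral_tsum fun k =>
      ((measurable_enorm_rpow_torus (hkh k) (boxMid_mem_radii _) p).const_mul _).aemeasurable]
    refine tsum_congr fun k => ?_
    rw [lintegral_const_mul _ (measurable_enorm_rpow_torus (hkh k) (boxMid_mem_radii _) p)]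
    rfl
  have hfin := h.tsum_dyadicNorm_ne_top hp hp hα hδ
  refine lt_top_iff_ne_top.2 (ne_top_of_le_ne_top (ENNReal.mul_ne_top (ENNReal.mul_ne_top
    (ENNReal.mul_ne_top (ENNReal.rpow_ne_top_of_nonneg hpq0.le hK) hDt) hK2) hfin) ?_)
  calc _ ≤ ∫⁻ θ, ∑' i, K ^ (p / q) * dyad i (α * p) * (D * S i θ) :=
        lintegral_mono fun θ => (rpow_tsum_le_tsum_rpow _ hpq0 ((div_le_one hq).2 hpq)).trans
          (ENNReal.tsum_le_tsum fun i => h2 i θ)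
    _ = ∑' i, K ^ (p / q) * dyad i (α * p) *
          (D * ∑' k, ‖v k‖ₑ ^ p * powerMean p (ker k) (boxMid (shift i 1))) := by
        rw [lintegral_tsum fun i => (((hSm i).const_mul _).const_mul _).aemeasurable]
        refine tsum_congr fun i => ?_
        rw [lintegral_const_mul _ ((hSm i).const_mul _), lintegral_const_mul _ (hSm i), hSi]
    _ ≤ ∑' i, ∑' k, K ^ (p / q) * D * K2 * (‖v k‖ₑ ^ p *
          (dyad (shift i 1) (α * p) * powerMean p (ker k) (boxMid (shift i 1)))) := by
        refine ENNReal.tsum_le_tsum fun i => ?_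
        simp only [ENNReal.tsum_mul_left]
        calc _ ≤ K ^ (p / q) * (K2 * dyad (shift i 1) (α * p)) *
              (D * ∑' k, ‖v k‖ₑ ^ p * powerMean p (ker k) (boxMid (shift i 1))) := by
              gcongr
              exact (hsh i).1
          _ = K ^ (p / q) * D * K2 * (dyad (shift i 1) (α * p) *
              ∑' k, ‖v k‖ₑ ^ p * powerMean p (ker k) (boxMid (shift i 1))) := by ring
          _ = _ := by
              rw [← ENNReal.tsum_mul_left (a := dyad (shift i 1) (α * p))]
              simp only [mul_left_comm (dyad (shift i 1) (α * p))]
    _ = K ^ (p / q) * D * K2 * ∑' k, ‖v k‖ₑ ^ p *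
          ∑' i, dyad (shift i 1) (α * p) * powerMean p (ker k) (boxMid (shift i 1)) := by
        rw [ENNReal.tsum_comm]
        simp only [ENNReal.tsum_mul_left]
    _ ≤ _ := by
        refine mul_le_mul_right (ENNReal.tsum_le_tsum fun k => mul_le_mul_right ?_ _) _
        rw [dyadicNorm, div_self hp.ne']
        simp only [ENNReal.rpow_one]
        exact ENNReal.tsum_comp_le_tsum_of_injective (shift_injective 1)
          fun i => dyad i (α * p) * powerMean p (ker k) (boxMid i)

theorem testSeries_mem_lizorkinTriebelSpace {m : ℕ} {p q α : ℝ} (hp : 0 < p) (hp1 : p ≤ 1)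
    (hq : 0 < q) (hα : 0 < α) (hδ : 0 < (m : ℝ) + 1 - α - 1 / p) {j : ℕ → Fin n → ℕ} {v : ℕ → ℂ}
    (h : IsAmplitude (min p q) ((m : ℝ) + 1 - α - 1 / p) j v) :
    testSeries m j v ∈ lizorkinTriebelSpace n p q α := by
  rcases le_total p q with hpq | hqp
  · rw [min_eq_left hpq] at h
    exact testSeries_mem_lizorkinTriebelSpace_of_le hp hp1 hpq hα hδ h
  · rw [min_eq_right hqp] at h
    exact mem_lizorkinTriebelSpace_of_dyadicNorm
      (holo_of_hasExpansion (hasExpansion_testSeries m j (h.summable hq hδ.le))) hq hqp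
      (dyadicNorm_testSeries_lt_top hp hp1 hq hqp hα hδ h)

/-! ### Necessity of the growth condition -/

theorem HasExpansion.eq_of_mem {f₁ f₂ : (Fin n → ℂ) → ℂ} {a : (Fin n → ℕ) → ℂ}
    (h₁ : HasExpansion f₁ a) (h₂ : HasExpansion f₂ a) {z : Fin n → ℂ} (hz : z ∈ polydisc n) :
    f₁ z = f₂ z := (h₁ z hz).unique (h₂ z hz)

/-- The amplitudes selected by a 0-1 sequence, the others being replaced by `0`. -/
def select (w : ℕ → ℂ) (x : ℕ → Bool) (k : ℕ) : ℂ := if x k then w k else 0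

theorem enorm_select_le (w : ℕ → ℂ) (x : ℕ → Bool) (k : ℕ) : ‖select w x k‖ₑ ≤ ‖w k‖ₑ := by
  rw [select]; split_ifs <;> simp

theorem norm_select_le (w : ℕ → ℂ) (x : ℕ → Bool) (k : ℕ) : ‖select w x k‖ ≤ ‖w k‖ := by
  rw [select]; split_ifs <;> simp

/-- The set of 0-1 sequences for which the selected superposition of the dilations of `G` has a
mean at most `M` over a given torus is closed. -/
theorem isClosed_powerMean_select_le {G : (Fin n → ℂ) → ℂ} {b : (Fin n → ℕ) → ℂ}
    (hG : HasExpansion G b) {w : ℕ → ℂ} (hw : Summable fun k => ‖w k‖) {r : ℕ → Fin n → ℝ}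
    (hr : ∀ k, r k ∈ radii n) (t : ℝ) {R : Fin n → ℝ} (hR : R ∈ radii n) (M : ℝ≥0∞) :
    IsClosed {x : ℕ → Bool | powerMean t
      (fun z => ∑' k, select w x k * G fun i => (r k i : ℂ) * z i) R ≤ M} := by
  set H : (ℕ → Bool) → (Fin n → ℂ) → ℂ := fun x z =>
    ∑' k, select w x k * G fun i => (r k i : ℂ) * z i with hH
  have hcont : ∀ z ∈ polydisc n, Continuous fun x => H x z := by
    intro z hz
    refine continuous_tsum (u := fun k => ‖w k‖ * ∑' l, ‖b l * monom l z‖) (fun k => ?_)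
      (hw.mul_right _) fun k x => ?_
    · have h1 : Continuous fun x : ℕ → Bool => select w x k :=
        (continuous_of_discreteTopology (f := fun c : Bool => if c then w k else 0)).comp
          (continuous_apply k)
      exact h1.mul continuous_const
    · rw [norm_mul]
      gcongr
      exacts [norm_select_le w x k, hG.norm_dilate_le (hr k) hz]
  have hmeas : ∀ x, Measurable fun θ => ‖H x (torusPoint R θ)‖ₑ ^ t := fun x =>
    measurable_enorm_rpow_torus (holo_of_hasExpansion (hG.tsum_dilate
      (Summable.of_nonneg_of_le (fun _ => norm_nonneg _) (norm_select_le w x) hw) hr)) hR t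
  refine IsSeqClosed.isClosed fun u x hu hux => ?_
  have h2 : ∀ θ, Filter.Tendsto (fun k => ‖H (u k) (torusPoint R θ)‖ₑ ^ t) Filter.atTop
      (nhds (‖H x (torusPoint R θ)‖ₑ ^ t)) := fun θ =>
    (((hcont _ (torusPoint_mem_polydisc hR θ)).tendsto x).comp hux).enorm.ennrpow_const t
  calc powerMean t (H x) R = ∫⁻ θ, Filter.liminf (fun k => ‖H (u k) (torusPoint R θ)‖ₑ ^ t)
        Filter.atTop := lintegral_congr fun θ => (h2 θ).liminf_eq.symm
    _ ≤ Filter.liminf (fun k => ∫⁻ θ, ‖H (u k) (torusPoint R θ)‖ₑ ^ t) Filter.atTop :=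
        lintegral_liminf_le fun k => hmeas (u k)
    _ ≤ Filter.liminf (fun _ : ℕ => M) Filter.atTop :=
        Filter.liminf_le_liminf (Filter.Eventually.of_forall hu)
    _ = M := Filter.liminf_const M

/-- Flipping one entry of the 0-1 sequence changes the selected superposition by one term. -/
theorem powerMean_le_add_select {G : (Fin n → ℂ) → ℂ} {b : (Fin n → ℕ) → ℂ}
    (hG : HasExpansion G b) {w : ℕ → ℂ} (hw : Summable fun k => ‖w k‖) {r : ℕ → Fin n → ℝ}
    (hr : ∀ k, r k ∈ radii n) {t : ℝ} (ht : 0 < t) (ht1 : t ≤ 1) {R : Fin n → ℝ}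
    (hR : R ∈ radii n) (x : ℕ → Bool) (k : ℕ) :
    ‖w k‖ₑ ^ t * powerMean t G (fun i => R i * r k i) ≤
      powerMean t (fun z => ∑' k, select w x k * G fun i => (r k i : ℂ) * z i) R +
      powerMean t (fun z => ∑' l, select w (Function.update x k (!x k)) l *
        G fun i => (r l i : ℂ) * z i) R := by
  set H : (ℕ → Bool) → (Fin n → ℂ) → ℂ := fun x z =>
    ∑' k, select w x k * G fun i => (r k i : ℂ) * z i with hH
  have hsum : ∀ x, ∀ z ∈ polydisc n,
      Summable fun k => select w x k * G fun i => (r k i : ℂ) * z i := fun x z hz =>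
    Summable.of_norm_bounded (hw.mul_right (∑' l, ‖b l * monom l z‖)) fun k => by
      rw [norm_mul]
      gcongr
      exacts [norm_select_le w x k, hG.norm_dilate_le (hr k) hz]
  have hdiff : ∀ z ∈ polydisc n, ‖w k‖ₑ * ‖G fun i => (r k i : ℂ) * z i‖ₑ =
      ‖H x z - H (Function.update x k (!x k)) z‖ₑ := by
    intro z hz
    rw [hH]
    simp only
    rw [← (hsum x z hz).tsum_sub (hsum _ z hz), tsum_eq_single k]
    · rw [← sub_mul, enorm_mul]
      congr 1
      simp only [select, Function.update_self]
      cases x k <;> simp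
    · intro l hl
      simp [select, Function.update_of_ne hl]
  have hmeas : Measurable fun θ => ‖H x (torusPoint R θ)‖ₑ ^ t :=
    measurable_enorm_rpow_torus (holo_of_hasExpansion (hG.tsum_dilate
      (Summable.of_nonneg_of_le (fun _ => norm_nonneg _) (norm_select_le w x) hw) hr)) hR t
  rw [powerMean, powerMean, powerMean, ← lintegral_add_left hmeas,
    ← lintegral_const_mul _ (measurable_enorm_rpow_torus (holo_of_hasExpansion hG)
      (mul_mem_radii hR (hr k)) t)]
  refine lintegral_mono fun θ => ?_
  have e : torusPoint (fun i => R i * r k i) θ = fun i => (r k i : ℂ) * torusPoint R θ i := by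
    funext i
    rw [torusPoint_apply, torusPoint_apply]
    push_cast
    ring
  simp only [e]
  rw [← ENNReal.mul_rpow_of_nonneg _ _ ht.le, hdiff _ (torusPoint_mem_polydisc hR θ)]
  calc _ ≤ (‖H x (torusPoint R θ)‖ₑ + ‖H (Function.update x k (!x k)) (torusPoint R θ)‖ₑ) ^ t := by
        gcongr
        exact enorm_sub_le
    _ ≤ _ := ENNReal.rpow_add_le_add_rpow _ _ ht.le ht1

/-- Uniform boundedness for multipliers: if all superpositions of the test functions lie in `X`,
the means of the fractional derivative at the squares of the dyadic radii obey the growth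
condition. Boundedness of the multiplier is extracted without a closed graph theorem for
quasi-normed spaces, from a category argument on the Cantor space of 0-1 sequences: flipping one
entry of a sequence isolates a single test function. -/
theorem exists_powerMean_mul_dyad_le {τ α p t s β : ℝ} {m : ℕ} (hτ : 0 < τ) (ht : 0 < t)
    (ht1 : t ≤ 1) (hs : 0 < s) (hδ : 0 < (m : ℝ) + 1 - α - 1 / p)
    {g : (Fin n → ℂ) → ℂ} {c : (Fin n → ℕ) → ℂ} (hgc : HasExpansion g c)
    {X : Set ((Fin n → ℂ) → ℂ)}
    (hX : ∀ (j : ℕ → Fin n → ℕ) (v : ℕ → ℂ), IsAmplitude τ ((m : ℝ) + 1 - α - 1 / p) j v →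
      testSeries m j v ∈ X)
    (hc : c ∈ coeffMultipliers X (lizorkinTriebelSpace n t s β)) :
    ∃ B : ℝ≥0∞, B ≠ ⊤ ∧ ∀ j : Fin n → ℕ,
      dyad j (((m : ℝ) + 1 - 1 / p + β - α) * t) *
        powerMean t (fracDeriv m c) (fun i => boxMid j i * boxMid j i) ≤ B := by
  set δ := (m : ℝ) + 1 - α - 1 / p with hδd
  set G := fracDeriv (n := n) m c with hGd
  have hG : HasExpansion G fun k => binomCoeff m k * c k := hasExpansion_fracDeriv m hgc
  by_contra hcon
  push Not at hcon
  -- The amplitude `2 ^ (-k / τ)` enters the means to the power `t`; the excess by `2 ^ (k t / τ)`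
  -- compensates it and leaves a quantity larger than `k`.
  have hbig : ∀ k : ℕ, ∃ j : Fin n → ℕ, (k : ℝ≥0∞) * 2 ^ ((k : ℝ) * (t / τ)) <
      dyad j (((m : ℝ) + 1 - 1 / p + β - α) * t) *
        powerMean t G (fun i => boxMid j i * boxMid j i) := fun k =>
    hcon _ (ENNReal.mul_ne_top (by finiteness)
      (ENNReal.rpow_ne_top_of_nonneg (by positivity) (by norm_num)))
  choose j hj using hbig
  set A : ℕ → ℝ≥0∞ := fun k => 2 ^ (-((k : ℝ) * (1 / τ))) * dyad (j k) δ with hA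
  have hAt : ∀ k, A k ≠ ⊤ := fun k => ENNReal.mul_ne_top
    (ENNReal.rpow_ne_top_of_ne_zero (by norm_num) (by norm_num)) (dyad_ne_top _ _)
  set w : ℕ → ℂ := fun k => ((A k).toReal : ℂ) with hw
  have hwA : ∀ k, ‖w k‖ₑ = A k := fun k => by
    rw [hw, ← ofReal_norm, Complex.norm_real, Real.norm_eq_abs, abs_of_nonneg ENNReal.toReal_nonneg,
      ENNReal.ofReal_toReal (hAt k)]
  have hwamp : IsAmplitude τ δ j w := fun k => (hwA k).le
  have hws : Summable fun k => ‖w k‖ := hwamp.summable hτ hδ.le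
  set r : ℕ → Fin n → ℝ := fun k => boxMid (j k) with hr
  have hrr : ∀ k, r k ∈ radii n := fun k => boxMid_mem_radii _
  set H : (ℕ → Bool) → (Fin n → ℂ) → ℂ := fun x z =>
    ∑' k, select w x k * G fun i => (r k i : ℂ) * z i with hH
  set E : ℕ → Set (ℕ → Bool) := fun N =>
    ⋂ i : Fin n → ℕ, {x | powerMean t (H x) (boxMid i) ≤ N * dyad i (-(β * t))} with hE
  have hEc : ∀ N, IsClosed (E N) := fun N => isClosed_iInter fun i =>
    isClosed_powerMean_select_le hG hws hrr t (boxMid_mem_radii i) _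
  obtain ⟨q, K, hK, hlow⟩ := exists_powerMean_le_lintegral_boxInt n ht hs β
  have hEU : ⋃ N, E N = univ := by
    refine eq_univ_of_forall fun x => ?_
    have hxa : IsAmplitude τ δ j (select w x) := fun k => (enorm_select_le w x k).trans (hwamp k)
    have hxs := hxa.summable hτ hδ.le
    obtain ⟨h, hhY, hhe⟩ := hc _ (hX j _ hxa) _ (hasExpansion_testSeries m j hxs)
    have hHe := hG.tsum_dilate hxs hrr
    have heq : ∀ z ∈ polydisc n, h z = H x z := fun z hz => by
      refine hhe.eq_of_mem (f₂ := H x) ?_ hz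
      have : (fun l => c l * (binomCoeff m l * moment (select w x) (fun k => boxMid (j k)) l)) =
          fun l => binomCoeff m l * c l * moment (select w x) r l := by
        funext l
        rw [hr]
        ring
      rw [this]
      exact hHe
    have hhh := holo_of_hasExpansion hhe
    have hfin := (mem_lizorkinTriebelSpace_iff hhh t s β).1 hhY
    set L := ∫⁻ θ, (∑' j, boxInt s (β * s - 1) h j θ) ^ (t / s) with hL
    obtain ⟨N, hN⟩ := ENNReal.exists_nat_gt (ENNReal.mul_ne_top hK hfin.ne)
    refine mem_iUnion.2 ⟨N, mem_iInter.2 fun i => ?_⟩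
    have h1 : dyad i (β * t) * powerMean t (H x) (boxMid i) ≤ N := by
      have h2 : powerMean t (H x) (boxMid i) = powerMean t h (boxMid i) :=
        lintegral_congr fun θ => by
          rw [heq _ (torusPoint_mem_polydisc (boxMid_mem_radii i) θ)]
      rw [h2]
      refine (hlow h hhh i).trans (le_trans ?_ hN.le)
      gcongr
      rw [hL]
      have : 0 ≤ t / s := by positivity
      gcongr with θ
      exact ENNReal.le_tsum _
    change powerMean t (H x) (boxMid i) ≤ N * dyad i (-(β * t))
    calc _ = dyad i (β * t) * dyad i (-(β * t)) * powerMean t (H x) (boxMid i) := by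
          rw [dyad_mul_neg, one_mul]
      _ = dyad i (β * t) * powerMean t (H x) (boxMid i) * dyad i (-(β * t)) := by ring
      _ ≤ _ := by gcongr
  obtain ⟨N, x, hx⟩ := nonempty_interior_of_iUnion_of_closed hEc hEU
  have hlim : Filter.Tendsto (fun k => Function.update x k (!x k)) Filter.atTop (nhds x) := by
    refine tendsto_pi_nhds.2 fun l => tendsto_const_nhds.congr' ?_
    filter_upwards [Filter.eventually_gt_atTop l] with k hk
    rw [Function.update_of_ne hk.ne]
  have hev := (hlim.eventually (mem_interior_iff_mem_nhds.1 hx)).and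
    (Filter.eventually_ge_atTop (2 * N))
  obtain ⟨k, hk, hkN⟩ := hev.exists
  have hxE : x ∈ E N := interior_subset hx
  have h1 := powerMean_le_add_select hG hws hrr ht ht1 (boxMid_mem_radii (j k)) x k
  have h2 : powerMean t (H x) (boxMid (j k)) ≤ N * dyad (j k) (-(β * t)) :=
    mem_iInter.1 hxE (j k)
  have h3 : powerMean t (H (Function.update x k (!x k))) (boxMid (j k)) ≤
      N * dyad (j k) (-(β * t)) := mem_iInter.1 hk (j k)
  have h4 : ‖w k‖ₑ ^ t * powerMean t G (fun i => boxMid (j k) i * boxMid (j k) i) ≤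
      (2 * N : ℕ) * dyad (j k) (-(β * t)) := by
    refine h1.trans ((add_le_add h2 h3).trans_eq ?_)
    push_cast
    ring
  have h5 : (k : ℝ≥0∞) < k := by
    calc (k : ℝ≥0∞) = k * 2 ^ ((k : ℝ) * (t / τ)) * 2 ^ (-((k : ℝ) * (t / τ))) := by
          rw [mul_assoc, ← ENNReal.rpow_add _ _ (by norm_num) (by norm_num), add_neg_cancel,
            ENNReal.rpow_zero, mul_one]
      _ < dyad (j k) (((m : ℝ) + 1 - 1 / p + β - α) * t) *
          powerMean t G (fun i => boxMid (j k) i * boxMid (j k) i) *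
            2 ^ (-((k : ℝ) * (t / τ))) :=
          ENNReal.mul_lt_mul_left
            (ENNReal.rpow_pos (by norm_num) (by norm_num)).ne'
            (ENNReal.rpow_ne_top_of_ne_zero (by norm_num) (by norm_num)) (hj k)
      _ = dyad (j k) (β * t) * (‖w k‖ₑ ^ t *
          powerMean t G (fun i => boxMid (j k) i * boxMid (j k) i)) := by
          rw [hwA, hA, ENNReal.mul_rpow_of_nonneg _ _ ht.le, dyad_rpow, ← ENNReal.rpow_mul,
            show ((m : ℝ) + 1 - 1 / p + β - α) * t = β * t + δ * t by rw [hδd]; ring, dyad_add,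
            show -((k : ℝ) * (1 / τ)) * t = -((k : ℝ) * (t / τ)) by ring]
          ring
      _ ≤ dyad (j k) (β * t) * ((2 * N : ℕ) * dyad (j k) (-(β * t))) := by gcongr
      _ = (2 * N : ℕ) * (dyad (j k) (β * t) * dyad (j k) (-(β * t))) := by ring
      _ = (2 * N : ℕ) := by rw [dyad_mul_neg, mul_one]
      _ ≤ k := by exact_mod_cast hkN
  exact lt_irrefl _ h5

/-- The growth condition at the squares of the dyadic radii implies the growth condition at all
radii. -/
theorem iSup_lt_top_of_powerMean_le {t γ : ℝ} (ht : 0 < t) {G : (Fin n → ℂ) → ℂ} (hG : G ∈ holo n)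
    {B : ℝ≥0∞} (hB : B ≠ ⊤) (h : ∀ j : Fin n → ℕ,
      dyad j (γ * t) * powerMean t G (fun i => boxMid j i * boxMid j i) ≤ B) :
    (⨆ r ∈ radii n, integralMean t G r * weight γ r) < ⊤ := by
  obtain ⟨K, hK, hw⟩ := exists_weight_comparable n γ
  obtain ⟨K2, hK2, hsh⟩ := exists_dyad_le_dyad_shift n 2 γ
  refine lt_of_le_of_lt (b := K * K2 * B ^ (1 / t)) (iSup₂_le fun r hr => ?_)
    (ENNReal.mul_ne_top (ENNReal.mul_ne_top hK hK2)
      (ENNReal.rpow_ne_top_of_nonneg (by positivity) hB)).lt_top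
  obtain ⟨j, hj⟩ := mem_iUnion.1 (radii_eq_iUnion ▸ hr)
  have h1 : integralMean t G r ≤
      powerMean t G (fun i => boxMid (shift j 2) i * boxMid (shift j 2) i) ^ (1 / t) := by
    rw [integralMean_eq]
    have hR := boxMid_mem_radii (shift j 2)
    have hmono := powerMean_mono hG ht hr (mul_mem_radii hR hR) fun i => by
      have h2 := sqrt_le_boxMid hj i
      calc r i = Real.sqrt (r i) * Real.sqrt (r i) := (Real.mul_self_sqrt (hr i).1).symm
        _ ≤ _ := mul_self_le_mul_self (Real.sqrt_nonneg _) h2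
    gcongr
  calc _ ≤ powerMean t G (fun i => boxMid (shift j 2) i * boxMid (shift j 2) i) ^ (1 / t) *
        (K * (K2 * dyad (shift j 2) γ)) := by
        gcongr
        refine (hw j r hj).1.trans ?_
        gcongr
        exact (hsh j).1
    _ = K * K2 * (dyad (shift j 2) (γ * t) *
        powerMean t G (fun i => boxMid (shift j 2) i * boxMid (shift j 2) i)) ^ (1 / t) := by
        rw [ENNReal.mul_rpow_of_nonneg _ _ (by positivity), dyad_rpow,
          show γ * t * (1 / t) = γ by field_simp]
        ring
    _ ≤ _ := by
        gcongr
        exact h _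

theorem theorem2 (n : ℕ) (hn : 1 ≤ n) (p q α t s β : ℝ) (m : ℕ)
    (hp : 0 < p) (hq : 0 < q) (hα : 0 < α) (hβ : 0 < β)
    (ht : t ≤ 1) (hts : t / 2 < s) (hst : s ≤ t) (hpqs : max p q ≤ s)
    (hlow : β + 1 / t < α + 1 / p) (hupp : α + 1 / p < 2 / t)
    (hm : 2 / t - 1 < (m : ℝ))
    (g : (Fin n → ℂ) → ℂ) (c : (Fin n → ℕ) → ℂ)
    (hg : g ∈ holo n) (hgc : HasExpansion g c) :
    (c ∈ coeffMultipliers (lizorkinTriebelSpace n p q α) (lizorkinTriebelSpace n t s β) ↔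
      (⨆ r ∈ radii n,
        integralMean t (fracDeriv m c) r * weight (m + 1 - 1 / p + β - α) r) < ⊤) ∧
    (c ∈ coeffMultipliers (mixedNormSpace n p q α) (lizorkinTriebelSpace n t s β) ↔
      (⨆ r ∈ radii n,
        integralMean t (fracDeriv m c) r * weight (m + 1 - 1 / p + β - α) r) < ⊤) := by
  have hps : p ≤ s := (le_max_left _ _).trans hpqs
  have hqs : q ≤ s := (le_max_right _ _).trans hpqs
  have hs : 0 < s := hp.trans_le hps
  have ht0 : 0 < t := hs.trans_le hst
  have hp1 : p ≤ 1 := hps.trans (hst.trans ht)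
  have hδ : 0 < (m : ℝ) + 1 - α - 1 / p := by linarith
  have hm1 : 1 ≤ m := by
    have h1 : 2 ≤ 2 / t := by rw [le_div_iff₀ ht0]; linarith
    have h2 : (0 : ℝ) < m := by linarith
    exact_mod_cast h2
  have hτ : 0 < min p q := lt_min hp hq
  have hG : fracDeriv m c ∈ holo n := holo_of_hasExpansion (hasExpansion_fracDeriv m hgc)
  refine ⟨⟨fun hc => ?_, fun h => ?_⟩, ⟨fun hc => ?_, fun h => ?_⟩⟩
  · obtain ⟨B, hB, hle⟩ := exists_powerMean_mul_dyad_le hτ ht0 ht hs hδ hgc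
      (fun j v hv => testSeries_mem_lizorkinTriebelSpace hp hp1 hq hα hδ hv) hc
    exact iSup_lt_top_of_powerMean_le ht0 hG hB hle
  · exact mem_coeffMultipliers_of_iSup_lt_top hm1 hp (hp.trans_le (le_max_left p q)) hpqs ht hst
      hps hβ hlow hgc h fun f hf => dyadicNorm_lt_top_of_mem_lizorkinTriebelSpace hp hq hf
  · obtain ⟨B, hB, hle⟩ := exists_powerMean_mul_dyad_le hτ ht0 ht hs hδ hgc
      (fun j v hv => testSeries_mem_mixedNormSpace hp hp1 hq hα hδ hv) hc
    exact iSup_lt_top_of_powerMean_le ht0 hG hB hle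
  · exact mem_coeffMultipliers_of_iSup_lt_top hm1 hp hq hqs ht hst hps hβ hlow hgc h
      fun f hf => (mem_mixedNormSpace_iff hf.1 hp hq α).1 hf

end
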